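/- Let $s_k=1+\prod_{j<k}s_j$ be the Sylvester sequence ($2,3,7,43,\dots$), and for $n\ge 0$ put $d_n=\prod_{k=0}^n s_k$ and $d_{n,k}=d_n/s_k$. Give the variables $x_0,\dots,x_n,x_{n+1}$ the weights $d_{n,0},\dots,d_{n,n},1$. For a vector $t=(t_i)$ of complex numbers, indexed by the tuples $i=(i_0,\dots,i_n)$ with $0\le i_k\le s_k-2$ and $w(i):=d_n-\sum_k i_kd_{n,k}>0$, let $$F_t=\sum_{k=0}^n x_k^{s_k}+\sum_i t_i\,x_0^{i_0}\cdots x_n^{i_n}x_{n+1}^{w(i)},$$ a weighted homogeneous polynomial of degree $d_n$; let $X_t=\{F_t=0\}\subset\mathbb P(d_{n,0},\dots,d_{n,n},1)$ over $\mathbb C$, and $D_t=X_t\cap\{x_{n+1}=0\}$. The group $\mathbb C^*$ acts by $(c.t)_i=c^{w(i)}t_i$, and $\mathcal E_n$ is the quotient (weighted projective stack) of the set of $t\neq 0$ by this action. For $m\ge 0$ let $\mathcal O_{X_t}(mD_t)$ be the sheaf of functions regular outside $D_t$ with a pole of order at most $m$ along $D_t$, and let $R(X_t,D_t)=\bigoplus_{m\ge0}H^0(X_t,\mathcal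 O_{X_t}(mD_t))$. Then: 1. If $n\ge1$, then for every $t$ there is an isomorphism of graded $\mathbb C$-algebras $\mathbb C[x_0,\dots,x_{n+1}]/(F_t)\cong R(X_t,D_t)$ that takes $x_{n+1}$ to the canonical section $1\in H^0(X_t,\mathcal O_{X_t}(D_t))$. 2. (Unique normalization by completing powers.) Let $g\in\mathbb C[x_0,\dots,x_{n+1}]$ be weighted homogeneous of degree $d_n$, let $c_k$ be the coefficient of $x_k^{s_k}$ in $g$, and let $a_0,\dots,a_n\in\mathbb C$ satisfy $c_ka_k^{s_k}=1$ for $0\le k\le n$. Then there are unique polynomials $p_0,\dots,p_n$ and a unique $t$ such that each $p_k$ is weighted homogeneous of degree $d_{n,k}$ in the variables $x_{k+1},\dots,x_{n+1}$ and $g(a_0x_0+p_0,\dots,a_nx_n+p_n,x_{n+1})=F_t$. 3. (The section ring determines $F_t$.) Let $n\ge1$. If $y_0,\dots,y_{n+1}\in R(X_t,D_t)$ are homogeneous of degrees $d_{n,0},\dots,d_{n,n},1$ and generate $R(X_t,D_t)$ as a $\mathbb C$-algebra, then the ideal of relations among them is generated by a weighted homogeneous polynomial $g$ of degree $d_n$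 in which every $x_k^{s_k}$, $0\le k\le n$, has a nonzero coefficient. Moreover, such generators with $F_{t'}(y)=0$ exist if and only if $t'=c.t$ for some $c\in\mathbb C^*$. 4. For every isomorphism $\varphi:X_t\to X_{t'}$ over $\mathbb C$, one has $\varphi_*\mathcal O_{X_t}(D_t)\cong\mathcal O_{X_{t'}}(D_{t'})$ if and only if $\varphi^{-1}(D_{t'})=D_t$. 5. For all $t,t'$ the following are equivalent: (a) $t'=c.t$ for some $c\in\mathbb C^*$; (b) the pairs $(X_t,D_t)$ and $(X_{t'},D_{t'})$ are isomorphic over $\mathbb C$; (c) the pairs $(X_t,\mathcal O_{X_t}(D_t))$ and $(X_{t'},\mathcal O_{X_{t'}}(D_{t'}))$ are isomorphic over $\mathbb C$. 6. Consequently, for nonzero $t,t'$ the pairs $(X_t,D_t)$ and $(X_{t'},D_{t'})$ are isomorphic if and only if $t$ and $t'$ define the same point of $\mathcal E_n$. -/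

import Mathlib

noncomputable section

namespace SylvesterPair

open CategoryTheory TopologicalSpace AlgebraicGeometry

/-! ### Divisorial sheaves and section rings -/

/-- `η` is the generic point of an irreducible component of the closed set `D`. -/
def IsGenericPointOf {X : Scheme.{0}} (D : Closeds X) (η : X) : Prop :=
  η ∈ D ∧ ∀ ξ ∈ D, ξ ⤳ η → η ⤳ ξ

/-- The open complement `X ∖ D`, as a scheme. -/
abbrev finitePart {X : Scheme.{0}} (D : Closeds X) : Scheme.{0} :=
  Scheme.Opens.toScheme (X := X) D.compl

/-- The inclusion `X ∖ D ⟶ X`. -/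
abbrev finiteIncl {X : Scheme.{0}} (D : Closeds X) : finitePart D ⟶ X :=
  Scheme.Opens.ι (X := X) D.compl

/-- The ring `𝒪_X(U ∖ D)`, as sections of the structure sheaf of the open subscheme `X ∖ D`. -/
abbrev PuncturedSections {X : Scheme.{0}} (D : Closeds X) (U : X.Opens) : Type :=
  Γ(finitePart D, finiteIncl D ⁻¹ᵁ U)

/-- The restriction `𝒪_X(W) → 𝒪_X(W ∖ D)`. -/
def restrictOff {X : Scheme.{0}} (D : Closeds X) (W : X.Opens) :
    Γ(X, W) →+* PuncturedSections D W :=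
  ((finiteIncl D).app W).hom

/-- The restriction `𝒪_X(U ∖ D) → 𝒪_X(W ∖ D)` for `W ≤ U`. -/
def puncturedRes {X : Scheme.{0}} (D : Closeds X) {W U : X.Opens} (h : W ≤ U) :
    PuncturedSections D U →+* PuncturedSections D W :=
  ((finitePart D).presheaf.map (homOfLE (fun _ hx => h hx) : finiteIncl D ⁻¹ᵁ W ⟶ finiteIncl D ⁻¹ᵁ U).op).hom

/-- The restriction `𝒪_X(U) → 𝒪_X(W)` for `W ≤ U`. -/
def openRes {X : Scheme.{0}} {W U : X.Opens} (h : W ≤ U) : Γ(X, U) →+* Γ(X, W) :=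
  (X.presheaf.map (homOfLE h).op).hom

lemma restrictOff_res {X : Scheme.{0}} (D : Closeds X) {W U : X.Opens} (h : W ≤ U) (a : Γ(X, U)) :
    restrictOff D W (openRes h a) = puncturedRes D h (restrictOff D U a) := by
  have := (finiteIncl D).naturality (homOfLE h).op
  exact congr($(this).hom a)

lemma puncturedRes_comp {X : Scheme.{0}} (D : Closeds X) {W V U : X.Opens} (h : W ≤ V) (h' : V ≤ U)
    (s : PuncturedSections D U) :
    puncturedRes D h (puncturedRes D h' s) = puncturedRes D (h.trans h') s := by
  have := (finitePart D).presheaf.map_comp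
    (homOfLE (fun _ hx => h' hx) : finiteIncl D ⁻¹ᵁ V ⟶ finiteIncl D ⁻¹ᵁ U).op
    (homOfLE (fun _ hx => h hx) : finiteIncl D ⁻¹ᵁ W ⟶ finiteIncl D ⁻¹ᵁ V).op
  exact congr($(this.symm).hom s)

lemma germ_res {X : Scheme.{0}} {W U : X.Opens} (h : W ≤ U) (x : X) (hx : x ∈ W) (a : Γ(X, U)) :
    X.presheaf.germ W x hx (openRes h a) = X.presheaf.germ U x (h hx) a :=
  X.presheaf.germ_res_apply (homOfLE h) x hx a

/-- For a section `s` of `𝒪_X` over `U ∖ D` and a point `η` of `U`, the ideal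
`{α ∈ 𝒪_{X,η} | α s ∈ 𝒪_{X,η}}` of denominators of `s` at `η`: those `α` which are the germ of some `a ∈ 𝒪_X(W)`,
`η ∈ W`, such that `a s` extends from `W ∖ D` to a section `b` over `W`. -/
def denominatorIdeal {X : Scheme.{0}} (D : Closeds X) {U : X.Opens} (s : PuncturedSections D U)
    (η : X) (hη : η ∈ U) : Ideal (X.presheaf.stalk η) where
  carrier := {α | ∃ (W : X.Opens) (hW : W ≤ U) (hηW : η ∈ W) (a b : Γ(X, W)),
    X.presheaf.germ W η hηW a = α ∧ restrictOff D W a * puncturedRes D hW s = restrictOff D W b}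
  zero_mem' := ⟨U, le_rfl, hη, 0, 0, by simp, by simp⟩
  add_mem' := by
    rintro α α' ⟨W, hW, hηW, a, b, rfl, h⟩ ⟨W', hW', hηW', a', b', rfl, h'⟩
    have hm : η ∈ W ⊓ W' := ⟨hηW, hηW'⟩
    refine ⟨W ⊓ W', inf_le_left.trans hW, hm,
      openRes inf_le_left a + openRes inf_le_right a',
      openRes inf_le_left b + openRes inf_le_right b', ?_, ?_⟩
    · rw [map_add, germ_res, germ_res]
    · simp only [map_add, restrictOff_res, ← h, ← h', map_mul, puncturedRes_comp, add_mul]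
  smul_mem' := by
    rintro β α ⟨W, hW, hηW, a, b, rfl, h⟩
    obtain ⟨V, hηV, c, rfl⟩ := X.presheaf.exists_germ_eq β
    have hm : η ∈ V ⊓ W := ⟨hηV, hηW⟩
    refine ⟨V ⊓ W, inf_le_right.trans hW, hm,
      openRes inf_le_left c * openRes inf_le_right a,
      openRes inf_le_left c * openRes inf_le_right b, ?_, ?_⟩
    · rw [map_mul, germ_res, germ_res, smul_eq_mul]
    · simp only [map_mul, restrictOff_res, ← h, puncturedRes_comp, mul_assoc]

/-- `s ∈ 𝒪_X(U ∖ D)` has a pole of order at most `m` along (each component of) `D`: at every generic point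
`η ∈ U` of `D` one has `𝔪_η ^ m · s ⊆ 𝒪_{X,η}`. When `𝒪_{X,η}` is a discrete valuation ring, this says that
the valuation of `s` at `η` is at least `-m`. -/
def PoleOrderLE {X : Scheme.{0}} (D : Closeds X) (m : ℕ) {U : X.Opens}
    (s : PuncturedSections D U) : Prop :=
  ∀ (η : X) (hη : η ∈ U), IsGenericPointOf D η →
    (IsLocalRing.maximalIdeal (X.presheaf.stalk η)) ^ m ≤ denominatorIdeal D s η hη

lemma denominatorIdeal_zero {X : Scheme.{0}} (D : Closeds X) {U : X.Opens} (η : X) (hη : η ∈ U) :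
    denominatorIdeal D (0 : PuncturedSections D U) η hη = ⊤ := by
  rw [Ideal.eq_top_iff_one]
  exact ⟨U, le_rfl, hη, 1, 0, by simp, by simp⟩

lemma denominatorIdeal_restrictOff {X : Scheme.{0}} (D : Closeds X) {U : X.Opens} (a : Γ(X, U))
    (η : X) (hη : η ∈ U) : denominatorIdeal D (restrictOff D U a) η hη = ⊤ := by
  rw [Ideal.eq_top_iff_one]
  exact ⟨U, le_rfl, hη, 1, a, by simp, by simp [← restrictOff_res, openRes]⟩

lemma denominatorIdeal_add {X : Scheme.{0}} (D : Closeds X) {U : X.Opens} (s s' : PuncturedSections D U)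
    (η : X) (hη : η ∈ U) :
    denominatorIdeal D s η hη ⊓ denominatorIdeal D s' η hη ≤ denominatorIdeal D (s + s') η hη := by
  rintro α ⟨⟨W, hW, hηW, a, b, ha, h⟩, ⟨W', hW', hηW', a', b', ha', h'⟩⟩
  obtain ⟨V, hηV, i, i', hi⟩ := X.presheaf.germ_eq η hηW hηW' a a' (ha.trans ha'.symm)
  have e : openRes i.le a = openRes i'.le a' := hi
  refine ⟨V, i.le.trans hW, hηV, openRes i.le a, openRes i.le b + openRes i'.le b', ?_, ?_⟩
  · rw [germ_res, ha]
  · rw [map_add, mul_add, map_add, restrictOff_res D i.le b, ← h, e, restrictOff_res D i'.le b', ← h',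
      ← e]
    simp only [map_mul, puncturedRes_comp, restrictOff_res, ← restrictOff_res D i.le a, e]

lemma denominatorIdeal_mul {X : Scheme.{0}} (D : Closeds X) {U : X.Opens} (s s' : PuncturedSections D U)
    (η : X) (hη : η ∈ U) :
    denominatorIdeal D s η hη * denominatorIdeal D s' η hη ≤ denominatorIdeal D (s * s') η hη := by
  rw [Ideal.mul_le]
  rintro α ⟨W, hW, hηW, a, b, rfl, h⟩ α' ⟨W', hW', hηW', a', b', rfl, h'⟩
  have hm : η ∈ W ⊓ W' := ⟨hηW, hηW'⟩
  refine ⟨W ⊓ W', inf_le_left.trans hW, hm,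
      openRes inf_le_left a * openRes inf_le_right a',
      openRes inf_le_left b * openRes inf_le_right b', ?_, ?_⟩
  · rw [map_mul, germ_res, germ_res]
  · simp only [map_mul, restrictOff_res, ← h, ← h', puncturedRes_comp]
    ring

lemma denominatorIdeal_res {X : Scheme.{0}} (D : Closeds X) {V U : X.Opens} (h : V ≤ U)
    (s : PuncturedSections D U) (η : X) (hη : η ∈ V) :
    denominatorIdeal D (puncturedRes D h s) η hη = denominatorIdeal D s η (h hη) := by
  apply le_antisymm
  · rintro α ⟨W, hW, hηW, a, b, rfl, e⟩
    exact ⟨W, hW.trans h, hηW, a, b, rfl, by rw [← e, puncturedRes_comp]⟩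
  · rintro α ⟨W, hW, hηW, a, b, rfl, e⟩
    refine ⟨V ⊓ W, inf_le_left, ⟨hη, hηW⟩, openRes inf_le_right a, openRes inf_le_right b, germ_res _ _ _ _, ?_⟩
    simp only [restrictOff_res, ← e, puncturedRes_comp, map_mul]

/-- The `𝒪_X`-module `j_* 𝒪_{X ∖ D}`, where `j : X ∖ D ⟶ X` is the inclusion. -/
def puncturedSheaf {X : Scheme.{0}} (D : Closeds X) : X.Modules :=
  (Scheme.Modules.pushforward (finiteIncl D)).obj (SheafOfModules.unit (finitePart D).ringCatSheaf)

/-- The sections of `j_* 𝒪_{X ∖ D}` with poles of order at most `m` along `D`. -/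
def divisorialSubmodule {X : Scheme.{0}} (D : Closeds X) (m : ℕ) :
    PresheafOfModules.Submodule (puncturedSheaf D).val where
  obj U :=
    { carrier := {s | PoleOrderLE D m (U := U.unop) s}
      zero_mem' := by
        intro η hη _
        exact le_top.trans_eq (denominatorIdeal_zero D η hη).symm
      add_mem' := by
        intro s s' h h' η hη hg
        exact (le_inf (h η hη hg) (h' η hη hg)).trans (denominatorIdeal_add D _ _ η hη)
      smul_mem' := by
        intro r s h η hη hg
        have h1 := denominatorIdeal_mul D (restrictOff D U.unop r) s η hη
        rw [denominatorIdeal_restrictOff D (U := U.unop) r η hη, Ideal.top_mul] at h1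
        exact (h η hη hg).trans h1 }
  map {U V} f := by
    intro s h η hη hg
    have := h η (f.unop.le hη) hg
    exact this.trans_eq (denominatorIdeal_res D f.unop.le s η hη).symm

/-- The divisorial sheaf `𝒪_X(mD)`, as a sheaf of `𝒪_X`-modules, for a closed set `D` viewed as a reduced
Weil divisor: the rational functions that are regular outside `D` and have a pole of order at most `m` along
`D`. -/
def divisorialSheaf {X : Scheme.{0}} (D : Closeds X) (m : ℕ) : X.Modules where
  val := (divisorialSubmodule D m).toPresheafOfModules
  isSheaf := by
    change TopCat.Presheaf.IsSheaf (X := X.carrier) (C := Ab) ((divisorialSubmodule D m).toPresheafOfModules.presheaf)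
    rw [TopCat.Presheaf.isSheaf_iff_isSheafUniqueGluing]
    intro ι U sf hsf
    let M : TopCat.Sheaf Ab X.carrier := ⟨(puncturedSheaf D).presheaf, (puncturedSheaf D).isSheaf⟩
    obtain ⟨s, hs, hu⟩ := M.existsUnique_gluing U (fun i => (sf i).1)
      (fun i j => congrArg Subtype.val (hsf i j))
    refine ⟨⟨s, ?_⟩, fun i => Subtype.ext (hs i), fun t ht => Subtype.ext (hu _ fun i => congrArg Subtype.val (ht i))⟩
    intro η hη hg
    obtain ⟨i, hi⟩ := Opens.mem_iSup.mp hη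
    have h1 := (sf i).2 η hi hg
    have h2 : puncturedRes D (le_iSup U i) s = (sf i).1 := hs i
    exact h1.trans_eq ((congrArg (fun z => denominatorIdeal D z η hi) h2.symm).trans
      (denominatorIdeal_res D (le_iSup U i) s η hi))
/-- The section ring `R(X, D) = ⨁_{m ≥ 0} H⁰(X, 𝒪_X(mD))`, realized as the ring of polynomials
`∑ s_m T ^ m` over `𝒪_X(X ∖ D)` with `s_m ∈ H⁰(X, 𝒪_X(mD))`. -/
def sectionRing {X : Scheme.{0}} (D : Closeds X) : Subring (Polynomial (PuncturedSections D ⊤)) where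
  carrier := {p | ∀ m, p.coeff m ∈ (divisorialSubmodule D m).obj (Opposite.op ⊤)}
  zero_mem' m := Submodule.zero_mem _
  one_mem' m := by
    rw [Polynomial.coeff_one]
    split_ifs
    · intro η hη _
      have := denominatorIdeal_restrictOff D (U := ⊤) 1 η hη
      rw [map_one] at this
      exact le_top.trans_eq this.symm
    · exact Submodule.zero_mem _
  add_mem' {p q} hp hq m := by
    rw [Polynomial.coeff_add]
    exact Submodule.add_mem _ (hp m) (hq m)
  neg_mem' {p} hp m := by
    rw [Polynomial.coeff_neg]
    exact Submodule.neg_mem _ (hp m)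
  mul_mem' {p q} hp hq m := by
    rw [Polynomial.coeff_mul]
    refine Submodule.sum_mem _ fun ij hij => ?_
    rw [Finset.HasAntidiagonal.mem_antidiagonal] at hij
    intro η hη hg
    rw [← hij, pow_add]
    exact (Ideal.mul_mono (hp _ η hη hg) (hq _ η hη hg)).trans (denominatorIdeal_mul D _ _ η hη)

/-- The degree `m` part `H⁰(X, 𝒪_X(mD)) T ^ m` of the section ring. -/
def sectionPiece {X : Scheme.{0}} (D : Closeds X) (m : ℕ) : AddSubgroup (sectionRing D) where
  carrier := {p | ∀ k, k ≠ m → p.1.coeff k = 0}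
  zero_mem' k _ := Polynomial.coeff_zero k
  add_mem' {p q} hp hq k hk :=
    (Polynomial.coeff_add p.1 q.1 k).trans (by rw [hp k hk, hq k hk, add_zero])
  neg_mem' {p} hp k hk := (Polynomial.coeff_neg p.1 k).trans (by rw [hp k hk, neg_zero])

/-- The category of schemes over `ℂ`. -/
abbrev ComplexScheme := Over (Spec (CommRingCat.of ℂ))

/-- The structure map `ℂ → H⁰(X, 𝒪_X)`. -/
def globalConst (X : ComplexScheme) : ℂ →+* Γ(X.left, ⊤) :=
  X.hom.appTop.hom.comp (Scheme.ΓSpecIso (CommRingCat.of ℂ)).inv.hom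

/-- The structure map `ℂ → R(X, D)`, with values in degree `0`. -/
def sectionConst (X : ComplexScheme) (D : Closeds X.left) : ℂ →+* sectionRing D :=
  ((Polynomial.C.comp (restrictOff D ⊤)).comp (globalConst X)).codRestrict (sectionRing D) (by
    intro c m
    change (Polynomial.C (restrictOff D ⊤ (globalConst X c))).coeff m ∈ _
    rw [Polynomial.coeff_C]
    split_ifs
    · intro η hη _
      exact le_top.trans_eq (denominatorIdeal_restrictOff D (U := ⊤) _ η hη).symm
    · exact Submodule.zero_mem _)

/-- The pairs `(X, D)` and `(X', D')` are isomorphic over `ℂ` (the divisors being reduced, they are given by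
closed sets). -/
def PairIso (X : ComplexScheme) (D : Closeds X.left) (X' : ComplexScheme) (D' : Closeds X'.left) : Prop :=
  ∃ φ : X ≅ X', (φ.hom.left : X.left → X'.left) ⁻¹' D' = D

/-- The pairs `(X, M)` and `(X', M')` of a scheme over `ℂ` and a sheaf of modules on it are isomorphic: there
is an isomorphism `φ : X ≅ X'` over `ℂ` with `φ_* M ≅ M'` (equivalently, `M ≅ φ^* M'`). -/
def SheafPairIso (X : ComplexScheme) (M : X.left.Modules) (X' : ComplexScheme) (M' : X'.left.Modules) :
    Prop :=
  ∃ φ : X ≅ X', Nonempty ((Scheme.Modules.pushforward φ.hom.left).obj M ≅ M')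

/-! ### Sylvester numbers and the normal form -/

/-- The Sylvester sequence `s_n = 1 + s_0 s_1 ⋯ s_{n-1}`, i.e. `2, 3, 7, 43, …`. -/
def sylvester (n : ℕ) : ℕ := 1 + ∏ k : Fin n, sylvester k
termination_by n
decreasing_by exact k.2

/-- `d_n = s_0 s_1 ⋯ s_n`. -/
def deg (n : ℕ) : ℕ := ∏ k ∈ Finset.range (n + 1), sylvester k

/-- `d_{n,j} = d_n / s_j = ∏_{k ≤ n, k ≠ j} s_k`. -/
def degVar (n j : ℕ) : ℕ := ∏ k ∈ (Finset.range (n + 1)).erase j, sylvester k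

/-- The weights `(d_{n,0}, …, d_{n,n}, 1)` of the variables `x_0, …, x_n, x_{n+1}`. -/
def wt (n : ℕ) : Fin (n + 2) → ℕ := Fin.snoc (α := fun _ => ℕ) (fun k : Fin (n + 1) => degVar n k) 1

/-- The exponents `(i_0, …, i_n)` with `0 ≤ i_k ≤ s_k - 2` and of positive weight, `∑ i_k d_{n,k} < d_n`. -/
def Idx (n : ℕ) : Type :=
  {i : (k : Fin (n + 1)) → Fin (sylvester k - 1) // ∑ k, (i k : ℕ) * degVar n k < deg n}

instance (n : ℕ) : Fintype (Idx n) := by unfold Idx; infer_instance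

/-- The weight `w(i) = d_n - ∑ i_k d_{n,k} > 0`. -/
def Idx.weight {n : ℕ} (i : Idx n) : ℕ := deg n - ∑ k, (i.1 k : ℕ) * degVar n k

/-- The polynomial ring `ℂ[x_0, …, x_{n+1}]`. -/
abbrev PolyRing (n : ℕ) : Type := MvPolynomial (Fin (n + 2)) ℂ

/-- The coefficient vectors `t = (t_i)`. -/
abbrev Params (n : ℕ) : Type := Idx n → ℂ

open MvPolynomial in
/-- The normalized equation
`F_t = ∑_k x_k ^ s_k + ∑_i t_i x_0 ^ i_0 ⋯ x_n ^ i_n x_{n+1} ^ w(i)`. -/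
def normalForm {n : ℕ} (t : Params n) : PolyRing n :=
  ∑ k : Fin (n + 1), X k.castSucc ^ sylvester k +
    ∑ i : Idx n, C (t i) * (∏ k : Fin (n + 1), X k.castSucc ^ (i.1 k : ℕ)) * X (Fin.last (n + 1)) ^ i.weight

lemma wt_castSucc (n : ℕ) (k : Fin (n + 1)) : wt n k.castSucc = degVar n k := by
  simp [wt]

lemma wt_last (n : ℕ) : wt n (Fin.last (n + 1)) = 1 := by
  simp [wt]

lemma sylvester_mul_degVar (n : ℕ) (k : Fin (n + 1)) : sylvester k * degVar n k = deg n :=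
  Finset.mul_prod_erase _ _ (Finset.mem_range.mpr k.2)

open MvPolynomial in
lemma normalForm_isWeightedHomogeneous {n : ℕ} (t : Params n) :
    IsWeightedHomogeneous (wt n) (normalForm t) (deg n) := by
  refine IsWeightedHomogeneous.add (IsWeightedHomogeneous.sum _ _ _ fun k _ => ?_)
    (IsWeightedHomogeneous.sum _ _ _ fun i _ => ?_)
  · have := (isWeightedHomogeneous_X ℂ (wt n) k.castSucc).pow (sylvester k)
    rwa [wt_castSucc, smul_eq_mul, sylvester_mul_degVar] at this
  · have h1 := (isWeightedHomogeneous_C (wt n) (t i)).mul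
      (IsWeightedHomogeneous.prod Finset.univ (fun k : Fin (n + 1) => (X k.castSucc : PolyRing n) ^ (i.1 k : ℕ))
        (fun k => (i.1 k : ℕ) * degVar n k) (fun k _ => by
          have := (isWeightedHomogeneous_X ℂ (wt n) k.castSucc).pow (i.1 k : ℕ)
          rwa [wt_castSucc, smul_eq_mul] at this))
    have h2 := h1.mul ((isWeightedHomogeneous_X ℂ (wt n) (Fin.last (n + 1))).pow i.weight)
    rw [wt_last, smul_eq_mul, mul_one, zero_add] at h2
    have := i.2
    have e : ∑ k, (i.1 k : ℕ) * degVar n k + i.weight = deg n := by unfold Idx.weight; omega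
    rwa [e] at h2

section QuotientGrading

open DirectSum

variable {R A : Type} [CommRing R] [CommRing A] [Algebra R A] (𝒮 : ℕ → Submodule R A) (I : Ideal A)

/-- The image in `A ⧸ I` of the degree `m` part of `A`. -/
def quotientPiece (m : ℕ) : Submodule R (A ⧸ I) :=
  (𝒮 m).map (Ideal.Quotient.mkₐ R I).toLinearMap

instance quotientGradedMonoid [SetLike.GradedMonoid 𝒮] : SetLike.GradedMonoid (quotientPiece 𝒮 I) where
  one_mem := ⟨1, SetLike.GradedOne.one_mem, map_one (Ideal.Quotient.mkₐ R I)⟩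
  mul_mem := by
    rintro i j _ _ ⟨p, hp, rfl⟩ ⟨r, hr, rfl⟩
    exact ⟨p * r, SetLike.GradedMul.mul_mem hp hr, map_mul (Ideal.Quotient.mkₐ R I) p r⟩

/-- The quotient map on degree `m` parts. -/
def toQuotientPiece (m : ℕ) : 𝒮 m →ₗ[R] quotientPiece 𝒮 I m :=
  (Ideal.Quotient.mkₐ R I).toLinearMap.restrict fun p hp => ⟨p, hp, rfl⟩

/-- The map `A → ⨁ (A ⧸ I)_m` sending `p` to the classes of its homogeneous components. -/
def componentClasses [GradedAlgebra 𝒮] : A →ₗ[R] ⨁ m, quotientPiece 𝒮 I m :=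
  DirectSum.lmap (toQuotientPiece 𝒮 I) ∘ₗ (DirectSum.decomposeLinearEquiv 𝒮).toLinearMap

lemma componentClasses_of_mem [GradedAlgebra 𝒮] {m : ℕ} (p : 𝒮 m) :
    componentClasses 𝒮 I p = DirectSum.of (fun m => quotientPiece 𝒮 I m) m (toQuotientPiece 𝒮 I m p) := by
  rw [componentClasses, LinearMap.comp_apply, LinearEquiv.coe_coe, decomposeLinearEquiv_apply,
    decompose_coe]
  exact DirectSum.lmap_lof _ _ _

lemma coe_componentClasses [GradedAlgebra 𝒮] (p : A) :
    DirectSum.coeLinearMap (quotientPiece 𝒮 I) (componentClasses 𝒮 I p) = Ideal.Quotient.mk I p := by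
  induction p using Decomposition.inductionOn 𝒮 with
  | zero => simp
  | @homogeneous i m =>
    rw [componentClasses_of_mem, DirectSum.coeLinearMap_of]
    rfl
  | add p q hp hq => rw [map_add, map_add, hp, hq, map_add]

lemma componentClasses_eq_zero [GradedAlgebra 𝒮] (hI : I.IsHomogeneous 𝒮) (p : A) (hp : p ∈ I) :
    componentClasses 𝒮 I p = 0 :=
  DFinsupp.ext fun m => Subtype.ext (Ideal.Quotient.eq_zero_iff_mem.mpr (hI m hp))

/-- The quotient of a graded algebra by a homogeneous ideal is graded by the images of the graded pieces. -/
abbrev quotientGradedAlgebra [GradedAlgebra 𝒮] (hI : I.IsHomogeneous 𝒮) :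
    GradedAlgebra (quotientPiece 𝒮 I) where
  decompose' := QuotientAddGroup.lift I.toAddSubgroup (componentClasses 𝒮 I).toAddMonoidHom
    (componentClasses_eq_zero 𝒮 I hI)
  left_inv x := by
    obtain ⟨p, rfl⟩ := Ideal.Quotient.mk_surjective x
    exact coe_componentClasses 𝒮 I p
  right_inv x := by
    induction x using DirectSum.induction_on with
    | zero => rw [map_zero]; exact map_zero (QuotientAddGroup.lift _ _ _)
    | of m x =>
      obtain ⟨_, p, hp, rfl⟩ := x
      rw [DirectSum.coeAddMonoidHom_of]
      exact componentClasses_of_mem 𝒮 I ⟨p, hp⟩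
    | add x y hx hy =>
      rw [map_add]
      exact (map_add (QuotientAddGroup.lift _ _ _) _ _).trans (congrArg₂ (· + ·) hx hy)

end QuotientGrading

/-! ### The pairs `(X_t, D_t)` -/

/-- The ring `ℂ[x_0, …, x_{n+1}] / (F_t)`. -/
abbrev CoordRing {n : ℕ} (t : Params n) : Type := PolyRing n ⧸ Ideal.span {normalForm t}

/-- The quotient map `ℂ[x_0, …, x_{n+1}] → ℂ[x_0, …, x_{n+1}] / (F_t)`. -/
def coordMk {n : ℕ} (t : Params n) : PolyRing n →ₐ[ℂ] CoordRing t := Ideal.Quotient.mkₐ ℂ _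

/-- The degree `m` part of `ℂ[x_0, …, x_{n+1}] / (F_t)`. -/
def coordPiece {n : ℕ} (t : Params n) : ℕ → Submodule ℂ (CoordRing t) :=
  quotientPiece (MvPolynomial.weightedHomogeneousSubmodule ℂ (wt n)) (Ideal.span {normalForm t})

open MvPolynomial in
instance coordGradedAlgebra {n : ℕ} (t : Params n) : GradedAlgebra (coordPiece t) :=
  letI : GradedAlgebra (weightedHomogeneousSubmodule ℂ (wt n)) := weightedGradedAlgebra ℂ (wt n)
  quotientGradedAlgebra (weightedHomogeneousSubmodule ℂ (wt n)) (Ideal.span {normalForm t}) <| by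
    apply Ideal.homogeneous_span
    rintro _ rfl
    exact ⟨deg n, normalForm_isWeightedHomogeneous t⟩

/-- The hypersurface `X_t = {F_t = 0} = Proj (ℂ[x_0, …, x_{n+1}] / (F_t))` in the weighted projective space
`ℙ(d_{n,0}, …, d_{n,n}, 1)`, as a scheme over `ℂ`. -/
def hypersurface {n : ℕ} (t : Params n) : ComplexScheme :=
  Over.mk (Proj.toSpecZero (coordPiece t) ≫
    Spec.map (CommRingCat.ofHom (algebraMap ℂ (coordPiece t 0))))

/-- The infinite divisor `D_t = {x_{n+1} = 0} ⊆ X_t`. -/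
def infiniteDivisor {n : ℕ} (t : Params n) : Closeds (hypersurface t).left :=
  Opens.compl (Proj.basicOpen (coordPiece t) (coordMk t (MvPolynomial.X (Fin.last (n + 1)))))

/-- The action of `ℂ^*` on coefficient vectors, `(c.t)_i = c ^ w(i) t_i`. -/
def rescale {n : ℕ} (c : ℂ) (t : Params n) : Params n := fun i => c ^ i.weight * t i

/-- Equivalence of nonzero coefficient vectors under the action of `ℂ^*`. -/
def moduliSetoid (n : ℕ) : Setoid {t : Params n // t ≠ 0} where
  r t t' := ∃ c : ℂ, c ≠ 0 ∧ t'.1 = rescale c t.1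
  iseqv :=
    { refl := fun t => ⟨1, one_ne_zero, by funext i; simp [rescale]⟩
      symm := by
        rintro t t' ⟨c, hc, h⟩
        exact ⟨c⁻¹, inv_ne_zero hc, by rw [h]; funext i; simp [rescale, hc]⟩
      trans := by
        rintro t t' t'' ⟨c, hc, h⟩ ⟨c', hc', h'⟩
        exact ⟨c' * c, mul_ne_zero hc' hc, by rw [h', h]; funext i; simp [rescale, mul_pow, mul_assoc]⟩ }

/-- The set of isomorphism classes of `ℂ`-points of the weighted projective stack
`ℰ_n = (ℂ ^ N ∖ 0) / ℂ^*`. -/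
def ModuliPoint (n : ℕ) : Type := Quotient (moduliSetoid n)

/-- The point `[t]` of `ℰ_n`. -/
def moduliPoint {n : ℕ} (t : Params n) (ht : t ≠ 0) : ModuliPoint n := Quotient.mk (moduliSetoid n) ⟨t, ht⟩

/-- `y_0, …, y_{n+1}` are homogeneous elements of degrees `d_{n,0}, …, d_{n,n}, 1` which generate the section
ring `R(X, D)` as a `ℂ`-algebra. -/
def IsGeneratingSystem {n : ℕ} (X : ComplexScheme) (D : Closeds X.left)
    (y : Fin (n + 2) → sectionRing D) : Prop :=
  (∀ j, y j ∈ sectionPiece D (wt n j)) ∧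
    Function.Surjective (MvPolynomial.eval₂Hom (sectionConst X D) y)

end SylvesterPair

end

open SylvesterPair

/-!
Write `A = ℂ[x_0, …, x_{n+1}] / (F_t)` and `z = x_{n+1}`.

*The section ring.* Let `n ≥ 1`. As a polynomial in `x_0`, `F_t` is `x_0 ^ 2 + h`, and `h` restricts to a cube on
the axis of `x_1`; so `-h` is no square and `F_t` is prime (`prime_normalForm`). The same argument without `z` shows
that `z` is a prime element of `A` (`prime_coordVar_last`). The identity `∑ d_{n,k} + 1 = d_n` makes the degree of
`x_0` exceed the degree of `x_1 ⋯ x_n` by one, so `z x_1 ⋯ x_n / x_0` is a rational function on `X_t`. Neither `x_0`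
nor `x_1 ⋯ x_n` is divisible by `z`, hence it is a uniformizer at the generic point of `D_t`
(`maximalIdeal_le_span`). A function on the complement of `D_t` is `a / z ^ N` with `a` homogeneous of degree `N`,
and comparison with this uniformizer shows that the sections of `𝒪(m D_t)` are the fractions `a / z ^ m` with
`a ∈ A_m` (`poleOrderLE_top_iff`). This identifies `R(X_t, D_t)` with `A` (`exists_sectionRing_equiv`).

*Normal forms.* The weights of `x_0, …, x_n` decrease, so a graded endomorphism of the polynomial ring which
preserves the line of `z` is triangular, and bijective if its diagonal has no zeros. The derivative of order
`s_k - 1` in `x_k` of a polynomial of degree `d_n` is a multiple of `x_k` plus a polynomial in later variables, and a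
translation of `x_k` removes the latter (`exists_complete_power`); in a normal form this derivative is `s_k! x_k`.
By the chain rule a triangular substitution between normal forms is therefore diagonal
(`IsTriangular.eq_diagonal`), which gives the uniqueness of the normalization. The diagonal entries of `x_k` have the
same `s_k`-th powers; by the Chinese remainder theorem they are the powers `ρ ^ d_{n,k}` of one number `ρ`, and the
substitution acts on the parameters as an element of the torus (`IsTriangular.exists_rescale`). Homogeneous
generators of the section ring come from a triangular automorphism, so the ring determines `t` up to the torus
(`exists_generators_iff`).

*The sheaf and the divisor.* Isomorphisms of pairs preserve pole orders, hence the sheaves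
(`nonempty_pushforward_iso`) and the section rings. Conversely, the global sections of `𝒪(D_t)` are constants, and
`𝒪(D)` is generated by its section `1` outside `D`. So an isomorphism `φ_* 𝒪(D_t) ≅ 𝒪(D_{t'})` makes all sections of
`𝒪(D_{t'})` outside `φ(D_t)` regular; as the inverse of a uniformizer is a section of `𝒪(D_{t'})` near the generic
point of `D_{t'}`, this point lies in `φ(D_t)` (`preimage_mem_of_iso`).

*The case `n = 0`.* Here `F_t = x_0 ^ 2 + t x_1 ^ 2`, the divisor is empty, and `X_t` consists of one point if `t = 0`
and of two points otherwise; all `t ≠ 0` lie in one orbit.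
-/

open SylvesterPair
noncomputable section

namespace SylvesterPair

open CategoryTheory TopologicalSpace AlgebraicGeometry

/-! ### Sections of `Proj` as fractions -/

section Fractions

variable {A σ : Type} [CommRing A] [SetLike σ A] [AddSubgroupClass σ A]
  {𝒜 : ℕ → σ} [GradedRing 𝒜]

/-- The homogeneous prime ideal of a point of `Proj`. -/
def idealAt (x : Proj 𝒜) : Ideal A := (ProjectiveSpectrum.asHomogeneousIdeal x).toIdeal

instance (x : Proj 𝒜) : (idealAt x).IsPrime := ProjectiveSpectrum.isPrime x

lemma mem_basicOpen_iff {f : A} {x : Proj 𝒜} : x ∈ Proj.basicOpen 𝒜 f ↔ f ∉ idealAt x := Iff.rfl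

/-- The value of the section `s` in the homogeneous local ring at `x` is `r / t`. -/
def IsFractionAt {U : (Proj 𝒜).Opens} (s : Γ(Proj 𝒜, U)) (x : Proj 𝒜) (hx : x ∈ U) {i : ℕ}
    (r t : 𝒜 i) : Prop :=
  ∃ ht : t.1 ∈ (idealAt x).primeCompl, s.1 ⟨x, hx⟩ = HomogeneousLocalization.mk ⟨i, r, t, ht⟩

/-- Near every point a section of `Proj` is a fraction of homogeneous elements of the same degree. -/
lemma exists_fraction {U : (Proj 𝒜).Opens} (x : Proj 𝒜) (hx : x ∈ U) (s : Γ(Proj 𝒜, U)) :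
    ∃ V : (Proj 𝒜).Opens, x ∈ V ∧ ∃ (h : V ≤ U) (i : ℕ) (r t : 𝒜 i),
      ∀ (y : Proj 𝒜) (hy : y ∈ V), IsFractionAt s y (h hy) r t := by
  obtain ⟨V, hxV, i, n, a, b, h, e⟩ := s.2 ⟨x, hx⟩
  exact ⟨V, hxV, i.le, n, a, b, fun y hy => ⟨h ⟨y, hy⟩, e ⟨y, hy⟩⟩⟩

/-- The section `r / t` of `Proj` over an open set on which `t` does not vanish. -/
def fractionSection (U : (Proj 𝒜).Opens) {i : ℕ} (r t : 𝒜 i)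
    (ht : ∀ y : Proj 𝒜, y ∈ U → t.1 ∉ idealAt y) : Γ(Proj 𝒜, U) :=
  ⟨fun y => HomogeneousLocalization.mk ⟨i, r, t, ht y.1 y.2⟩,
    fun y => ⟨U, y.2, 𝟙 _, i, r, t, fun z => ht z.1 z.2, fun _ => rfl⟩⟩

lemma isFractionAt_fractionSection (U : (Proj 𝒜).Opens) {i : ℕ} (r t : 𝒜 i)
    (ht : ∀ y : Proj 𝒜, y ∈ U → t.1 ∉ idealAt y) (x : Proj 𝒜) (hx : x ∈ U) :
    IsFractionAt (fractionSection U r t ht) x hx r t :=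
  ⟨ht x hx, rfl⟩

/-- A germ at `x` lies in the maximal ideal exactly if its numerator vanishes at `x`. -/
lemma germ_mem_maximalIdeal_iff {U : (Proj 𝒜).Opens} (x : Proj 𝒜) (hx : x ∈ U)
    (s : Γ(Proj 𝒜, U)) {i : ℕ} (r t : 𝒜 i) (hs : IsFractionAt s x hx r t) :
    (Proj 𝒜).presheaf.germ U x hx s ∈ IsLocalRing.maximalIdeal ((Proj 𝒜).presheaf.stalk x) ↔
      r.1 ∈ idealAt x := by
  obtain ⟨ht, e⟩ := hs
  have h2 : Proj.stalkIso' 𝒜 x ((Proj 𝒜).presheaf.germ U x hx s) =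
    (HomogeneousLocalization.mk ⟨i, r, t, ht⟩ : HomogeneousLocalization.AtPrime 𝒜 (idealAt x)) :=
    (Proj.stalkIso'_germ 𝒜 U x hx s).trans e
  have h3 : IsUnit ((Proj 𝒜).presheaf.germ U x hx s) ↔
      IsUnit (HomogeneousLocalization.mk ⟨i, r, t, ht⟩ :
        HomogeneousLocalization.AtPrime 𝒜 (idealAt x)) :=
    (MulEquiv.isUnit_map (Proj.stalkIso' 𝒜 x)).symm.trans (Iff.of_eq (congrArg IsUnit h2))
  rw [IsLocalRing.mem_maximalIdeal, mem_nonunits_iff, h3,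
    ← HomogeneousLocalization.isUnit_iff_isUnit_val, HomogeneousLocalization.val_mk,
    Localization.mk_eq_mk', IsLocalization.AtPrime.isUnit_mk'_iff _ (idealAt x)]
  exact not_not

lemma mem_of_idealAt_le {x y : Proj 𝒜} (h : idealAt x ≤ idealAt y) {U : (Proj 𝒜).Opens} (hy : y ∈ U) :
    x ∈ U := by
  obtain ⟨_, ⟨f, rfl⟩, hyf, hf⟩ :=
    TopologicalSpace.Opens.isBasis_iff_nbhd.mp (Proj.isBasis_basicOpen 𝒜) hy
  exact hf fun hx => hyf (h hx)

end Fractions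

section GenericValue

variable {A σ : Type} [CommRing A] [IsDomain A] [SetLike σ A] [AddSubgroupClass σ A]
  {𝒜 : ℕ → σ} [GradedRing 𝒜]

/-- The inclusion of the homogeneous local ring at a point of `Proj` into the field of fractions. -/
def localToFrac (x : Proj 𝒜) : HomogeneousLocalization.AtPrime 𝒜 (idealAt x) →+* FractionRing A :=
  (IsLocalization.lift (M := (idealAt x).primeCompl) (S := Localization (idealAt x).primeCompl)
    (g := algebraMap A (FractionRing A)) (fun t => by
      have : t.1 ≠ 0 := fun h => t.2 (h ▸ Ideal.zero_mem _)
      simpa using this)).comp (algebraMap _ _)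

lemma localToFrac_mk (x : Proj 𝒜)
    (c : HomogeneousLocalization.NumDenSameDeg 𝒜 (idealAt x).primeCompl) :
    localToFrac x (.mk c) =
      algebraMap A (FractionRing A) c.num / algebraMap A (FractionRing A) c.den := by
  have h0 : (c.den : A) ≠ 0 := fun h => c.den_mem (h ▸ Ideal.zero_mem _)
  rw [localToFrac, RingHom.comp_apply, HomogeneousLocalization.algebraMap_apply,
    HomogeneousLocalization.val_mk, Localization.mk_eq_mk', IsLocalization.lift_mk'_spec]
  exact (mul_div_cancel₀ _ (by simpa using h0)).symm

lemma localToFrac_injective (x : Proj 𝒜) : Function.Injective (localToFrac x) := by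
  rw [injective_iff_map_eq_zero]
  intro a ha
  obtain ⟨c, rfl⟩ := HomogeneousLocalization.mk_surjective a
  have h0 : (c.den : A) ≠ 0 := fun h => c.den_mem (h ▸ Ideal.zero_mem _)
  rw [localToFrac_mk, div_eq_zero_iff] at ha
  have : (c.num : A) = 0 := by
    rcases ha with h | h
    · simpa using h
    · exact absurd (by simpa using h) h0
  apply HomogeneousLocalization.val_injective
  rw [HomogeneousLocalization.val_mk, HomogeneousLocalization.val_zero, this, Localization.mk_zero]

/-- The value of a section of `Proj` at the point `x`, as an element of the field of fractions. -/
def valueAt {U : (Proj 𝒜).Opens} (x : Proj 𝒜) (hx : x ∈ U) : Γ(Proj 𝒜, U) →+* FractionRing A :=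
  (localToFrac x).comp (AlgebraicGeometry.openToLocalization 𝒜 U x hx).hom

lemma valueAt_map {x : Proj 𝒜} {U V : (Proj 𝒜).Opens} (i : V ⟶ U) (hV : x ∈ V) (s : Γ(Proj 𝒜, U)) :
    valueAt x hV ((Proj 𝒜).presheaf.map i.op s) = valueAt x (i.le hV) s := rfl

lemma valueAt_openRes {x : Proj 𝒜} {U V : (Proj 𝒜).Opens} (h : V ≤ U) (hV : x ∈ V)
    (s : Γ(Proj 𝒜, U)) : valueAt x hV (openRes h s) = valueAt x (h hV) s := rfl

lemma valueAt_eq_div {U : (Proj 𝒜).Opens} {x : Proj 𝒜} {hx : x ∈ U} {s : Γ(Proj 𝒜, U)} {i : ℕ}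
    {r t : 𝒜 i} (h : IsFractionAt s x hx r t) :
    valueAt x hx s = algebraMap A (FractionRing A) r / algebraMap A (FractionRing A) t :=
  (congrArg (localToFrac x) h.2).trans (localToFrac_mk x _)

lemma valueAt_fractionSection (U : (Proj 𝒜).Opens) {i : ℕ} (r t : 𝒜 i)
    (ht : ∀ y : Proj 𝒜, y ∈ U → t.1 ∉ idealAt y) (x : Proj 𝒜) (hx : x ∈ U) :
    valueAt x hx (fractionSection U r t ht) =
      algebraMap A (FractionRing A) r / algebraMap A (FractionRing A) t :=
  valueAt_eq_div (isFractionAt_fractionSection U r t ht x hx)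

/-- Sections of `Proj` of a graded domain are determined by their value at the generic point `ξ`, here any
point lying in all nonempty open sets. -/
lemma valueAt_injective {ξ : Proj 𝒜} (hξ : ∀ (V : (Proj 𝒜).Opens) (x : Proj 𝒜), x ∈ V → ξ ∈ V)
    {U : (Proj 𝒜).Opens} (hU : ξ ∈ U) : Function.Injective (valueAt ξ hU) := by
  rw [injective_iff_map_eq_zero]
  intro s hs
  apply Subtype.ext
  funext ⟨x, hx⟩
  obtain ⟨V, hxV, hVU, i, r, t, h⟩ := exists_fraction x hx s
  rw [valueAt_eq_div (h ξ (hξ V x hxV))] at hs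
  obtain ⟨ht', e'⟩ := h x hxV
  apply localToFrac_injective x
  refine (congrArg (localToFrac x) e').trans ((localToFrac_mk x _).trans (hs.trans ?_))
  exact (map_zero _).symm

lemma valueAt_eq_of_germ_eq {ξ : Proj 𝒜}
    (hξ : ∀ (V : (Proj 𝒜).Opens) (x : Proj 𝒜), x ∈ V → ξ ∈ V)
    {U V : (Proj 𝒜).Opens} {x : Proj 𝒜} (hxU : x ∈ U) (hxV : x ∈ V) (s : Γ(Proj 𝒜, U))
    (t : Γ(Proj 𝒜, V))
    (h : (Proj 𝒜).presheaf.germ U x hxU s = (Proj 𝒜).presheaf.germ V x hxV t) :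
    valueAt ξ (hξ U x hxU) s = valueAt ξ (hξ V x hxV) t := by
  obtain ⟨W, hxW, i, j, e⟩ := (Proj 𝒜).presheaf.germ_eq x hxU hxV s t h
  have := congrArg (valueAt ξ (hξ W x hxW)) e
  rwa [valueAt_map, valueAt_map] at this

/-- The generic point of `Proj` of a graded domain, given by the zero ideal. -/
def zeroPoint (𝒜 : ℕ → σ) [GradedRing 𝒜] {z : A} (hz : z ≠ 0) {d : ℕ} (hd : 0 < d) (hzd : z ∈ 𝒜 d) :
    Proj 𝒜 :=
  ProjectiveSpectrum.mk (𝒜 := 𝒜) ⊥ (Ideal.isPrime_bot (α := A)) fun h => hz <| by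
    have : z ∈ HomogeneousIdeal.irrelevant 𝒜 := by
      rw [HomogeneousIdeal.mem_irrelevant_iff, GradedRing.proj_apply,
        DirectSum.decompose_of_mem_ne 𝒜 hzd hd.ne']
    exact h this

lemma idealAt_zeroPoint {z : A} (hz : z ≠ 0) {d : ℕ} (hd : 0 < d) (hzd : z ∈ 𝒜 d) :
    idealAt (zeroPoint 𝒜 hz hd hzd) = ⊥ := rfl

end GenericValue

/-! ### Poles along a prime divisor of `Proj` -/

section PuncturedValue

variable {A σ : Type} [CommRing A] [IsDomain A] [SetLike σ A] [AddSubgroupClass σ A]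
  {𝒜 : ℕ → σ} [GradedRing 𝒜] {ξ : Proj 𝒜} {D : Closeds (Proj 𝒜)}

lemma mem_image_preimage {X : Scheme.{0}} {D : Closeds X} {U : X.Opens} {x : X} :
    x ∈ finiteIncl D ''ᵁ (finiteIncl D ⁻¹ᵁ U) ↔ x ∈ U ∧ x ∉ D := by
  constructor
  · rintro ⟨y, hy, rfl⟩
    exact ⟨hy, y.2⟩
  · rintro ⟨h, h'⟩
    exact ⟨⟨x, h'⟩, h, rfl⟩

variable (D ξ) in
/-- The value at the point `ξ` outside `D`, in applications the generic point, of a section of the structure sheaf outside `D`. -/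
def puncturedValue {U : (Proj 𝒜).Opens} (hU : ξ ∈ U) (hD : ξ ∉ (D : Set (Proj 𝒜))) :
    PuncturedSections D U →+* FractionRing A :=
  valueAt ξ (U := finiteIncl D ''ᵁ (finiteIncl D ⁻¹ᵁ U)) (mem_image_preimage.mpr ⟨hU, hD⟩)

variable {U V : (Proj 𝒜).Opens} (hD : ξ ∉ (D : Set (Proj 𝒜)))

lemma puncturedValue_restrictOff (hU : ξ ∈ U) (s : Γ(Proj 𝒜, U)) :
    puncturedValue ξ D hU hD (restrictOff D U s) = valueAt ξ hU s := rfl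

lemma puncturedValue_res (h : V ≤ U) (hV : ξ ∈ V) (s : PuncturedSections D U) :
    puncturedValue ξ D hV hD (puncturedRes D h s) = puncturedValue ξ D (h hV) hD s := rfl

lemma puncturedValue_injective
    (hξ : ∀ (V : (Proj 𝒜).Opens) (x : Proj 𝒜), x ∈ V → ξ ∈ V) (hU : ξ ∈ U) :
    Function.Injective (puncturedValue ξ D hU hD) :=
  valueAt_injective hξ _

/-- The section `r / t` outside `D`, where the zeros of `t` lie in `D`. -/
def puncturedFraction (U : (Proj 𝒜).Opens) {i : ℕ} (r t : 𝒜 i)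
    (ht : ∀ y : Proj 𝒜, y ∈ U → t.1 ∈ idealAt y → y ∈ (D : Set (Proj 𝒜))) :
    PuncturedSections D U :=
  fractionSection (finiteIncl D ''ᵁ (finiteIncl D ⁻¹ᵁ U)) r t
    fun y hy h => (mem_image_preimage.mp hy).2 (ht y (mem_image_preimage.mp hy).1 h)

lemma puncturedValue_puncturedFraction (hU : ξ ∈ U) {i : ℕ} (r t : 𝒜 i)
    (ht : ∀ y : Proj 𝒜, y ∈ U → t.1 ∈ idealAt y → y ∈ (D : Set (Proj 𝒜))) :
    puncturedValue ξ D hU hD (puncturedFraction U r t ht) =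
      algebraMap A (FractionRing A) r / algebraMap A (FractionRing A) t :=
  valueAt_fractionSection _ r t _ ξ _

end PuncturedValue

section PrimeDivisor

variable {A σ : Type} [CommRing A] [SetLike σ A] [AddSubgroupClass σ A]
  {𝒜 : ℕ → σ} [GradedRing 𝒜]

/-- The point of `Proj` given by a homogeneous prime element `z`, for which some homogeneous element of
positive degree is not divisible by `z`. -/
def primePoint {z : A} {d : ℕ} (hzd : z ∈ 𝒜 d) (hz : Prime z) {q : A} {e : ℕ} (he : 0 < e)
    (hq : q ∈ 𝒜 e) (hzq : ¬ z ∣ q) : Proj 𝒜 :=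
  ProjectiveSpectrum.mk (𝒜 := 𝒜)
    ⟨Ideal.span {z}, Ideal.homogeneous_span 𝒜 _ (by rintro _ rfl; exact ⟨d, hzd⟩)⟩
    ((Ideal.span_singleton_prime hz.ne_zero).mpr hz) fun h => hzq <| by
    have : q ∈ HomogeneousIdeal.irrelevant 𝒜 := by
      rw [HomogeneousIdeal.mem_irrelevant_iff, GradedRing.proj_apply,
        DirectSum.decompose_of_mem_ne 𝒜 hq he.ne']
    exact Ideal.mem_span_singleton.mp (h this)

lemma specializes_of_le {x y : Proj 𝒜} (h : idealAt x ≤ idealAt y) : x ⤳ y := by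
  rw [specializes_iff_forall_open]
  exact fun s hs hy => mem_of_idealAt_le h (U := ⟨s, hs⟩) hy

/-- The element `z` defines the reduced irreducible divisor with generic point `η`. -/
lemma isGenericPointOf_iff {D : Closeds (Proj 𝒜)} {z : A}
    (hD : ∀ x : Proj 𝒜, x ∈ (D : Set (Proj 𝒜)) ↔ z ∈ idealAt x)
    {η : Proj 𝒜} (hη : idealAt η = Ideal.span {z}) (x : Proj 𝒜) :
    IsGenericPointOf D x ↔ x = η := by
  have key : ∀ y : Proj 𝒜, y ∈ D → η ⤳ y := fun y hy =>
    specializes_of_le <| by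
      rw [hη, Ideal.span_singleton_le_iff_mem]
      exact (hD y).mp hy
  have hηD : η ∈ D :=
    (hD η).mpr (hη ▸ Ideal.mem_span_singleton_self z)
  constructor
  · rintro ⟨hx, h⟩
    exact ((h η hηD (key x hx)).antisymm (key x hx)).eq
  · rintro rfl
    exact ⟨hηD, fun y hy _ => key y hy⟩

lemma exists_homogeneous_quotient {z : A} {d : ℕ} (hzd : z ∈ 𝒜 d) {r : A} {i : ℕ}
    (hr : r ∈ 𝒜 i) (hr0 : r ≠ 0) (h : z ∣ r) : ∃ (j : ℕ) (r' : A), j + d = i ∧ r' ∈ 𝒜 j ∧ r = z * r' := by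
  obtain ⟨c, rfl⟩ := h
  have h1 := DirectSum.coe_decompose_mul_of_left_mem (𝒜 := 𝒜) i (b := c) hzd
  rw [DirectSum.decompose_of_mem_same 𝒜 hr] at h1
  split_ifs at h1 with hdi
  · exact ⟨i - d, _, by omega, SetLike.coe_mem _, h1⟩
  · exact absurd h1 hr0


variable {ξ : Proj 𝒜} {η : Proj 𝒜} {D : Closeds (Proj 𝒜)} {z p q : A} {e : ℕ}

lemma algebraMap_ne_zero [IsDomain A] {a : A} (ha : a ≠ 0) : algebraMap A (FractionRing A) a ≠ 0 := by
  simpa using ha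

lemma mem_basicOpen_of_not_dvd (hη : idealAt η = Ideal.span {z}) {t : A} (ht : ¬ z ∣ t) :
    η ∈ Proj.basicOpen 𝒜 t := by
  rwa [mem_basicOpen_iff, hη, Ideal.mem_span_singleton]

/-- The section `z p / q` over the set where `q` does not vanish. -/
def uniformizer (hz1 : z ∈ 𝒜 1) (hp : p ∈ 𝒜 e) (hq : q ∈ 𝒜 (1 + e)) : Γ(Proj 𝒜, Proj.basicOpen 𝒜 q) :=
  fractionSection (Proj.basicOpen 𝒜 q) ⟨z * p, SetLike.mul_mem_graded hz1 hp⟩ ⟨q, hq⟩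
    fun _ hy => mem_basicOpen_iff.mp hy

lemma valueAt_uniformizer [IsDomain A] (hz1 : z ∈ 𝒜 1) (hp : p ∈ 𝒜 e) (hq : q ∈ 𝒜 (1 + e))
    (hξ : ξ ∈ Proj.basicOpen 𝒜 q) : valueAt ξ hξ (uniformizer hz1 hp hq) =
      algebraMap A (FractionRing A) (z * p) / algebraMap A (FractionRing A) q :=
  valueAt_fractionSection _ _ _ _ ξ _

variable [IsDomain A]

/-- The rational function `z p / q`, for `p` and `q` not divisible by `z`, generates the maximal ideal at
the generic point of `z = 0`. -/
lemma maximalIdeal_le_span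
    (hξ : ∀ (V : (Proj 𝒜).Opens) (x : Proj 𝒜), x ∈ V → ξ ∈ V)
    (hη : idealAt η = Ideal.span {z})
    (hz1 : z ∈ 𝒜 1) (hz : Prime z) (hp : p ∈ 𝒜 e) (hq : q ∈ 𝒜 (1 + e)) (hzp : ¬ z ∣ p) (hzq : ¬ z ∣ q) :
    IsLocalRing.maximalIdeal ((Proj 𝒜).presheaf.stalk η) ≤
      Ideal.span {(Proj 𝒜).presheaf.germ (Proj.basicOpen 𝒜 q) η (mem_basicOpen_of_not_dvd hη hzq)
        (uniformizer hz1 hp hq)} := by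
  intro α hα
  obtain ⟨U, hηU, s, rfl⟩ := (Proj 𝒜).presheaf.exists_germ_eq α
  -- the germ is `z r' / t`, with `t` prime to `z`, and equals `(z p / q) * (r' q / (p t))`
  obtain ⟨V, hηV, hVU, i, r, t, h⟩ := exists_fraction η hηU s
  have ht := (h η hηV).1
  have hr := (germ_mem_maximalIdeal_iff η hηU s r t (h η hηV)).mp hα
  have hzt : ¬ z ∣ t := fun h => ht (by rw [hη]; exact Ideal.mem_span_singleton.mpr h)
  rw [Ideal.mem_span_singleton]
  by_cases hr0 : (r : A) = 0
  · -- the zero germ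
    have : s = 0 := by
      apply valueAt_injective hξ (hξ U η hηU)
      rw [valueAt_eq_div (h ξ (hξ V η hηV)), hr0]
      simp
    rw [this, map_zero]
    exact dvd_zero _
  obtain ⟨j, r', hj, hr', hrr⟩ := exists_homogeneous_quotient hz1 r.2 hr0
    (Ideal.mem_span_singleton.mp (hη ▸ hr))
  have hpt : ¬ z ∣ p * t := hz.not_dvd_mul hzp hzt
  let W : (Proj 𝒜).Opens := V ⊓ Proj.basicOpen 𝒜 (p * t) ⊓ Proj.basicOpen 𝒜 q
  have hηW : η ∈ W := ⟨⟨hηV, mem_basicOpen_of_not_dvd hη hpt⟩, mem_basicOpen_of_not_dvd hη hzq⟩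
  have hdeg : r' * q ∈ 𝒜 (e + i) := by
    have := SetLike.mul_mem_graded hr' hq
    rwa [show j + (1 + e) = e + i by omega] at this
  let w := fractionSection W ⟨r' * q, hdeg⟩ ⟨p * t, SetLike.mul_mem_graded hp t.2⟩
    (fun y hy => hy.1.2)
  refine ⟨(Proj 𝒜).presheaf.germ W η hηW w, ?_⟩
  have hWU : W ≤ U := fun _ hx => hVU hx.1.1
  have hWq : W ≤ Proj.basicOpen 𝒜 q := fun _ hx => hx.2
  rw [← germ_res hWU η hηW, ← germ_res hWq η hηW, ← map_mul]
  congr 1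
  have hξW := hξ W η hηW
  apply valueAt_injective hξ hξW
  rw [map_mul, valueAt_openRes, valueAt_openRes, valueAt_uniformizer,
    show valueAt ξ hξW w = _ from valueAt_fractionSection _ _ _ _ ξ _]
  rw [valueAt_eq_div (h ξ (hξ V η hηV)), hrr]
  have h1 := algebraMap_ne_zero (show p ≠ 0 from fun h => hzp (h ▸ dvd_zero _))
  have h2 := algebraMap_ne_zero (show q ≠ 0 from fun h => hzq (h ▸ dvd_zero _))
  have h3 := algebraMap_ne_zero (show (t : A) ≠ 0 from fun h => hzt (h ▸ dvd_zero _))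
  simp only [map_mul]
  field_simp

/-- A section with a pole of order at most `m` along `z = 0` is `b / (z ^ m t)`, with `t` prime to `z`. -/
lemma exists_fraction_of_poleOrderLE
    (hξ : ∀ (V : (Proj 𝒜).Opens) (x : Proj 𝒜), x ∈ V → ξ ∈ V)
    (hξD : ξ ∉ (D : Set (Proj 𝒜)))
    (hD : ∀ x : Proj 𝒜, x ∈ (D : Set (Proj 𝒜)) ↔ z ∈ idealAt x)
    (hη : idealAt η = Ideal.span {z})
    (hz1 : z ∈ 𝒜 1) (hz : Prime z) (hp : p ∈ 𝒜 e) (hq : q ∈ 𝒜 (1 + e)) (hzp : ¬ z ∣ p) (hzq : ¬ z ∣ q)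
    {U : (Proj 𝒜).Opens} (hηU : η ∈ U) (m : ℕ) (s : PuncturedSections D U) (hs : PoleOrderLE D m s) :
    ∃ (i : ℕ) (b t : A), t ∈ 𝒜 i ∧ b ∈ 𝒜 (i + m) ∧ ¬ z ∣ t ∧
      puncturedValue ξ D (hξ U η hηU) hξD s * algebraMap A (FractionRing A) (z ^ m * t) =
        algebraMap A (FractionRing A) b := by
  have hg := hs η hηU ((isGenericPointOf_iff hD hη η).mpr rfl)
  have hw : (Proj 𝒜).presheaf.germ (Proj.basicOpen 𝒜 q) η (mem_basicOpen_of_not_dvd hη hzq)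
      (uniformizer hz1 hp hq) ∈ IsLocalRing.maximalIdeal ((Proj 𝒜).presheaf.stalk η) :=
    (germ_mem_maximalIdeal_iff η (mem_basicOpen_of_not_dvd hη hzq) _ _ _
    (isFractionAt_fractionSection (Proj.basicOpen 𝒜 q) ⟨z * p, SetLike.mul_mem_graded hz1 hp⟩ ⟨q, hq⟩
      (fun _ hy => mem_basicOpen_iff.mp hy) η (mem_basicOpen_of_not_dvd hη hzq))).mpr
      (hη ▸ Ideal.mem_span_singleton.mpr (dvd_mul_right z p))
  obtain ⟨W, hWU, hηW, a, b, hab, h⟩ := hg (Ideal.pow_mem_pow hw m)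
  have hξW := hξ W η hηW
  have e1 := congrArg (puncturedValue ξ D hξW hξD) h
  rw [map_mul, puncturedValue_res, puncturedValue_restrictOff, puncturedValue_restrictOff] at e1
  rw [← map_pow] at hab
  rw [valueAt_eq_of_germ_eq hξ _ _ _ _ hab, map_pow, valueAt_uniformizer] at e1
  obtain ⟨V, hηV, hVW, i, r, t, hr⟩ := exists_fraction η hηW b
  have ht := (hr η hηV).1
  have hzt : ¬ z ∣ t := fun h => ht (by rw [hη]; exact Ideal.mem_span_singleton.mpr h)
  rw [valueAt_eq_div (hr ξ (hξ V η hηV))] at e1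
  refine ⟨m * e + i, r * q ^ m, p ^ m * t, SetLike.mul_mem_graded (SetLike.pow_mem_graded m hp) t.2,
    ?_, hz.not_dvd_mul (fun h => hzp (hz.dvd_of_dvd_pow h)) hzt, ?_⟩
  · have := SetLike.mul_mem_graded r.2 (SetLike.pow_mem_graded m hq)
    rwa [show i + m • (1 + e) = m * e + i + m by rw [smul_eq_mul]; ring] at this
  · have h2 := algebraMap_ne_zero (show q ≠ 0 from fun h => hzq (h ▸ dvd_zero _))
    have h3 := algebraMap_ne_zero (show (t : A) ≠ 0 from fun h => hzt (h ▸ dvd_zero _))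
    simp only [map_mul, map_pow, div_pow] at e1 ⊢
    field_simp at e1
    linear_combination e1

/-- Conversely, a fraction `b / (z ^ m t)` with `t` prime to `z` has a pole of order at most `m`: multiplied
by the `m`-th power of the uniformizer `z p / q` it becomes `p ^ m b / (q ^ m t)`, which is regular at `η`. -/
lemma poleOrderLE_of_fraction
    (hξ : ∀ (V : (Proj 𝒜).Opens) (x : Proj 𝒜), x ∈ V → ξ ∈ V)
    (hξD : ξ ∉ (D : Set (Proj 𝒜)))
    (hD : ∀ x : Proj 𝒜, x ∈ (D : Set (Proj 𝒜)) ↔ z ∈ idealAt x)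
    (hη : idealAt η = Ideal.span {z})
    (hz1 : z ∈ 𝒜 1) (hz : Prime z) (hp : p ∈ 𝒜 e) (hq : q ∈ 𝒜 (1 + e)) (hzp : ¬ z ∣ p) (hzq : ¬ z ∣ q)
    {U : (Proj 𝒜).Opens} (hξU : ξ ∈ U) (m : ℕ) (s : PuncturedSections D U)
    {i : ℕ} {b t : A} (ht : t ∈ 𝒜 i) (hb : b ∈ 𝒜 (i + m)) (hzt : ¬ z ∣ t)
    (h : puncturedValue ξ D hξU hξD s * algebraMap A (FractionRing A) (z ^ m * t) =
        algebraMap A (FractionRing A) b) :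
    PoleOrderLE D m s := by
  intro x hx hxD
  obtain rfl := (isGenericPointOf_iff hD hη x).mp hxD
  refine (Ideal.pow_right_mono (maximalIdeal_le_span hξ hη hz1 hz hp hq hzp hzq) m).trans ?_
  rw [Ideal.span_singleton_pow, Ideal.span_singleton_le_iff_mem]
  let W : (Proj 𝒜).Opens := U ⊓ Proj.basicOpen 𝒜 q ⊓ Proj.basicOpen 𝒜 t
  have hηW : x ∈ W := ⟨⟨hx, mem_basicOpen_of_not_dvd hη hzq⟩, mem_basicOpen_of_not_dvd hη hzt⟩
  have hWU : W ≤ U := fun _ hx => hx.1.1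
  have hWq : W ≤ Proj.basicOpen 𝒜 q := fun _ hx => hx.1.2
  have hqt : ∀ y : Proj 𝒜, y ∈ W → q ^ m * t ∉ idealAt y := by
    intro y hy hm
    rcases (inferInstance : (idealAt y).IsPrime).mem_or_mem hm with h' | h'
    · exact hy.1.2 ((inferInstance : (idealAt y).IsPrime).mem_of_pow_mem m h')
    · exact hy.2 h'
  have hdeg : p ^ m * b ∈ 𝒜 (m * (1 + e) + i) := by
    have := SetLike.mul_mem_graded (SetLike.pow_mem_graded m hp) hb
    rwa [show m • e + (i + m) = m * (1 + e) + i by rw [smul_eq_mul]; ring] at this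
  refine ⟨W, hWU, hηW, openRes hWq (uniformizer hz1 hp hq) ^ m, fractionSection W ⟨p ^ m * b, hdeg⟩
    ⟨q ^ m * t, SetLike.mul_mem_graded (SetLike.pow_mem_graded m hq) ht⟩ hqt, ?_, ?_⟩
  · rw [map_pow, germ_res]
  · have hξW := hξ W x hηW
    apply puncturedValue_injective hξD hξ hξW
    rw [map_mul, puncturedValue_res, puncturedValue_restrictOff, puncturedValue_restrictOff, map_pow,
      valueAt_openRes, valueAt_uniformizer, valueAt_fractionSection]
    have h1 := algebraMap_ne_zero hz.ne_zero
    have h2 := algebraMap_ne_zero (show q ≠ 0 from fun h => hzq (h ▸ dvd_zero _))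
    have h3 := algebraMap_ne_zero (show (t : A) ≠ 0 from fun h => hzt (h ▸ dvd_zero _))
    simp only [map_mul, map_pow, div_pow] at h ⊢
    field_simp
    linear_combination (algebraMap A (FractionRing A) p) ^ m * h

/-- Sections over the complement of `z = 0` are fractions `a / z ^ N`. -/
lemma exists_fraction_of_top (hξD : ξ ∉ (D : Set (Proj 𝒜)))
    (hD : ∀ x : Proj 𝒜, x ∈ (D : Set (Proj 𝒜)) ↔ z ∈ idealAt x) (hz1 : z ∈ 𝒜 1) (hz0 : z ≠ 0)
    (s : PuncturedSections D ⊤) :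
    ∃ (N : ℕ) (a : A), a ∈ 𝒜 N ∧
      puncturedValue ξ D (U := ⊤) trivial hξD s * algebraMap A (FractionRing A) (z ^ N) =
        algebraMap A (FractionRing A) a := by
  have hle : Proj.basicOpen 𝒜 z ≤ finiteIncl D ''ᵁ (finiteIncl D ⁻¹ᵁ ⊤) := fun x hx =>
    mem_image_preimage.mpr ⟨trivial, fun h => hx ((hD x).mp h)⟩
  have hξz : ξ ∈ Proj.basicOpen 𝒜 z := fun h => hξD ((hD ξ).mpr h)
  let s' : Γ(Proj 𝒜, Proj.basicOpen 𝒜 z) := openRes hle s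
  let e := Proj.basicOpenIsoAway 𝒜 z hz1 one_pos
  obtain ⟨y, hy⟩ : ∃ y, e.hom.hom y = s' := ⟨e.inv.hom s', by
    rw [← RingHom.comp_apply, ← CommRingCat.hom_comp, e.inv_hom_id]; rfl⟩
  obtain ⟨N, a, ha, rfl⟩ := HomogeneousLocalization.Away.mk_surjective 𝒜 hz1 y
  have hzN : z ^ N ∈ 𝒜 (N • 1) := SetLike.pow_mem_graded N hz1
  have hfrac : IsFractionAt s' ξ hξz ⟨a, ha⟩ ⟨z ^ N, hzN⟩ := by
    rw [← hy, Proj.basicOpenIsoAway_hom]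
    exact ⟨fun h => hξz ((inferInstance : (idealAt ξ).IsPrime).mem_of_pow_mem N h), rfl⟩
  refine ⟨N, a, by simpa using ha, ?_⟩
  have h1 : valueAt ξ hξz s' = puncturedValue ξ D (U := ⊤) trivial hξD s := valueAt_openRes hle hξz _
  rw [← h1, valueAt_eq_div hfrac]
  exact div_mul_cancel₀ _ (algebraMap_ne_zero (pow_ne_zero N hz0))

/-- The sections of `𝒪(mD)` over the whole of `Proj`, for the divisor `D` given by the prime element `z`
of degree one, are the fractions `a / z ^ m`. -/
lemma poleOrderLE_top_iff
    (hξ : ∀ (V : (Proj 𝒜).Opens) (x : Proj 𝒜), x ∈ V → ξ ∈ V)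
    (hξD : ξ ∉ (D : Set (Proj 𝒜)))
    (hD : ∀ x : Proj 𝒜, x ∈ (D : Set (Proj 𝒜)) ↔ z ∈ idealAt x)
    (hη : idealAt η = Ideal.span {z})
    (hz1 : z ∈ 𝒜 1) (hz : Prime z) (hp : p ∈ 𝒜 e) (hq : q ∈ 𝒜 (1 + e)) (hzp : ¬ z ∣ p) (hzq : ¬ z ∣ q)
    (m : ℕ) (s : PuncturedSections D ⊤) :
    PoleOrderLE D m s ↔ ∃ a ∈ 𝒜 m,
      puncturedValue ξ D (U := ⊤) trivial hξD s * algebraMap A (FractionRing A) (z ^ m) =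
        algebraMap A (FractionRing A) a := by
  constructor
  · intro hs
    obtain ⟨N, a, ha, h⟩ := exists_fraction_of_top hξD hD hz1 hz.ne_zero s
    obtain ⟨i, b, t, ht, hb, hzt, h'⟩ := exists_fraction_of_poleOrderLE hξ hξD hD hη hz1 hz hp hq hzp hzq
      (U := ⊤) trivial m s hs
    by_cases ha0 : a = 0
    · refine ⟨0, zero_mem _, ?_⟩
      rw [ha0, map_zero] at h
      rw [(mul_eq_zero.mp h).resolve_right (algebraMap_ne_zero (pow_ne_zero N hz.ne_zero))]
      simp
    have hz' := algebraMap_ne_zero hz.ne_zero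
    rcases le_total N m with hNm | hNm
    · refine ⟨a * z ^ (m - N), ?_, ?_⟩
      · have := SetLike.mul_mem_graded ha (SetLike.pow_mem_graded (m - N) hz1)
        rwa [show N + (m - N) • 1 = m by rw [smul_eq_mul]; omega] at this
      · rw [map_mul, ← h, mul_assoc, ← map_mul, ← pow_add, Nat.add_sub_cancel' hNm]
    · -- comparison of `a / z ^ N` with `b / (z ^ m t)`: since `z` is prime to `t`, it can be cancelled
      have key : z ^ (N - m) * b = a * t := by
        apply IsFractionRing.injective A (FractionRing A)
        rw [map_mul, map_mul, ← h, ← h', ← Nat.sub_add_cancel hNm]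
        simp only [map_mul, map_pow, pow_add, Nat.add_sub_cancel]
        ring
      have hdvd : z ^ (N - m) ∣ a :=
        hz.pow_dvd_of_dvd_mul_right (N - m) hzt ⟨b, key.symm⟩
      obtain ⟨j, c, hj, hc, hac⟩ := exists_homogeneous_quotient
        (SetLike.pow_mem_graded (N - m) hz1) ha ha0 hdvd
      rw [smul_eq_mul, mul_one] at hj
      obtain rfl : j = m := by omega
      refine ⟨c, hc, ?_⟩
      apply mul_left_cancel₀ (pow_ne_zero (N - j) hz')
      rw [← map_pow, ← map_mul, ← hac, ← h, mul_left_comm, ← map_mul, ← pow_add, Nat.sub_add_cancel hNm]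
  · rintro ⟨a, ha, h⟩
    exact poleOrderLE_of_fraction hξ hξD hD hη hz1 hz hp hq hzp hzq (U := ⊤) trivial m s (i := 0)
      (t := 1) SetLike.GradedOne.one_mem (by rwa [zero_add])
      (fun h => hz.not_isUnit (isUnit_of_dvd_one h)) (by rwa [mul_one])

/-- On no open set that meets `z = 0` is `𝒪(D)` generated by its section `1`. -/
lemma disjoint_of_sections_extend
    (hξ : ∀ (V : (Proj 𝒜).Opens) (x : Proj 𝒜), x ∈ V → ξ ∈ V)
    (hξD : ξ ∉ (D : Set (Proj 𝒜)))
    (hD : ∀ x : Proj 𝒜, x ∈ (D : Set (Proj 𝒜)) ↔ z ∈ idealAt x)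
    (hη : idealAt η = Ideal.span {z})
    (hz1 : z ∈ 𝒜 1) (hz : Prime z) (hp : p ∈ 𝒜 e) (hq : q ∈ 𝒜 (1 + e)) (hzp : ¬ z ∣ p) (hzq : ¬ z ∣ q)
    {U : (Proj 𝒜).Opens} (h : ∀ V : (Proj 𝒜).Opens, V ≤ U → ∀ s : PuncturedSections D V,
      PoleOrderLE D 1 s → ∃ f : Γ(Proj 𝒜, V), s = restrictOff D V f)
    (x : Proj 𝒜) (hx : x ∈ U) : x ∉ (D : Set (Proj 𝒜)) := by
  intro hxD
  have hηU : η ∈ U := mem_of_idealAt_le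
    (by rw [hη, Ideal.span_singleton_le_iff_mem]; exact (hD x).mp hxD) hx
  let V := U ⊓ Proj.basicOpen 𝒜 p
  have hηV : η ∈ V := ⟨hηU, mem_basicOpen_of_not_dvd hη hzp⟩
  have hξV := hξ V η hηV
  -- the inverse `q / (z p)` of the uniformizer is a section of `𝒪(D)` over `V`
  let s : PuncturedSections D V := puncturedFraction V ⟨q, hq⟩ ⟨z * p, SetLike.mul_mem_graded hz1 hp⟩
    fun y hy h => (hD y).mpr
      (((inferInstance : (idealAt y).IsPrime).mem_or_mem h).resolve_right (mem_basicOpen_iff.mp hy.2))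
  have hs : puncturedValue ξ D hξV hξD s =
      algebraMap A (FractionRing A) q / algebraMap A (FractionRing A) (z * p) :=
    puncturedValue_puncturedFraction hξD hξV _ _ _
  have hz0 := algebraMap_ne_zero hz.ne_zero
  have hp0 := algebraMap_ne_zero (show p ≠ 0 from fun h => hzp (h ▸ dvd_zero _))
  obtain ⟨f, hf⟩ := h V inf_le_left s (poleOrderLE_of_fraction hξ hξD hD hη hz1 hz hp hq hzp hzq hξV 1 s
    hp (b := q) (by rwa [add_comm]) hzp (by rw [hs, pow_one, map_mul]; field_simp))
  obtain ⟨W, hηW, hWV, i, r, t, hrt⟩ := exists_fraction η hηV f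
  have hzt : ¬ z ∣ t := fun h => (hrt η hηW).1 (by rw [hη]; exact Ideal.mem_span_singleton.mpr h)
  have ht0 := algebraMap_ne_zero (show (t : A) ≠ 0 from fun h => hzt (h ▸ dvd_zero _))
  rw [hf, puncturedValue_restrictOff, valueAt_eq_div (hrt ξ (hξ W η hηW)), map_mul] at hs
  field_simp at hs
  rw [← map_mul, ← map_mul, ← map_mul] at hs
  have := IsFractionRing.injective A (FractionRing A) hs
  rcases hz.dvd_or_dvd ⟨_, this.symm.trans (by ring : _ = z * (r * p))⟩ with h1 | h1
  · exact hzt h1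
  · exact hzq h1

end PrimeDivisor

/-! ### The Sylvester sequence and the weights -/

section Sylvester

lemma sylvester_eq (n : ℕ) : sylvester n = 1 + ∏ k ∈ Finset.range n, sylvester k := by
  rw [sylvester, Finset.prod_range]

lemma two_le_sylvester (n : ℕ) : 2 ≤ sylvester n := by
  induction n using Nat.strong_induction_on with
  | _ n ih =>
    rw [sylvester_eq]
    have : 0 < ∏ k ∈ Finset.range n, sylvester k :=
      Finset.prod_pos fun k hk => by have := ih k (Finset.mem_range.mp hk); omega
    omega

lemma sylvester_zero : sylvester 0 = 2 := by
  simp [sylvester_eq 0]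

lemma sylvester_one : sylvester 1 = 3 := by rw [sylvester_eq, Finset.prod_range_one, sylvester_zero]

lemma deg_eq (n : ℕ) : deg n + 1 = sylvester (n + 1) := by
  rw [sylvester_eq, deg, add_comm]

lemma deg_succ (n : ℕ) : deg (n + 1) = deg n * sylvester (n + 1) := by
  rw [deg, Finset.prod_range_succ, deg]

lemma deg_pos (n : ℕ) : 0 < deg n := Finset.prod_pos fun k _ => by have := two_le_sylvester k; omega

lemma coprime_sylvester {j k : ℕ} (h : j ≠ k) : Nat.Coprime (sylvester j) (sylvester k) := by
  wlog hjk : j < k generalizing j k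
  · exact (this h.symm (by omega)).symm
  have h1 : sylvester j ∣ ∏ i ∈ Finset.range k, sylvester i :=
    Finset.dvd_prod_of_mem _ (Finset.mem_range.mpr hjk)
  rw [sylvester_eq k]
  refine Nat.Coprime.coprime_dvd_left h1 ?_
  simp

lemma sylvester_strictMono : StrictMono sylvester := by
  refine strictMono_nat_of_lt_succ fun n => ?_
  rw [← deg_eq, deg, Finset.prod_range_succ]
  have h : 0 < ∏ k ∈ Finset.range n, sylvester k :=
    Finset.prod_pos fun k _ => by have := two_le_sylvester k; omega
  nlinarith

lemma degVar_pos (n k : ℕ) : 0 < degVar n k :=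
  Finset.prod_pos fun k _ => by have := two_le_sylvester k; omega

lemma sylvester_mul_degVar' {n k : ℕ} (hk : k ≤ n) : sylvester k * degVar n k = deg n :=
  sylvester_mul_degVar n ⟨k, by omega⟩

lemma degVar_lt {n j k : ℕ} (hjk : j < k) (hk : k ≤ n) : degVar n k < degVar n j := by
  have h1 := sylvester_mul_degVar' hk
  have h2 := sylvester_mul_degVar' (n := n) (k := j) (by omega)
  have h3 := sylvester_strictMono hjk
  have := degVar_pos n k
  by_contra! h
  have : sylvester j * degVar n j < sylvester k * degVar n k :=
    Nat.mul_lt_mul_of_lt_of_le h3 h this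
  omega

lemma sylvester_dvd_degVar {n j k : ℕ} (hjk : j ≠ k) (hj : j ≤ n) : sylvester j ∣ degVar n k :=
  Finset.dvd_prod_of_mem _ (by simp; omega)

lemma coprime_sylvester_degVar (n k : ℕ) : Nat.Coprime (sylvester k) (degVar n k) :=
  Nat.Coprime.prod_right fun _ hj => coprime_sylvester (Finset.ne_of_mem_erase hj).symm

/-- The identity `∑ 1 / s_k = 1 - 1 / d_n` of the Sylvester sequence. -/
lemma sum_degVar (n : ℕ) : ∑ k ∈ Finset.range (n + 1), degVar n k + 1 = deg n := by
  induction n with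
  | zero => simp [degVar, deg, sylvester_zero]
  | succ n ih =>
    have h1 : ∀ k ∈ Finset.range (n + 1), degVar (n + 1) k = sylvester (n + 1) * degVar n k := by
      intro k hk
      have hk' := Finset.mem_range.mp hk
      have e1 := sylvester_mul_degVar' (n := n) (k := k) (by omega)
      have e2 := sylvester_mul_degVar' (n := n + 1) (k := k) (by omega)
      rw [deg_succ, ← e1] at e2
      have := two_le_sylvester k
      exact Nat.eq_of_mul_eq_mul_left (by omega : 0 < sylvester k) (by rw [e2]; ring)
    have h2 : degVar (n + 1) (n + 1) = deg n := by
      have e2 := sylvester_mul_degVar' (n := n + 1) le_rfl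
      rw [deg_succ, mul_comm] at e2
      have := two_le_sylvester (n + 1)
      exact Nat.eq_of_mul_eq_mul_right (by omega) e2
    rw [Finset.sum_range_succ, Finset.sum_congr rfl h1, h2, ← Finset.mul_sum, deg_succ]
    have := deg_eq n
    nlinarith

lemma one_lt_degVar {n k : ℕ} (hn : 1 ≤ n) (hk : k ≤ n) : 1 < degVar n k := by
  obtain ⟨j, hj, hjk⟩ : ∃ j, j ≤ n ∧ j ≠ k := by
    rcases Nat.eq_zero_or_pos k with rfl | h
    · exact ⟨1, hn, by simp⟩
    · exact ⟨0, by omega, by omega⟩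
  have := Nat.le_of_dvd (degVar_pos n k) (sylvester_dvd_degVar hjk hj)
  have := two_le_sylvester j
  omega

end Sylvester

section Weights

variable {n : ℕ}

lemma wt_pos (j : Fin (n + 2)) : 0 < wt n j := by
  induction j using Fin.lastCases with
  | last => simp [wt_last]
  | cast k => rw [wt_castSucc]; exact degVar_pos n k

lemma weight_eq (d : Fin (n + 2) →₀ ℕ) :
    Finsupp.weight (wt n) d = ∑ k : Fin (n + 1), d k.castSucc * degVar n k + d (Fin.last _) := by
  rw [Finsupp.weight_apply, Finsupp.sum_fintype _ _ (by simp), Fin.sum_univ_castSucc]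
  simp [wt_castSucc, wt_last]

lemma mul_wt_le_weight (d : Fin (n + 2) →₀ ℕ) (j : Fin (n + 2)) :
    d j * wt n j ≤ Finsupp.weight (wt n) d := by
  rw [Finsupp.weight_apply, Finsupp.sum_fintype _ _ (by simp)]
  exact Finset.single_le_sum (f := fun i => d i • wt n i) (fun _ _ => Nat.zero_le _) (Finset.mem_univ j)

lemma weight_single (j : Fin (n + 2)) (m : ℕ) :
    Finsupp.weight (wt n) (Finsupp.single j m) = m * wt n j := by
  simp [Finsupp.weight_apply]

lemma eq_zero_of_weight_eq_zero {d : Fin (n + 2) →₀ ℕ} (h : Finsupp.weight (wt n) d = 0) : d = 0 := by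
  ext j
  have h1 := mul_wt_le_weight d j
  have h2 := wt_pos j
  rw [h, Nat.le_zero, Nat.mul_eq_zero] at h1
  simp only [Finsupp.coe_zero, Pi.zero_apply]
  omega

lemma wt_strictAnti_castSucc {j k : Fin (n + 1)} (h : j < k) :
    wt n k.castSucc < wt n j.castSucc := by
  rw [wt_castSucc, wt_castSucc]
  exact degVar_lt h (by omega)

lemma weight_add_single (d : Fin (n + 2) →₀ ℕ) (j : Fin (n + 2)) (m : ℕ) :
    Finsupp.weight (wt n) (d + Finsupp.single j m) = Finsupp.weight (wt n) d + m * wt n j := by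
  rw [map_add, weight_single]

lemma sub_add_single {d : Fin (n + 2) →₀ ℕ} {j : Fin (n + 2)} {m : ℕ} (h : m ≤ d j) :
    d - Finsupp.single j m + Finsupp.single j m = d :=
  tsub_add_cancel_of_le (by simpa using h)

/-- A monomial of the weight of `x_k` is `x_k`, or involves only later variables. -/
lemma eq_single_or_lt {k : Fin (n + 1)} {d : Fin (n + 2) →₀ ℕ}
    (h : Finsupp.weight (wt n) d = degVar n k) :
    d = Finsupp.single k.castSucc 1 ∨ ∀ j : Fin (n + 2), d j ≠ 0 → k.castSucc < j := by
  by_cases hd : ∃ j : Fin (n + 2), d j ≠ 0 ∧ j ≤ k.castSucc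
  · left
    obtain ⟨j, hj, hjk⟩ := hd
    have h1 := mul_wt_le_weight d j
    have h2 : wt n j ≤ d j * wt n j := Nat.le_mul_of_pos_left _ (Nat.pos_of_ne_zero hj)
    obtain ⟨j, rfl⟩ : ∃ j' : Fin (n + 1), j'.castSucc = j := by
      refine Fin.exists_castSucc_eq.mpr ?_
      rintro rfl
      exact absurd hjk (Fin.castSucc_lt_last k).not_ge
    obtain rfl : j = k := by
      by_contra hne
      have := wt_strictAnti_castSucc (lt_of_le_of_ne (by simpa using hjk) hne)
      rw [wt_castSucc] at this
      omega
    have h3 := sub_add_single (d := d) (j := j.castSucc) (m := 1) (by omega)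
    have h4 := weight_add_single (d - Finsupp.single j.castSucc 1) j.castSucc 1
    rw [h3, h, wt_castSucc] at h4
    have := eq_zero_of_weight_eq_zero (n := n) (d := d - Finsupp.single j.castSucc 1) (by omega)
    rw [← h3, this, zero_add]
  · right
    push Not at hd
    exact hd

/-- The exponent vector of the monomial `x_0 ^ i_0 ⋯ x_n ^ i_n x_{n+1} ^ w(i)`. -/
def Idx.exponent (i : Idx n) : Fin (n + 2) →₀ ℕ :=
  Finsupp.equivFunOnFinite.symm (Fin.snoc (α := fun _ => ℕ) (fun k => (i.1 k : ℕ)) i.weight)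

@[simp] lemma Idx.exponent_castSucc (i : Idx n) (k : Fin (n + 1)) : i.exponent k.castSucc = i.1 k := by
  simp [Idx.exponent]

@[simp] lemma Idx.exponent_last (i : Idx n) : i.exponent (Fin.last _) = i.weight := by
  simp [Idx.exponent]

lemma Idx.exponent_injective : Function.Injective (Idx.exponent (n := n)) := by
  intro i j h
  apply Subtype.ext
  funext k
  apply Fin.ext
  have := DFunLike.congr_fun h k.castSucc
  simpa using this

lemma Idx.exponent_lt (i : Idx n) (k : Fin (n + 1)) : i.exponent k.castSucc + 1 < sylvester k := by
  rw [Idx.exponent_castSucc]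
  have := (i.1 k).2
  omega

/-- The monomials of weight `d_n` are the powers `x_k ^ s_k`, the monomials of the normal form, and those
in which some `x_k` has exponent `s_k - 1`. -/
lemma classify_exponent {d : Fin (n + 2) →₀ ℕ} (h : Finsupp.weight (wt n) d = deg n) :
    (∃ k : Fin (n + 1), d = Finsupp.single k.castSucc (sylvester k)) ∨
    (∃ k : Fin (n + 1), d k.castSucc + 1 = sylvester k) ∨ ∃ i : Idx n, d = i.exponent := by
  by_cases h1 : ∃ k : Fin (n + 1), sylvester k ≤ d k.castSucc
  · left
    obtain ⟨k, hk⟩ := h1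
    refine ⟨k, ?_⟩
    have h3 := sub_add_single hk
    have h4 := weight_add_single (d - Finsupp.single k.castSucc (sylvester k)) k.castSucc (sylvester k)
    rw [h3, h, wt_castSucc, sylvester_mul_degVar] at h4
    rw [← h3, eq_zero_of_weight_eq_zero (n := n)
      (d := d - Finsupp.single k.castSucc (sylvester k)) (by omega), zero_add]
  · right
    push Not at h1
    by_cases h2 : ∃ k : Fin (n + 1), d k.castSucc + 1 = sylvester k
    · exact Or.inl h2
    · right
      push Not at h2
      rw [weight_eq] at h
      -- `Idx` requires a positive exponent of the last variable
      have hlast : d (Fin.last _) ≠ 0 := by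
        intro h0
        rw [h0, add_zero] at h
        -- modulo `s_k` only the `k`-th summand survives, so `s_k` divides the `k`-th exponent
        have hz : ∀ k : Fin (n + 1), d k.castSucc = 0 := by
          intro k
          have e1 : sylvester k ∣ d k.castSucc * degVar n k := by
            have e2 : sylvester k ∣ ∑ j ∈ Finset.univ.erase k, d (Fin.castSucc j) * degVar n j :=
              Finset.dvd_sum fun j hj => Dvd.dvd.mul_left (sylvester_dvd_degVar
                (fun h => Finset.ne_of_mem_erase hj (Fin.ext h.symm)) (by omega)) _
            have e3 : sylvester k ∣ deg n := ⟨_, (sylvester_mul_degVar n k).symm⟩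
            rw [← h, ← Finset.add_sum_erase _ _ (Finset.mem_univ k)] at e3
            exact (Nat.dvd_add_left e2).mp e3
          exact Nat.eq_zero_of_dvd_of_lt ((coprime_sylvester_degVar n k).dvd_of_dvd_mul_right e1) (h1 k)
        have := deg_pos n
        simp [hz] at h
        omega
      obtain ⟨i, hi⟩ : ∃ i : Idx n, ∀ k, (i.1 k : ℕ) = d k.castSucc :=
        ⟨⟨fun k => ⟨d k.castSucc, by have := h1 k; have := h2 k; omega⟩, by
          simp only
          omega⟩, fun _ => rfl⟩
      refine ⟨i, ?_⟩
      ext j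
      induction j using Fin.lastCases with
      | last =>
        rw [Idx.exponent_last]
        simp only [Idx.weight, hi]
        omega
      | cast k => rw [Idx.exponent_castSucc, hi]

end Weights

/-! ### Coefficients of the normal form and iterated derivatives -/

section

open MvPolynomial

section NormalForm

variable {n : ℕ}

lemma normalForm_eq (t : Params n) :
    normalForm t = ∑ k : Fin (n + 1), monomial (Finsupp.single k.castSucc (sylvester k)) (1 : ℂ) +
      ∑ i : Idx n, monomial i.exponent (t i) := by
  rw [normalForm]
  congr 1
  · exact Finset.sum_congr rfl fun k _ => X_pow_eq_monomial
  · refine Finset.sum_congr rfl fun i _ => ?_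
    have h : ∏ j, (X j : PolyRing n) ^ i.exponent j =
        (∏ k : Fin (n + 1), X k.castSucc ^ i.exponent k.castSucc) *
          X (Fin.last (n + 1)) ^ i.exponent (Fin.last _) := Fin.prod_univ_castSucc _
    simp only [Idx.exponent_castSucc, Idx.exponent_last] at h
    rw [MvPolynomial.monomial_eq, Finsupp.prod_fintype _ _ (by simp), h, mul_assoc]

lemma coeff_normalForm (t : Params n) (d : Fin (n + 2) →₀ ℕ) :
    coeff d (normalForm t) = (∑ k : Fin (n + 1), if Finsupp.single k.castSucc (sylvester k) = d then 1 else 0) +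
      ∑ i : Idx n, if i.exponent = d then t i else 0 := by
  classical
  rw [normalForm_eq, coeff_add, coeff_sum, coeff_sum]
  simp only [coeff_monomial]

lemma exponent_ne_single (i : Idx n) (k : Fin (n + 1)) :
    i.exponent ≠ Finsupp.single k.castSucc (sylvester k) := fun h => by
  have h1 := i.exponent_lt k
  rw [h, Finsupp.single_eq_same] at h1
  omega

lemma coeff_normalForm_exponent (t : Params n) (i : Idx n) : coeff i.exponent (normalForm t) = t i := by
  classical
  rw [coeff_normalForm, Finset.sum_eq_zero, zero_add, Finset.sum_eq_single i]
  · simp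
  · intro j _ hj
    rw [if_neg fun h => hj (Idx.exponent_injective h)]
  · simp
  · intro k _
    rw [if_neg fun h => exponent_ne_single i k h.symm]

lemma coeff_normalForm_single (t : Params n) (k : Fin (n + 1)) :
    coeff (Finsupp.single k.castSucc (sylvester k)) (normalForm t) = 1 := by
  classical
  rw [coeff_normalForm, Finset.sum_eq_single k, Finset.sum_eq_zero]
  · simp
  · intro i _
    rw [if_neg (exponent_ne_single i k)]
  · intro j _ hj
    refine if_neg fun h => hj ?_
    have h1 := DFunLike.congr_fun h j.castSucc
    rw [Finsupp.single_eq_same] at h1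
    by_contra hjk
    rw [Finsupp.single_eq_of_ne (by simpa using hjk)] at h1
    have := two_le_sylvester j
    omega
  · simp

lemma coeff_normalForm_eq_zero (t : Params n) {d : Fin (n + 2) →₀ ℕ} {k : Fin (n + 1)}
    (h : d k.castSucc + 1 = sylvester k) : coeff d (normalForm t) = 0 := by
  classical
  rw [coeff_normalForm, Finset.sum_eq_zero, Finset.sum_eq_zero, add_zero]
  · intro i _
    refine if_neg ?_
    rintro rfl
    have := i.exponent_lt k
    omega
  · intro j _
    refine if_neg ?_
    rintro rfl
    have := two_le_sylvester k
    by_cases hjk : j = k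
    · subst hjk
      rw [Finsupp.single_eq_same] at h
      omega
    · rw [Finsupp.single_eq_of_ne (by simpa using fun h => hjk h.symm)] at h
      omega

/-- A weighted homogeneous polynomial of degree `d_n` is a normal form as soon as the powers `x_k ^ s_k` have
coefficient one and no monomial contains some `x_k` with exponent `s_k - 1`. -/
lemma eq_normalForm {g : PolyRing n} (hg : IsWeightedHomogeneous (wt n) g (deg n))
    (h1 : ∀ k : Fin (n + 1), coeff (Finsupp.single k.castSucc (sylvester k)) g = 1)
    (h2 : ∀ (k : Fin (n + 1)) (d : Fin (n + 2) →₀ ℕ), d k.castSucc + 1 = sylvester k → coeff d g = 0) :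
    g = normalForm fun i => coeff i.exponent g := by
  ext d
  by_cases hd : Finsupp.weight (wt n) d = deg n
  · rcases classify_exponent hd with ⟨k, rfl⟩ | ⟨k, hk⟩ | ⟨i, rfl⟩
    · rw [h1, coeff_normalForm_single]
    · rw [h2 k d hk, coeff_normalForm_eq_zero _ hk]
    · rw [coeff_normalForm_exponent]
  · rw [hg.coeff_eq_zero d hd, (normalForm_isWeightedHomogeneous _).coeff_eq_zero d hd]

lemma normalForm_injective : Function.Injective (normalForm (n := n)) := fun t t' h => by
  funext i
  rw [← coeff_normalForm_exponent t i, h, coeff_normalForm_exponent]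

lemma normalForm_ne_zero (t : Params n) : normalForm t ≠ 0 := fun h => by
  have := coeff_normalForm_single t 0
  rw [h, coeff_zero] at this
  exact zero_ne_one this

end NormalForm

section IteratedDerivative

variable {σ : Type} {R : Type} [CommRing R]

lemma coeff_iterate_pderiv (k : σ) (m : ℕ) (g : MvPolynomial σ R) (d : σ →₀ ℕ) :
    coeff d ((pderiv k)^[m] g) =
      ((d k + m).descFactorial m : R) * coeff (d + Finsupp.single k m) g := by
  classical
  induction m generalizing d with
  | zero => simp
  | succ m ih =>
    rw [Function.iterate_succ_apply', coeff_pderiv, ih, add_assoc, ← Finsupp.single_add, add_comm 1 m]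
    have : ((d + Finsupp.single k 1 : σ →₀ ℕ) k + m).descFactorial m * (d k + 1) =
        (d k + (m + 1)).descFactorial (m + 1) := by
      rw [Finsupp.add_apply, Finsupp.single_eq_same, Nat.descFactorial_succ, mul_comm]
      congr 1
      · omega
      · congr 1; omega
    rw [← this]
    push_cast
    ring

/-- The chain rule, for a substitution `φ` under which only the image of `x_k` depends on `x_k`. -/
lemma pderiv_algHom {φ : MvPolynomial σ R →ₐ[R] MvPolynomial σ R} {k : σ} {a : R}
    (hk : pderiv k (φ (X k)) = C a) (hj : ∀ j ≠ k, pderiv k (φ (X j)) = 0) (g : MvPolynomial σ R) :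
    pderiv k (φ g) = C a * φ (pderiv k g) := by
  classical
  induction g using MvPolynomial.induction_on with
  | C r => simp [← algebraMap_eq]
  | add p q hp hq => rw [map_add, map_add, hp, hq, map_add, map_add, mul_add]
  | mul_X p j hp =>
    rw [map_mul, pderiv_mul, hp, pderiv_mul, map_add, map_mul, map_mul]
    by_cases h : j = k
    · subst h
      rw [hk, pderiv_X_self, map_one]
      ring
    · rw [hj j h, pderiv_X_of_ne h, map_zero]
      ring

lemma iterate_pderiv_algHom {φ : MvPolynomial σ R →ₐ[R] MvPolynomial σ R} {k : σ} {a : R}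
    (hk : pderiv k (φ (X k)) = C a) (hj : ∀ j ≠ k, pderiv k (φ (X j)) = 0) (m : ℕ)
    (g : MvPolynomial σ R) :
    (pderiv k)^[m] (φ g) = C (a ^ m) * φ ((pderiv k)^[m] g) := by
  induction m with
  | zero => simp
  | succ m ih =>
    rw [Function.iterate_succ_apply', ih, pderiv_C_mul, pderiv_algHom hk hj,
      Function.iterate_succ_apply', pow_succ, C_mul, mul_assoc]

end IteratedDerivative

end

/-! ### Triangular substitutions -/

section

open MvPolynomial

section Triangular

variable {n : ℕ}

/-- A graded endomorphism of the weighted polynomial ring which preserves the line spanned by the last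
variable. As the weights decrease, such an endomorphism is triangular. -/
structure IsTriangular (Θ : PolyRing n →ₐ[ℂ] PolyRing n) : Prop where
  homogeneous : ∀ j, IsWeightedHomogeneous (wt n) (Θ (X j)) (wt n j)
  last : ∃ γ : ℂ, Θ (X (Fin.last _)) = C γ * X (Fin.last _)

/-- The coefficient of `x_k` in `Θ (x_k)`. -/
def diagCoeff (Θ : PolyRing n →ₐ[ℂ] PolyRing n) (k : Fin (n + 2)) : ℂ :=
  coeff (Finsupp.single k 1) (Θ (X k))

/-- `r` is weighted homogeneous of the degree of `x_k`, in later variables. -/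
structure IsLower (k : Fin (n + 1)) (r : PolyRing n) : Prop where
  homogeneous : IsWeightedHomogeneous (wt n) r (degVar n k)
  vars : ∀ j ∈ r.vars, k.castSucc < j

lemma isLower_iff {k : Fin (n + 1)} {r : PolyRing n} (hr : IsWeightedHomogeneous (wt n) r (degVar n k)) :
    IsLower k r ↔ coeff (Finsupp.single k.castSucc 1) r = 0 := by
  constructor
  · rintro ⟨-, h⟩
    by_contra hc
    exact lt_irrefl _ (h k.castSucc ((mem_vars_iff_mem_support _).mpr
      ⟨_, mem_support_iff.mpr hc, by simp⟩))
  · intro h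
    refine ⟨hr, fun j hj => ?_⟩
    obtain ⟨d, hd, hjd⟩ := (mem_vars_iff_mem_support _).mp hj
    rw [mem_support_iff] at hd
    rcases eq_single_or_lt (hr hd) with rfl | h'
    · exact absurd h hd
    · exact h' j (by simpa using hjd)

lemma isLower_sub_coeff {k : Fin (n + 1)} {h : PolyRing n}
    (hh : IsWeightedHomogeneous (wt n) h (degVar n k)) :
    IsLower k (h - C (coeff (Finsupp.single k.castSucc 1) h) * X k.castSucc) := by
  have hX : IsWeightedHomogeneous (wt n) (X k.castSucc : PolyRing n) (degVar n k) := by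
    rw [← wt_castSucc]; exact isWeightedHomogeneous_X ℂ _ _
  rw [isLower_iff (hh.sub (hX.C_mul _))]
  simp

lemma IsLower.mem_supported {k : Fin (n + 1)} {r : PolyRing n} (h : IsLower k r) :
    r ∈ supported ℂ {j | k.castSucc < j} :=
  MvPolynomial.mem_supported.mpr fun j hj => h.vars j hj

lemma IsLower.pderiv_eq_zero {k : Fin (n + 1)} {r : PolyRing n} (h : IsLower k r) {j : Fin (n + 2)}
    (hj : j ≤ k.castSucc) : pderiv j r = 0 :=
  pderiv_eq_zero_of_notMem_vars fun h' => absurd (h.vars j h') hj.not_gt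

lemma algHom_eq_self_of_supported {Θ : PolyRing n →ₐ[ℂ] PolyRing n} {s : Set (Fin (n + 2))}
    (h : ∀ j ∈ s, Θ (X j) = X j) {r : PolyRing n} (hr : r ∈ supported ℂ s) : Θ r = r := by
  have : supported ℂ s ≤ AlgHom.equalizer Θ (AlgHom.id ℂ _) := by
    rw [supported_eq_adjoin_X, Algebra.adjoin_le_iff]
    rintro _ ⟨j, hj, rfl⟩
    exact h j hj
  exact this hr

/-- A graded endomorphism preserves weighted homogeneity. -/
lemma IsTriangular.map_homogeneous {Θ : PolyRing n →ₐ[ℂ] PolyRing n} (hΘ : IsTriangular Θ) {g : PolyRing n}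
    {m : ℕ} (hg : IsWeightedHomogeneous (wt n) g m) : IsWeightedHomogeneous (wt n) (Θ g) m := by
  rw [g.as_sum, map_sum]
  refine IsWeightedHomogeneous.sum _ _ _ fun d hd => ?_
  have hm := hg (mem_support_iff.mp hd)
  rw [monomial_eq, map_mul, Finsupp.prod, map_prod, ← algebraMap_eq, AlgHom.commutes, algebraMap_eq]
  refine IsWeightedHomogeneous.C_mul ?_ _
  rw [← hm, Finsupp.weight_apply, Finsupp.sum]
  refine IsWeightedHomogeneous.prod _ _ _ fun j _ => ?_
  rw [map_pow]
  exact (hΘ.homogeneous j).pow _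

lemma IsTriangular.comp {Θ Φ : PolyRing n →ₐ[ℂ] PolyRing n} (hΘ : IsTriangular Θ) (hΦ : IsTriangular Φ) :
    IsTriangular (Θ.comp Φ) := by
  refine ⟨fun j => hΘ.map_homogeneous (hΦ.homogeneous j), ?_⟩
  obtain ⟨γ, h⟩ := hΘ.last
  obtain ⟨γ', h'⟩ := hΦ.last
  refine ⟨γ' * γ, ?_⟩
  rw [AlgHom.comp_apply, h', map_mul, h, ← algebraMap_eq, AlgHom.commutes, map_mul, mul_assoc]

lemma IsTriangular.isLower {Θ : PolyRing n →ₐ[ℂ] PolyRing n} (hΘ : IsTriangular Θ) (k : Fin (n + 1)) :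
    IsLower k (Θ (X k.castSucc) - C (diagCoeff Θ k.castSucc) * X k.castSucc) := by
  have := hΘ.homogeneous k.castSucc
  rw [wt_castSucc] at this
  exact isLower_sub_coeff this

lemma IsTriangular.apply_last {Θ : PolyRing n →ₐ[ℂ] PolyRing n} (hΘ : IsTriangular Θ) :
    Θ (X (Fin.last _)) = C (diagCoeff Θ (Fin.last _)) * X (Fin.last _) := by
  obtain ⟨γ, h⟩ := hΘ.last
  rw [diagCoeff, h]
  simp

lemma IsTriangular.pderiv_self {Θ : PolyRing n →ₐ[ℂ] PolyRing n} (hΘ : IsTriangular Θ) (k : Fin (n + 1)) :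
    pderiv k.castSucc (Θ (X k.castSucc)) = C (diagCoeff Θ k.castSucc) := by
  have := (hΘ.isLower k).pderiv_eq_zero le_rfl
  rwa [map_sub, pderiv_C_mul, pderiv_X_self, sub_eq_zero, mul_one] at this

lemma IsTriangular.pderiv_of_lt {Θ : PolyRing n →ₐ[ℂ] PolyRing n} (hΘ : IsTriangular Θ) {k : Fin (n + 1)}
    {j : Fin (n + 2)} (hj : k.castSucc < j) : pderiv k.castSucc (Θ (X j)) = 0 := by
  induction j using Fin.lastCases with
  | last => rw [hΘ.apply_last, pderiv_C_mul, pderiv_X_of_ne hj.ne', mul_zero]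
  | cast j =>
    have := (hΘ.isLower j).pderiv_eq_zero hj.le
    rwa [map_sub, pderiv_C_mul, pderiv_X_of_ne hj.ne', sub_eq_zero, mul_zero] at this

/-- The restriction of a polynomial to the `k`-th coordinate axis. -/
def axis (k : Fin (n + 1)) : PolyRing n →ₐ[ℂ] Polynomial ℂ :=
  aeval (Pi.single k.castSucc Polynomial.X)

lemma coeff_axis (k : Fin (n + 1)) (m : ℕ) (g : PolyRing n) :
    (axis k g).coeff m = coeff (Finsupp.single k.castSucc m) g := by
  classical
  induction g using MvPolynomial.induction_on' with
  | add p q hp hq => rw [map_add, Polynomial.coeff_add, hp, hq, coeff_add]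
  | monomial d c =>
    rw [axis, aeval_monomial, coeff_monomial, Finsupp.prod_fintype _ _ (by simp),
      Polynomial.algebraMap_eq, Polynomial.coeff_C_mul]
    by_cases h : ∃ j ≠ k.castSucc, d j ≠ 0
    · obtain ⟨j, hj, hd⟩ := h
      rw [Finset.prod_eq_zero (Finset.mem_univ j) (by rw [Pi.single_eq_of_ne hj, zero_pow hd]),
        if_neg, Polynomial.coeff_zero, mul_zero]
      rintro rfl
      exact hd (Finsupp.single_eq_of_ne hj)
    · push Not at h
      have hd : d = Finsupp.single k.castSucc (d k.castSucc) := by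
        ext j
        by_cases hj : j = k.castSucc
        · rw [hj, Finsupp.single_eq_same]
        · rw [h j hj, Finsupp.single_eq_of_ne hj]
      rw [Finset.prod_eq_single k.castSucc (fun j _ hj => by rw [h j hj, pow_zero]) (by simp),
        Pi.single_eq_same, Polynomial.coeff_X_pow]
      by_cases hm : m = d k.castSucc
      · rw [if_pos hm, hm, if_pos hd, mul_one]
      · rw [if_neg hm, mul_zero, if_neg]
        intro h'
        apply hm
        rw [h', Finsupp.single_eq_same]

/-- As `s_j` divides the weight of `x_k` for `j ≠ k`, but not the one of `x_j`, no power of `x_k` has the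
weight of another variable. So graded endomorphisms preserve the coordinate axes. -/
lemma IsTriangular.axis_apply {Θ : PolyRing n →ₐ[ℂ] PolyRing n} (hΘ : IsTriangular Θ) (k : Fin (n + 1))
    (g : PolyRing n) :
    axis k (Θ g) = (axis k g).comp (Polynomial.C (diagCoeff Θ k.castSucc) * Polynomial.X) := by
  have key : (axis k).comp Θ = (Polynomial.aeval
      (Polynomial.C (diagCoeff Θ k.castSucc) * Polynomial.X : Polynomial ℂ)).comp (axis k) := by
    apply MvPolynomial.algHom_ext
    intro j
    have hax : axis k (X j) = (Pi.single k.castSucc Polynomial.X : Fin (n + 2) → Polynomial ℂ) j := by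
      rw [axis, aeval_X]
    rw [AlgHom.comp_apply, AlgHom.comp_apply, hax]
    ext m
    rw [coeff_axis]
    by_cases hj : j = k.castSucc
    · subst hj
      rw [Pi.single_eq_same, Polynomial.aeval_X, Polynomial.coeff_C_mul, Polynomial.coeff_X]
      split_ifs with hm
      · rw [← hm, mul_one, diagCoeff]
      · rw [mul_zero]
        refine (hΘ.homogeneous _).coeff_eq_zero _ ?_
        rw [weight_single]
        intro h
        have := wt_pos (n := n) k.castSucc
        have h2 : m = 1 := Nat.eq_of_mul_eq_mul_right this (by rw [h, one_mul])
        exact hm h2.symm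
    · rw [Pi.single_eq_of_ne hj, map_zero, Polynomial.coeff_zero]
      induction j using Fin.lastCases with
      | last =>
        rw [hΘ.apply_last, coeff_C_mul, coeff_X, if_neg, mul_zero]
        intro h
        have := DFunLike.congr_fun h (Fin.last (n + 1))
        rw [Finsupp.single_eq_same, Finsupp.single_eq_of_ne hj] at this
        exact one_ne_zero this
      | cast j =>
        refine (hΘ.homogeneous _).coeff_eq_zero _ ?_
        rw [weight_single, wt_castSucc, wt_castSucc]
        intro h
        have hjk : (j : ℕ) ≠ k := fun h => hj (by rw [Fin.ext h])
        have h1 : sylvester j ∣ degVar n j := by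
          rw [← h]
          exact (sylvester_dvd_degVar hjk (by omega)).mul_left m
        have h2 := Nat.Coprime.eq_one_of_dvd (coprime_sylvester_degVar n j) h1
        have := two_le_sylvester j
        omega
  have := DFunLike.congr_fun key g
  rwa [AlgHom.comp_apply, AlgHom.comp_apply, ← Polynomial.comp_eq_aeval] at this

lemma IsTriangular.coeff_single {Θ : PolyRing n →ₐ[ℂ] PolyRing n} (hΘ : IsTriangular Θ) (k : Fin (n + 1))
    (m : ℕ) (g : PolyRing n) : coeff (Finsupp.single k.castSucc m) (Θ g) =
      diagCoeff Θ k.castSucc ^ m * coeff (Finsupp.single k.castSucc m) g := by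
  rw [← coeff_axis, hΘ.axis_apply, Polynomial.comp_C_mul_X_coeff, coeff_axis, mul_comm]

lemma IsTriangular.diagCoeff_comp {Θ Φ : PolyRing n →ₐ[ℂ] PolyRing n} (hΘ : IsTriangular Θ)
    (k : Fin (n + 1)) :
    diagCoeff (Θ.comp Φ) k.castSucc = diagCoeff Θ k.castSucc * diagCoeff Φ k.castSucc := by
  exact (hΘ.coeff_single k 1 _).trans (by rw [pow_one]; rfl)

/-- The kernels of the iterates of an endomorphism form an ascending chain, which becomes stationary in a
noetherian ring. -/
lemma injective_of_surjective_endomorphism {A : Type} [CommRing A] [IsNoetherianRing A] (f : A →+* A)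
    (hf : Function.Surjective f) : Function.Injective f := by
  obtain ⟨m, hm⟩ := monotone_stabilizes_iff_noetherian.mpr (inferInstance : IsNoetherian A A)
    ⟨fun i : ℕ => RingHom.ker (f ^ i : A →+* A), monotone_nat_of_le_succ fun i a ha => by
      rw [RingHom.mem_ker] at ha ⊢
      rw [pow_succ', RingHom.mul_def, RingHom.comp_apply, ha, map_zero]⟩
  have hs : ∀ i : ℕ, Function.Surjective (f ^ i : A →+* A) := by
    intro i
    induction i with
    | zero => exact fun a => ⟨a, rfl⟩
    | succ i ih => rw [pow_succ']; exact hf.comp ih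
  rw [injective_iff_map_eq_zero]
  intro a ha
  obtain ⟨b, rfl⟩ := hs m a
  have h1 : b ∈ RingHom.ker (f ^ (m + 1)) := by
    rw [RingHom.mem_ker, pow_succ', RingHom.mul_def, RingHom.comp_apply, ha]
  rw [← show RingHom.ker (f ^ m) = RingHom.ker (f ^ (m + 1)) from hm (m + 1) (Nat.le_succ m)] at h1
  exact h1

/-- A triangular endomorphism with nonzero diagonal is bijective: the variables lie in its image, by descending
induction, so that it is surjective, hence injective. -/
lemma IsTriangular.bijective {Θ : PolyRing n →ₐ[ℂ] PolyRing n} (hΘ : IsTriangular Θ)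
    (h : ∀ j, diagCoeff Θ j ≠ 0) : Function.Bijective Θ := by
  have key : ∀ j : Fin (n + 2), X j ∈ Θ.range := by
    intro j
    induction j using WellFoundedGT.induction with
    | _ j ih =>
    have hC : ∀ c : ℂ, C c ∈ Θ.range := fun c => ⟨C c, by rw [← algebraMap_eq]; exact Θ.commutes c⟩
    have hlin : C (diagCoeff Θ j) * X j ∈ Θ.range := by
      induction j using Fin.lastCases with
      | last => rw [← hΘ.apply_last]; exact ⟨_, rfl⟩
      | cast k =>
        have h1 : Θ (X k.castSucc) - C (diagCoeff Θ k.castSucc) * X k.castSucc ∈ Θ.range := by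
          have h2 : supported ℂ {j | k.castSucc < j} ≤ Θ.range := by
            rw [supported_eq_adjoin_X, Algebra.adjoin_le_iff]
            rintro _ ⟨j, hj, rfl⟩
            exact ih j hj
          exact h2 (hΘ.isLower k).mem_supported
        have := Subalgebra.sub_mem _ (show Θ (X k.castSucc) ∈ Θ.range from ⟨_, rfl⟩) h1
        rwa [sub_sub_cancel] at this
    have := Subalgebra.mul_mem _ (hC (diagCoeff Θ j)⁻¹) hlin
    rwa [← mul_assoc, ← C_mul, inv_mul_cancel₀ (h j), C_1, one_mul] at this
  have hs : Function.Surjective Θ := by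
    have : (⊤ : Subalgebra ℂ (PolyRing n)) ≤ Θ.range := by
      rw [← MvPolynomial.adjoin_range_X, Algebra.adjoin_le_iff]
      rintro _ ⟨j, rfl⟩
      exact key j
    exact fun g => this (Algebra.mem_top (x := g))
  exact ⟨injective_of_surjective_endomorphism Θ.toRingHom hs, hs⟩

lemma IsTriangular.map_component {Θ : PolyRing n →ₐ[ℂ] PolyRing n} (hΘ : IsTriangular Θ) (m : ℕ)
    (g : PolyRing n) : Θ (weightedHomogeneousComponent (wt n) m g) =
      weightedHomogeneousComponent (wt n) m (Θ g) := by
  classical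
  induction g using MvPolynomial.induction_on' with
  | add p q hp hq => simp only [map_add, hp, hq]
  | monomial d c =>
    have hd := isWeightedHomogeneous_monomial (wt n) d c rfl
    by_cases h : Finsupp.weight (wt n) d = m
    · rw [h] at hd
      rw [weightedHomogeneousComponent_eq_self hd,
        weightedHomogeneousComponent_eq_self (hΘ.map_homogeneous hd)]
    · rw [hd.weightedHomogeneousComponent_ne _ (Ne.symm h), map_zero,
        (hΘ.map_homogeneous hd).weightedHomogeneousComponent_ne _ (Ne.symm h)]

/-- A graded bijection reflects weighted homogeneity. -/
lemma IsTriangular.homogeneous_of_map {Θ : PolyRing n →ₐ[ℂ] PolyRing n} (hΘ : IsTriangular Θ)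
    (hb : Function.Injective Θ) {g : PolyRing n} {m : ℕ} (hg : IsWeightedHomogeneous (wt n) (Θ g) m) :
    IsWeightedHomogeneous (wt n) g m := by
  have h1 := hΘ.map_component m g
  rw [weightedHomogeneousComponent_eq_self hg] at h1
  rw [← hb h1]
  exact weightedHomogeneousComponent_isWeightedHomogeneous m g

end Triangular

end

/-! ### Rigidity of normal forms -/

section

open MvPolynomial

section Rigidity

variable {n : ℕ}

/-- Differentiating a polynomial of degree `d_n` in `x_k` as often as `s_k - 1` times gives the degree of `x_k`. -/
lemma iterate_pderiv_isWeightedHomogeneous {g : PolyRing n} (hg : IsWeightedHomogeneous (wt n) g (deg n))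
    (k : Fin (n + 1)) :
    IsWeightedHomogeneous (wt n) ((pderiv k.castSucc)^[sylvester k - 1] g) (degVar n k) := by
  intro d hd
  rw [coeff_iterate_pderiv] at hd
  have h1 := hg (right_ne_zero_of_mul hd)
  rw [weight_add_single, wt_castSucc] at h1
  have h2 := sylvester_mul_degVar n k
  have h3 := two_le_sylvester k
  obtain ⟨s, hs⟩ : ∃ s, sylvester k = s + 1 := ⟨sylvester k - 1, by omega⟩
  rw [hs, Nat.add_sub_cancel] at h1
  rw [hs, add_mul, one_mul] at h2
  omega

lemma coeff_single_iterate_pderiv (g : PolyRing n) (k : Fin (n + 1)) :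
    coeff (Finsupp.single k.castSucc 1) ((pderiv k.castSucc)^[sylvester k - 1] g) =
      (sylvester k).factorial * coeff (Finsupp.single k.castSucc (sylvester k)) g := by
  have h3 := two_le_sylvester k
  have h4 : 1 + (sylvester k - 1) = sylvester k := by omega
  rw [coeff_iterate_pderiv, ← Finsupp.single_add, Finsupp.single_eq_same, h4]
  congr 2
  obtain ⟨s, hs⟩ : ∃ s, sylvester k = s + 1 := ⟨sylvester k - 1, by omega⟩
  have := Nat.factorial_mul_descFactorial (Nat.le_succ s)
  rw [Nat.succ_sub (le_refl s), Nat.sub_self, Nat.factorial_one, one_mul] at this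
  rw [hs, Nat.add_sub_cancel, this]

/-- The condition that no monomial contains `x_k` with exponent `s_k - 1`, and that `x_k ^ s_k` has coefficient
one, in terms of the derivative of order `s_k - 1`. -/
lemma iterate_pderiv_normalForm (t : Params n) (k : Fin (n + 1)) :
    (pderiv k.castSucc)^[sylvester k - 1] (normalForm t) = C ((sylvester k).factorial : ℂ) * X k.castSucc := by
  ext d
  by_cases hd : d = Finsupp.single k.castSucc 1
  · subst hd
    rw [coeff_single_iterate_pderiv, coeff_normalForm_single, coeff_C_mul, coeff_X, if_pos rfl]
  · have h3 := two_le_sylvester k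
    rw [coeff_C_mul, coeff_X, if_neg (Ne.symm hd), mul_zero]
    by_contra hc
    have h1 := iterate_pderiv_isWeightedHomogeneous (normalForm_isWeightedHomogeneous t) k hc
    rcases eq_single_or_lt h1 with h | h
    · exact hd h
    · have h0 : d k.castSucc = 0 := by
        by_contra h0
        exact lt_irrefl _ (h _ h0)
      rw [coeff_iterate_pderiv, coeff_normalForm_eq_zero (k := k), mul_zero] at hc
      · exact hc rfl
      · rw [Finsupp.add_apply, Finsupp.single_eq_same]; omega

/-- A triangular substitution between normal forms is diagonal: no power can be completed further. -/
lemma IsTriangular.eq_diagonal {Θ : PolyRing n →ₐ[ℂ] PolyRing n} (hΘ : IsTriangular Θ)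
    (h0 : ∀ k : Fin (n + 1), diagCoeff Θ k.castSucc ≠ 0) {t t' : Params n} {l : ℂ}
    (h : Θ (normalForm t) = C l * normalForm t') (k : Fin (n + 1)) :
    Θ (X k.castSucc) = C (diagCoeff Θ k.castSucc) * X k.castSucc := by
  induction k using WellFoundedLT.induction with
  | _ k ih =>
  have h1 : (pderiv k.castSucc)^[sylvester k - 1] (Θ (normalForm t)) =
      C (l * (sylvester k).factorial) * X k.castSucc := by
    rw [h, C_mul, mul_assoc, ← iterate_pderiv_normalForm t' k]
    generalize sylvester k - 1 = m
    induction m with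
    | zero => rfl
    | succ m ihm => rw [Function.iterate_succ_apply', ihm, pderiv_C_mul, Function.iterate_succ_apply']
  -- the chain rule applies, since by induction the images of the earlier variables do not contain `x_k`
  rw [iterate_pderiv_algHom (hΘ.pderiv_self k), iterate_pderiv_normalForm, map_mul,
    show Θ (C _) = C _ from Θ.commutes _, ← mul_assoc, ← C_mul] at h1
  · set a := diagCoeff Θ k.castSucc ^ (sylvester k - 1) * ((sylvester k).factorial : ℂ) with ha_def
    have ha : a ≠ 0 := mul_ne_zero (pow_ne_zero _ (h0 k)) (by exact_mod_cast (sylvester k).factorial_ne_zero)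
    have h2 : Θ (X k.castSucc) = C (a⁻¹ * (l * (sylvester k).factorial)) * X k.castSucc := by
      rw [C_mul, mul_assoc, ← h1, ← mul_assoc, ← C_mul, inv_mul_cancel₀ ha, C_1, one_mul]
    have h3 : diagCoeff Θ k.castSucc = a⁻¹ * (l * (sylvester k).factorial) := by
      rw [diagCoeff, h2, coeff_C_mul, coeff_X, if_pos rfl, mul_one]
    rw [h3, h2]
  · intro j hj
    rcases lt_or_gt_of_ne hj with hj | hj
    · obtain ⟨j, rfl⟩ : ∃ j' : Fin (n + 1), j'.castSucc = j :=
        Fin.exists_castSucc_eq.mpr (by rintro rfl; exact absurd (Fin.le_last _) hj.not_ge)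
      rw [ih j (by simpa using hj), pderiv_C_mul, pderiv_X_of_ne hj.ne, mul_zero]
    · exact hΘ.pderiv_of_lt hj

lemma IsTriangular.diagCoeff_pow {Θ : PolyRing n →ₐ[ℂ] PolyRing n} (hΘ : IsTriangular Θ)
    {t t' : Params n} {l : ℂ} (h : Θ (normalForm t) = C l * normalForm t') (k : Fin (n + 1)) :
    diagCoeff Θ k.castSucc ^ sylvester k = l := by
  have h1 := hΘ.coeff_single k (sylvester k) (normalForm t)
  rw [h, coeff_C_mul, coeff_normalForm_single, coeff_normalForm_single, mul_one, mul_one] at h1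
  exact h1.symm

lemma coeff_of_diagonal {Θ : PolyRing n →ₐ[ℂ] PolyRing n} {v : Fin (n + 2) → ℂ}
    (h : ∀ j, Θ (X j) = C (v j) * X j) (g : PolyRing n) (d : Fin (n + 2) →₀ ℕ) :
    coeff d (Θ g) = (∏ j, v j ^ d j) * coeff d g := by
  classical
  induction g using MvPolynomial.induction_on' with
  | add p q hp hq => rw [map_add, coeff_add, hp, hq, coeff_add, mul_add]
  | monomial e c =>
    have h1 : Θ (monomial e c) = monomial e (c * ∏ j, v j ^ e j) := by
      rw [monomial_eq, map_mul, show Θ (C c) = C c from Θ.commutes c, Finsupp.prod_fintype _ _ (by simp),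
        map_prod, monomial_eq, Finsupp.prod_fintype _ _ (by simp), C_mul, map_prod, mul_assoc,
        ← Finset.prod_mul_distrib]
      congr 1
      refine Finset.prod_congr rfl fun j _ => ?_
      rw [map_pow, h, mul_pow, C_pow]
    rw [h1, coeff_monomial, coeff_monomial]
    split_ifs with he
    · rw [he, mul_comm]
    · rw [mul_zero]

/-- Given numbers `α_k` with the same `s_k`-th powers `α_k ^ s_k = l`, there is a common `ρ` with
`ρ ^ d_{n,k} = α_k`, by the Chinese remainder theorem. -/
lemma exists_common_root {l : ℂ} (hl : l ≠ 0) {α : Fin (n + 1) → ℂ} (h : ∀ k, α k ^ sylvester k = l) :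
    ∃ ρ : ℂ, ρ ≠ 0 ∧ ρ ^ deg n = l ∧ ∀ k : Fin (n + 1), ρ ^ degVar n k = α k := by
  -- start from any `d_n`-th root `ρ` of `l`: then `α_k` and `ρ ^ d_{n,k}` differ by an `s_k`-th root of unity
  obtain ⟨ρ, hρ⟩ := IsAlgClosed.exists_pow_nat_eq l (deg_pos n)
  have hρ0 : ρ ≠ 0 := by
    rintro rfl
    rw [zero_pow (deg_pos n).ne'] at hρ
    exact hl hρ.symm
  have hζ : ∀ k : Fin (n + 1), (α k / ρ ^ degVar n k) ^ sylvester k = 1 := by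
    intro k
    rw [div_pow, h, ← pow_mul, mul_comm, sylvester_mul_degVar, hρ, div_self hl]
  -- `ζ_k ^ e_k` has the `d_{n,k}`-th power `ζ_k`, and its `d_{n,j}`-th power is `1` for `j ≠ k`, as `s_k ∣ d_{n,j}`
  have he : ∀ k : Fin (n + 1), ∃ e : ℕ, degVar n k * e ≡ 1 [MOD sylvester k] := fun k =>
    Nat.exists_mul_mod_eq_one_of_coprime (coprime_sylvester_degVar n k).symm (two_le_sylvester k)
      |>.imp fun e he => by rw [Nat.ModEq, he.2, Nat.mod_eq_of_lt (two_le_sylvester k)]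
  choose e he using he
  set ζ : Fin (n + 1) → ℂ := fun k => α k / ρ ^ degVar n k with hζ_def
  have key : ∀ j : Fin (n + 1), (∏ k, ζ k ^ e k) ^ degVar n j = ζ j := by
    intro j
    rw [← Finset.prod_pow, Finset.prod_eq_single j]
    · rw [← pow_mul, mul_comm, pow_eq_pow_mod _ (hζ j), he j, Nat.mod_eq_of_lt (two_le_sylvester j), pow_one]
    · intro k _ hk
      obtain ⟨c, hc⟩ := sylvester_dvd_degVar (n := n) (j := k) (k := j) (fun h => hk (Fin.ext h)) (by omega)
      rw [← pow_mul, hc, mul_left_comm, pow_mul, hζ, one_pow]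
    · simp
  have hζ0 : ∀ k, ζ k ≠ 0 := fun k h0 => by
    have := hζ k
    rw [show α k / ρ ^ degVar n k = 0 from h0, zero_pow (by have := two_le_sylvester k; omega)] at this
    exact zero_ne_one this
  refine ⟨ρ * ∏ k, ζ k ^ e k, mul_ne_zero hρ0 (Finset.prod_ne_zero_iff.mpr fun k _ => pow_ne_zero _ (hζ0 k)),
    ?_, fun k => ?_⟩
  · rw [← sylvester_mul_degVar n 0, mul_comm (sylvester _), pow_mul, mul_pow, key, mul_div_cancel₀ _ (pow_ne_zero _ hρ0)]
    exact h 0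
  · rw [mul_pow, key, mul_div_cancel₀ _ (pow_ne_zero _ hρ0)]

/-- Triangular substitutions identify normal forms only along the orbits of the torus. -/
lemma IsTriangular.exists_rescale {Θ : PolyRing n →ₐ[ℂ] PolyRing n} (hΘ : IsTriangular Θ)
    (h0 : ∀ j, diagCoeff Θ j ≠ 0) {t t' : Params n} {l : ℂ}
    (h : Θ (normalForm t) = C l * normalForm t') : ∃ c : ℂ, c ≠ 0 ∧ t' = rescale c t := by
  have hpow := hΘ.diagCoeff_pow h
  have hl : l ≠ 0 := by
    rw [← hpow 0]
    exact pow_ne_zero _ (h0 _)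
  obtain ⟨ρ, hρ0, hρ, hρα⟩ := exists_common_root hl hpow
  -- dividing out the action of `ρ`, which multiplies `F` by `l`, leaves a scaling of the last variable only
  refine ⟨diagCoeff Θ (Fin.last _) / ρ, div_ne_zero (h0 _) hρ0, ?_⟩
  funext i
  have hdiag : ∀ j, Θ (X j) = C (diagCoeff Θ j) * X j := by
    intro j
    induction j using Fin.lastCases with
    | last => exact hΘ.apply_last
    | cast k => exact hΘ.eq_diagonal (fun k => h0 _) h k
  have h1 := coeff_of_diagonal hdiag (normalForm t) i.exponent
  rw [h, coeff_C_mul, coeff_normalForm_exponent, coeff_normalForm_exponent, Fin.prod_univ_castSucc] at h1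
  simp only [Idx.exponent_castSucc, Idx.exponent_last, ← hρα, ← pow_mul] at h1
  rw [Finset.prod_pow_eq_pow_sum] at h1
  have h2 : l = ρ ^ (∑ k : Fin (n + 1), degVar n k * (i.1 k : ℕ)) * ρ ^ i.weight := by
    rw [← pow_add, ← hρ]
    congr 1
    have := i.2
    simp only [mul_comm (degVar n _)]
    unfold Idx.weight
    omega
  rw [h2, mul_assoc, mul_assoc] at h1
  have h3 := mul_left_cancel₀ (pow_ne_zero _ hρ0) h1
  rw [rescale, div_pow, div_mul_eq_mul_div, eq_div_iff (pow_ne_zero _ hρ0), mul_comm, h3]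

end Rigidity

end

/-! ### Completing powers -/

section

open MvPolynomial

section Normalization

variable {n : ℕ}

/-- The substitution `x_k ↦ a_k x_k + p_k`, `x_{n+1} ↦ x_{n+1}`. -/
def triangularSubst (a : Fin (n + 1) → ℂ) (p : Fin (n + 1) → PolyRing n) : PolyRing n →ₐ[ℂ] PolyRing n :=
  aeval (Fin.snoc (α := fun _ => PolyRing n) (fun k : Fin (n + 1) => C (a k) * X k.castSucc + p k)
    (X (Fin.last (n + 1))))

lemma triangularSubst_X_castSucc (a : Fin (n + 1) → ℂ) (p : Fin (n + 1) → PolyRing n) (k : Fin (n + 1)) :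
    triangularSubst a p (X k.castSucc) = C (a k) * X k.castSucc + p k := by
  simp [triangularSubst]

lemma triangularSubst_X_last (a : Fin (n + 1) → ℂ) (p : Fin (n + 1) → PolyRing n) :
    triangularSubst a p (X (Fin.last _)) = X (Fin.last _) := by
  simp [triangularSubst]

lemma diagCoeff_triangularSubst (a : Fin (n + 1) → ℂ) {p : Fin (n + 1) → PolyRing n}
    (hp : ∀ k, IsLower k (p k)) (k : Fin (n + 1)) :
    diagCoeff (triangularSubst a p) k.castSucc = a k := by
  rw [diagCoeff, triangularSubst_X_castSucc, coeff_add, (isLower_iff (hp k).homogeneous).mp (hp k),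
    coeff_C_mul, coeff_X, if_pos rfl, mul_one, add_zero]

lemma isTriangular_triangularSubst (a : Fin (n + 1) → ℂ) {p : Fin (n + 1) → PolyRing n}
    (hp : ∀ k, IsLower k (p k)) : IsTriangular (triangularSubst a p) where
  homogeneous j := by
    induction j using Fin.lastCases with
    | last => rw [triangularSubst_X_last]; exact isWeightedHomogeneous_X ℂ _ _
    | cast k =>
      rw [triangularSubst_X_castSucc]
      refine ((isWeightedHomogeneous_X ℂ _ _).C_mul _).add ?_
      rw [wt_castSucc]
      exact (hp k).homogeneous
  last := ⟨1, by rw [triangularSubst_X_last, C_1, one_mul]⟩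

lemma IsTriangular.eq_triangularSubst {Θ : PolyRing n →ₐ[ℂ] PolyRing n}
    (hl : Θ (X (Fin.last _)) = X (Fin.last _)) :
    Θ = triangularSubst (fun k => diagCoeff Θ k.castSucc)
      fun k => Θ (X k.castSucc) - C (diagCoeff Θ k.castSucc) * X k.castSucc := by
  apply MvPolynomial.algHom_ext
  intro j
  induction j using Fin.lastCases with
  | last => rw [triangularSubst_X_last, hl]
  | cast k => rw [triangularSubst_X_castSucc, add_sub_cancel]

lemma isLower_zero (k : Fin (n + 1)) : IsLower k (0 : PolyRing n) :=
  ⟨isWeightedHomogeneous_zero ℂ _ _, by simp⟩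

/-- Completing the power of `x_k`: writing `∂_k ^ (s_k - 1) g = s_k! c x_k + q`, the substitution
`x_k ↦ a x_k - q / (s_k! c)` with `a ^ s_k c = 1` removes `q`. -/
lemma exists_complete_power {g : PolyRing n} (hg : IsWeightedHomogeneous (wt n) g (deg n)) (k : Fin (n + 1))
    {a : ℂ} (ha : a ^ sylvester k * coeff (Finsupp.single k.castSucc (sylvester k)) g = 1) :
    ∃ q : PolyRing n, IsLower k q ∧
      (pderiv k.castSucc)^[sylvester k - 1]
        (triangularSubst (Function.update 1 k a) (Function.update 0 k q) g) =
        C ((sylvester k).factorial : ℂ) * X k.castSucc := by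
  set c := coeff (Finsupp.single k.castSucc (sylvester k)) g with hc_def
  have hc : c ≠ 0 := right_ne_zero_of_mul_eq_one ha
  have hf : ((sylvester k).factorial : ℂ) ≠ 0 := by exact_mod_cast (sylvester k).factorial_ne_zero
  set h := (pderiv k.castSucc)^[sylvester k - 1] g with h_def
  have hh := isLower_sub_coeff (iterate_pderiv_isWeightedHomogeneous hg k)
  rw [coeff_single_iterate_pderiv, ← h_def, ← hc_def] at hh
  set r := h - C ((sylvester k).factorial * c) * X k.castSucc with hr
  have hq : IsLower k (-(C ((sylvester k).factorial * c)⁻¹ * r)) := by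
    rw [isLower_iff (hh.homogeneous.C_mul _).neg, coeff_neg, coeff_C_mul,
      (isLower_iff hh.homogeneous).mp hh, mul_zero, neg_zero]
  refine ⟨_, hq, ?_⟩
  set q := -(C ((sylvester k).factorial * c)⁻¹ * r) with hq_def
  have hlow : ∀ j, IsLower j ((Function.update 0 k q : Fin (n + 1) → PolyRing n) j) := by
    intro j
    by_cases hj : j = k
    · subst hj; rwa [Function.update_self]
    · rw [Function.update_of_ne hj]; exact isLower_zero j
  set σ := triangularSubst (Function.update 1 k a) (Function.update 0 k q) with hσ
  have hσt : IsTriangular σ := isTriangular_triangularSubst _ hlow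
  have hσk : σ (X k.castSucc) = C a * X k.castSucc + q := by
    rw [hσ, triangularSubst_X_castSucc, Function.update_self, Function.update_self]
  have hσj : ∀ j ≠ k.castSucc, σ (X j) = X j := by
    intro j hj
    induction j using Fin.lastCases with
    | last => exact triangularSubst_X_last _ _
    | cast j =>
      have : j ≠ k := fun h => hj (by rw [h])
      rw [hσ, triangularSubst_X_castSucc, Function.update_of_ne this, Function.update_of_ne this]
      simp
  have hd : diagCoeff σ k.castSucc = a := by
    rw [hσ, diagCoeff_triangularSubst _ hlow, Function.update_self]
  have hσr : σ r = r := algHom_eq_self_of_supported (fun j hj => hσj j (ne_of_gt hj)) hh.mem_supported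
  rw [iterate_pderiv_algHom (a := a) (by rw [← hd]; exact hσt.pderiv_self k)
    (fun j hj => by rw [hσj j hj, pderiv_X_of_ne hj])]
  have h1 : h = C ((sylvester k).factorial * c) * X k.castSucc + r := by rw [hr]; ring
  have hcf : C ((sylvester k).factorial * c) * q = -r := by
    rw [hq_def, mul_neg, ← mul_assoc, ← C_mul, mul_inv_cancel₀ (mul_ne_zero hf hc), C_1, one_mul]
  have hs : sylvester k = sylvester k - 1 + 1 := by have := two_le_sylvester k; omega
  rw [← h_def, h1, map_add, map_mul, hσr, show σ (C _) = C _ from σ.commutes _, hσk,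
    mul_add (C ((sylvester k).factorial * c)), hcf,
    neg_add_cancel_right, ← mul_assoc, ← mul_assoc, ← C_mul, ← C_mul]
  congr 2
  have h2 : a ^ (sylvester k - 1) * a = a ^ sylvester k := by rw [← pow_succ, ← hs]
  calc a ^ (sylvester k - 1) * ((sylvester k).factorial * c) * a
      = (sylvester k).factorial * ((a ^ (sylvester k - 1) * a) * c) := by ring
    _ = _ := by rw [h2, ha, mul_one]

/-- The powers of `x_0, …, x_{m-1}` can be completed, one after the other. -/
lemma exists_complete_powers {g : PolyRing n} (hg : IsWeightedHomogeneous (wt n) g (deg n))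
    {a : Fin (n + 1) → ℂ}
    (ha : ∀ k, a k ^ sylvester k * coeff (Finsupp.single k.castSucc (sylvester k)) g = 1) (m : ℕ) (hm : m ≤ n + 1) :
    ∃ Θ : PolyRing n →ₐ[ℂ] PolyRing n, IsTriangular Θ ∧ Θ (X (Fin.last _)) = X (Fin.last _) ∧
      (∀ k : Fin (n + 1), m ≤ k → Θ (X k.castSucc) = X k.castSucc) ∧
      ∀ k : Fin (n + 1), (k : ℕ) < m → diagCoeff Θ k.castSucc = a k ∧
        (pderiv k.castSucc)^[sylvester k - 1] (Θ g) = C ((sylvester k).factorial : ℂ) * X k.castSucc := by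
  induction m with
  | zero =>
    exact ⟨AlgHom.id ℂ _, ⟨fun j => isWeightedHomogeneous_X ℂ _ _, 1, by simp⟩, rfl, fun _ _ => rfl,
      fun k hk => absurd hk (Nat.not_lt_zero _)⟩
  | succ m ih =>
    obtain ⟨Θ, hΘ, hΘl, hΘ1, hΘ2⟩ := ih (by omega)
    set i : Fin (n + 1) := ⟨m, by omega⟩ with hi
    have hdi : diagCoeff Θ i.castSucc = 1 := by
      rw [diagCoeff, hΘ1 i le_rfl, coeff_X, if_pos rfl]
    have hai : a i ^ sylvester i * coeff (Finsupp.single i.castSucc (sylvester i)) (Θ g) = 1 := by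
      rw [hΘ.coeff_single, hdi, one_pow, one_mul, ha]
    obtain ⟨q, hq, hqd⟩ := exists_complete_power (hΘ.map_homogeneous hg) i hai
    have hlow : ∀ j, IsLower j ((Function.update 0 i q : Fin (n + 1) → PolyRing n) j) := by
      intro j
      by_cases hj : j = i
      · subst hj; rwa [Function.update_self]
      · rw [Function.update_of_ne hj]; exact isLower_zero j
    set σ := triangularSubst (Function.update 1 i (a i)) (Function.update 0 i q) with hσ
    have hσt : IsTriangular σ := isTriangular_triangularSubst _ hlow
    have hσj : ∀ j ≠ i, σ (X j.castSucc) = X j.castSucc := by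
      intro j hj
      rw [hσ, triangularSubst_X_castSucc, Function.update_of_ne hj, Function.update_of_ne hj]
      simp
    have hσl : σ (X (Fin.last _)) = X (Fin.last _) := triangularSubst_X_last _ _
    refine ⟨σ.comp Θ, hσt.comp hΘ, by rw [AlgHom.comp_apply, hΘl, hσl], fun k hk => ?_, fun k hk => ?_⟩
    · rw [AlgHom.comp_apply, hΘ1 k (by omega), hσj k (by rintro rfl; simp [hi] at hk)]
    · rw [hσt.diagCoeff_comp, AlgHom.comp_apply]
      by_cases hki : k = i
      · subst hki
        refine ⟨?_, hqd⟩
        rw [hdi, mul_one, hσ, diagCoeff_triangularSubst _ hlow, Function.update_self]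
      · have hkm : (k : ℕ) < m := by
          have : (k : ℕ) ≠ m := fun h => hki (Fin.ext h)
          omega
        obtain ⟨h1, h2⟩ := hΘ2 k hkm
        have hdk : diagCoeff σ k.castSucc = 1 := by
          rw [hσ, diagCoeff_triangularSubst _ hlow, Function.update_of_ne hki]; rfl
        refine ⟨by rw [hdk, one_mul, h1], ?_⟩
        rw [iterate_pderiv_algHom (a := 1) (by rw [← hdk]; exact hσt.pderiv_self k), h2, one_pow, C_1,
          one_mul, map_mul, hσj k hki, show σ (C _) = C _ from σ.commutes _]
        intro j hj
        induction j using Fin.lastCases with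
        | last => rw [hσl, pderiv_X_of_ne hj]
        | cast j =>
          by_cases hji : j = i
          · subst hji
            exact hσt.pderiv_of_lt (by simpa [Fin.lt_def, hi] using hkm)
          · rw [hσj j hji, pderiv_X_of_ne hj]

/-- Once all powers are completed, the derivatives of order `s_k - 1` show that no monomial contains `x_k` with
exponent `s_k - 1`, so that the polynomial is a normal form. -/
lemma exists_normalization {g : PolyRing n} (hg : IsWeightedHomogeneous (wt n) g (deg n))
    {a : Fin (n + 1) → ℂ}
    (ha : ∀ k, a k ^ sylvester k * coeff (Finsupp.single k.castSucc (sylvester k)) g = 1) :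
    ∃ (p : Fin (n + 1) → PolyRing n) (t : Params n), (∀ k, IsLower k (p k)) ∧
      triangularSubst a p g = normalForm t := by
  obtain ⟨Θ, hΘ, hΘl, -, h⟩ := exists_complete_powers hg ha (n + 1) le_rfl
  refine ⟨fun k => Θ (X k.castSucc) - C (a k) * X k.castSucc, fun i => coeff i.exponent (Θ g),
    fun k => ?_, ?_⟩
  · have := hΘ.isLower k
    rwa [(h k k.2).1] at this
  · have e := IsTriangular.eq_triangularSubst hΘl
    simp only [fun k : Fin (n + 1) => (h k k.2).1] at e
    rw [← e]
    refine eq_normalForm (hΘ.map_homogeneous hg) (fun k => ?_) fun k d hd => ?_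
    · rw [hΘ.coeff_single, (h k k.2).1, ha]
    · have hs := two_le_sylvester k
      have hle : sylvester k - 1 ≤ d k.castSucc := by omega
      have h1 := congrArg (coeff (d - Finsupp.single k.castSucc (sylvester k - 1))) (h k k.2).2
      rw [coeff_iterate_pderiv, sub_add_single hle, coeff_C_mul, coeff_X, if_neg, mul_zero] at h1
      · refine (mul_eq_zero.mp h1).resolve_left ?_
        have : ((d - Finsupp.single k.castSucc (sylvester k - 1) : Fin (n + 2) →₀ ℕ) k.castSucc +
            (sylvester k - 1)).descFactorial (sylvester k - 1) ≠ 0 := by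
          rw [Ne, Nat.descFactorial_eq_zero_iff_lt]
          omega
        exact_mod_cast this
      · intro h2
        have := DFunLike.congr_fun h2 k.castSucc
        rw [Finsupp.single_eq_same, Finsupp.tsub_apply, Finsupp.single_eq_same] at this
        omega

/-- The inverse of a bijective triangular endomorphism. -/
lemma IsTriangular.exists_inverse {Φ : PolyRing n →ₐ[ℂ] PolyRing n} (hΦ : IsTriangular Φ)
    (h : ∀ j, diagCoeff Φ j ≠ 0) :
    ∃ Ψ : PolyRing n →ₐ[ℂ] PolyRing n, IsTriangular Ψ ∧ (∀ g, Ψ (Φ g) = g) ∧ ∀ g, Φ (Ψ g) = g := by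
  have hb := hΦ.bijective h
  let e := AlgEquiv.ofBijective Φ hb
  have h1 : ∀ g, Φ (e.symm g) = g := fun g => e.apply_symm_apply g
  have h2 : ∀ g, e.symm (Φ g) = g := fun g => e.symm_apply_apply g
  refine ⟨e.symm.toAlgHom, ⟨fun j => hΦ.homogeneous_of_map hb.1 ?_, (diagCoeff Φ (Fin.last _))⁻¹, ?_⟩, h2, h1⟩
  · exact (congrArg (fun g => IsWeightedHomogeneous (wt n) g (wt n j)) (h1 (X j))).mpr
      (isWeightedHomogeneous_X ℂ _ _)
  · apply hb.1
    refine (h1 _).trans ?_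
    rw [map_mul, hΦ.apply_last, show Φ (C _) = C _ from Φ.commutes _, ← mul_assoc, ← C_mul,
      inv_mul_cancel₀ (h _), C_1, one_mul]

/-- Two normalizations with the same diagonal differ by a triangular substitution between normal forms with
diagonal entries one, which is the identity by `IsTriangular.eq_diagonal`. -/
lemma normalization_unique {g : PolyRing n} {a : Fin (n + 1) → ℂ} (ha : ∀ k, a k ≠ 0)
    {p p' : Fin (n + 1) → PolyRing n} {t t' : Params n}
    (hp : ∀ k, IsLower k (p k)) (hp' : ∀ k, IsLower k (p' k)) (h : triangularSubst a p g = normalForm t)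
    (h' : triangularSubst a p' g = normalForm t') : p = p' ∧ t = t' := by
  have hΦ := isTriangular_triangularSubst a hp
  have hΨ := isTriangular_triangularSubst a hp'
  have hl : ∀ p : Fin (n + 1) → PolyRing n, diagCoeff (triangularSubst a p) (Fin.last _) = 1 := by
    intro p
    rw [diagCoeff, triangularSubst_X_last, coeff_X, if_pos rfl]
  have hΦ0 : ∀ j, diagCoeff (triangularSubst a p) j ≠ 0 := by
    intro j
    induction j using Fin.lastCases with
    | last => rw [hl]; exact one_ne_zero
    | cast k => rw [diagCoeff_triangularSubst a hp]; exact ha k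
  obtain ⟨Φ', hΦ', h1, h2⟩ := hΦ.exists_inverse hΦ0
  set Θ := (triangularSubst a p').comp Φ' with hΘ_def
  have hΘ : IsTriangular Θ := hΨ.comp hΦ'
  have hΘΦ : ∀ f, Θ (triangularSubst a p f) = triangularSubst a p' f := fun f => by
    rw [hΘ_def, AlgHom.comp_apply, h1]
  have hd : ∀ k : Fin (n + 1), diagCoeff Θ k.castSucc = 1 := by
    intro k
    have h3 := hΘ.diagCoeff_comp (Φ := triangularSubst a p) k
    rw [show Θ.comp (triangularSubst a p) = triangularSubst a p' from AlgHom.ext hΘΦ,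
      diagCoeff_triangularSubst a hp, diagCoeff_triangularSubst a hp'] at h3
    exact mul_right_cancel₀ (ha k) (by rw [← h3, one_mul])
  have hΘF : Θ (normalForm t) = C 1 * normalForm t' := by rw [← h, hΘΦ, h', C_1, one_mul]
  have hid : Θ = AlgHom.id ℂ _ := by
    apply MvPolynomial.algHom_ext
    intro j
    induction j using Fin.lastCases with
    | last =>
      have := hΘΦ (X (Fin.last _))
      rwa [triangularSubst_X_last, triangularSubst_X_last] at this
    | cast k =>
      rw [hΘ.eq_diagonal (fun k => by rw [hd]; exact one_ne_zero) hΘF k, hd, C_1, one_mul, AlgHom.id_apply]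
  constructor
  · funext k
    have := hΘΦ (X k.castSucc)
    rw [hid, AlgHom.id_apply, triangularSubst_X_castSucc, triangularSubst_X_castSucc] at this
    exact add_left_cancel this
  · apply normalForm_injective
    rw [hid, AlgHom.id_apply, C_1, one_mul] at hΘF
    exact hΘF

theorem existsUnique_normalization {g : PolyRing n} (hg : IsWeightedHomogeneous (wt n) g (deg n))
    {a : Fin (n + 1) → ℂ}
    (ha : ∀ k, a k ^ sylvester k * coeff (Finsupp.single k.castSucc (sylvester k)) g = 1) :
    ∃! pt : (Fin (n + 1) → PolyRing n) × Params n,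
      (∀ k : Fin (n + 1), IsWeightedHomogeneous (wt n) (pt.1 k) (degVar n k) ∧
        ∀ j ∈ (pt.1 k).vars, k.castSucc < j) ∧
      triangularSubst a pt.1 g = normalForm pt.2 := by
  obtain ⟨p, t, hp, h⟩ := exists_normalization hg ha
  have ha0 : ∀ k, a k ≠ 0 := fun k h0 => by
    have := ha k
    rw [h0, zero_pow (by have := two_le_sylvester k; omega), zero_mul] at this
    exact zero_ne_one this
  refine ⟨(p, t), ⟨fun k => ⟨(hp k).homogeneous, (hp k).vars⟩, h⟩, ?_⟩
  rintro ⟨p', t'⟩ ⟨hp', h'⟩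
  obtain ⟨rfl, rfl⟩ := normalization_unique ha0 (fun k => ⟨(hp' k).1, (hp' k).2⟩) hp h' h
  rfl

end Normalization

end

/-! ### The coordinate ring -/

section

open MvPolynomial

section Primality

/-- A polynomial `x_0 ^ 2 + h(x_1, x_2, …)` is prime if `h` restricts to a cube on some coordinate axis: then `-h`
is not a square. -/
lemma prime_of_square_add {N : ℕ} {f : MvPolynomial (Fin (N + 1)) ℂ}
    (hf : f - X 0 ^ 2 ∈ supported ℂ (Set.range (Fin.succ : Fin N → Fin (N + 1)))) {j : Fin N}
    (hj : aeval (Pi.single j.succ (Polynomial.X : Polynomial ℂ)) f = (Polynomial.X : Polynomial ℂ) ^ 3) :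
    Prime f := by
  obtain ⟨h, hh⟩ : ∃ h, rename Fin.succ h = f - X 0 ^ 2 := by
    have : supported ℂ (Set.range (Fin.succ : Fin N → Fin (N + 1))) ≤
        (rename Fin.succ : MvPolynomial (Fin N) ℂ →ₐ[ℂ] _).range := by
      rw [supported_eq_adjoin_X, Algebra.adjoin_le_iff]
      rintro _ ⟨_, ⟨i, rfl⟩, rfl⟩
      exact ⟨X i, rename_X _ _⟩
    exact this hf
  have hfe : f = X 0 ^ 2 + rename Fin.succ h := by rw [hh]; ring
  have h1 : finSuccEquiv ℂ N f = Polynomial.X ^ 2 + Polynomial.C h := by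
    have h2 : ∀ g, finSuccEquiv ℂ N (rename Fin.succ g) = Polynomial.C g := by
      intro g
      induction g using MvPolynomial.induction_on with
      | C c => rw [rename_C]; exact (finSuccEquiv ℂ N).commutes c
      | add p q hp hq => rw [map_add, map_add, hp, hq, Polynomial.C_add]
      | mul_X p i hp => rw [map_mul, map_mul, hp, rename_X, finSuccEquiv_X_succ, Polynomial.C_mul]
    rw [hfe, map_add, map_pow, finSuccEquiv_X_zero, h2]
  have hmon : (Polynomial.X ^ 2 + Polynomial.C h).Monic := Polynomial.monic_X_pow_add_C h two_ne_zero
  have hdeg : (Polynomial.X ^ 2 + Polynomial.C h).natDegree = 2 := Polynomial.natDegree_X_pow_add_C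
  rw [← MulEquiv.prime_iff (finSuccEquiv ℂ N), h1, ← irreducible_iff_prime,
    hmon.irreducible_iff_roots_eq_zero_of_degree_le_three hdeg.ge (hdeg.le.trans (by norm_num)),
    Multiset.eq_zero_iff_forall_notMem]
  -- a root `r` of `X ^ 2 + h` would restrict to a polynomial in one variable with square `-X ^ 3`
  intro r hr
  have hr' := (Polynomial.mem_roots'.mp hr).2
  rw [Polynomial.IsRoot, Polynomial.eval_add, Polynomial.eval_pow, Polynomial.eval_X, Polynomial.eval_C] at hr'
  let ev : MvPolynomial (Fin N) ℂ →ₐ[ℂ] Polynomial ℂ := aeval (Pi.single j Polynomial.X)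
  have h3 : ev h = Polynomial.X ^ 3 := by
    rw [← hj, hfe, map_add, map_pow, aeval_X, Pi.single_eq_of_ne (Fin.succ_ne_zero j).symm, aeval_rename]
    rw [zero_pow two_ne_zero, zero_add]
    refine congrFun (congrArg DFunLike.coe (congrArg (aeval (R := ℂ)) ?_)) h
    funext i
    by_cases hi : i = j
    · subst hi; simp
    · rw [Function.comp_apply, Pi.single_eq_of_ne hi, Pi.single_eq_of_ne (by simpa using hi)]
  have h4 : ev r ^ 2 = -(Polynomial.X : Polynomial ℂ) ^ 3 := by
    have := congrArg ev hr'
    rw [map_add, map_pow, h3, map_zero] at this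
    exact eq_neg_of_add_eq_zero_left this
  have h5 := congrArg Polynomial.natDegree h4
  -- now `2 * deg (ev r) = 3`
  rw [Polynomial.natDegree_pow, Polynomial.natDegree_neg, Polynomial.natDegree_X_pow] at h5
  omega

variable {m : ℕ}

/-- The restriction to the hyperplane `x_{n+1} = 0`. -/
def atInfinity (n : ℕ) : PolyRing n →ₐ[ℂ] MvPolynomial (Fin (n + 1)) ℂ :=
  aeval (Fin.snoc (α := fun _ => MvPolynomial (Fin (n + 1)) ℂ) X 0)

@[simp] lemma atInfinity_X_castSucc {n : ℕ} (k : Fin (n + 1)) : atInfinity n (X k.castSucc) = X k := by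
  simp [atInfinity]

@[simp] lemma atInfinity_X_last {n : ℕ} : atInfinity n (X (Fin.last _)) = 0 := by
  simp [atInfinity]

lemma atInfinity_surjective (n : ℕ) : Function.Surjective (atInfinity n) := fun g =>
  ⟨rename Fin.castSucc g, by
    rw [atInfinity, aeval_rename]
    convert aeval_X_left_apply g using 2
    exact congrArg _ (funext fun k => Fin.snoc_castSucc ..)⟩

lemma X_last_dvd_of_atInfinity_eq_zero {n : ℕ} {g : PolyRing n} (h : atInfinity n g = 0) :
    X (Fin.last _) ∣ g := by
  have key : ∀ g : PolyRing n, X (Fin.last _) ∣ g - rename Fin.castSucc (atInfinity n g) := by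
    intro g
    induction g using MvPolynomial.induction_on with
    | C c => simp [← algebraMap_eq]
    | add p q hp hq =>
      have := dvd_add hp hq
      rwa [← add_sub_add_comm, ← map_add, ← map_add] at this
    | mul_X p j hp =>
      induction j using Fin.lastCases with
      | last => simp
      | cast k =>
        rw [map_mul, map_mul, atInfinity_X_castSucc, rename_X, ← sub_mul]
        exact hp.mul_right _
  have := key g
  rwa [h, map_zero, sub_zero] at this

lemma Idx.weight_pos {n : ℕ} (i : Idx n) : 0 < i.weight := Nat.sub_pos_of_lt i.2

lemma atInfinity_normalForm {n : ℕ} (t : Params n) :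
    atInfinity n (normalForm t) = ∑ k : Fin (n + 1), X k ^ sylvester k := by
  rw [normalForm, map_add, map_sum, map_sum, Finset.sum_eq_zero (s := Finset.univ (α := Idx n)), add_zero]
  · simp only [map_pow, atInfinity_X_castSucc]
  · intro i _
    rw [map_mul, map_pow, atInfinity_X_last, zero_pow i.weight_pos.ne', mul_zero]

lemma aeval_fermat (m : ℕ) :
    aeval (Pi.single (Fin.succ 0) (Polynomial.X : Polynomial ℂ))
      (∑ k : Fin (m + 2), (X k : MvPolynomial (Fin (m + 2)) ℂ) ^ sylvester k) = (Polynomial.X : Polynomial ℂ) ^ 3 := by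
  rw [map_sum, Finset.sum_eq_single (Fin.succ 0)]
  · rw [map_pow, aeval_X, Pi.single_eq_same]
    congr 1
    simp [sylvester_one]
  · intro k _ hk
    rw [map_pow, aeval_X, Pi.single_eq_of_ne hk, zero_pow]
    have := two_le_sylvester k
    omega
  · simp

/-- The polynomial `∑ x_k ^ s_k`, which defines `D_t` in the hyperplane at infinity. -/
lemma prime_fermat (m : ℕ) : Prime (∑ k : Fin (m + 2), (X k : MvPolynomial (Fin (m + 2)) ℂ) ^ sylvester k) := by
  refine prime_of_square_add ?_ (aeval_fermat m)
  rw [Fin.sum_univ_succ, Fin.val_zero, sylvester_zero, add_sub_cancel_left]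
  exact Subalgebra.sum_mem _ fun k _ => Subalgebra.pow_mem _ (X_mem_supported.mpr (Set.mem_range_self k)) _

lemma prime_normalForm (t : Params (m + 1)) : Prime (normalForm t) := by
  refine prime_of_square_add (j := 0) ?_ ?_
  · have h0 : ∀ k : Fin (m + 1), (X k.succ.castSucc : PolyRing (m + 1)) ∈
        supported ℂ (Set.range (Fin.succ : Fin (m + 2) → Fin (m + 3))) := fun k =>
      X_mem_supported.mpr ⟨k.castSucc, Fin.succ_castSucc k⟩
    have hX : (X (Fin.castSucc 0) : PolyRing (m + 1)) = X 0 := rfl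
    rw [normalForm, Fin.sum_univ_succ, Fin.val_zero, sylvester_zero, hX, add_assoc (X 0 ^ 2), add_sub_cancel_left]
    refine Subalgebra.add_mem _ (Subalgebra.sum_mem _ fun k _ => Subalgebra.pow_mem _ (h0 k) _)
      (Subalgebra.sum_mem _ fun i _ => Subalgebra.mul_mem _ (Subalgebra.mul_mem _ ?_ ?_)
        (Subalgebra.pow_mem _ (X_mem_supported.mpr (Set.mem_range_self (Fin.last (m + 1)))) _))
    · rw [← algebraMap_eq]; exact Subalgebra.algebraMap_mem _ _
    · refine Subalgebra.prod_mem _ fun k _ => ?_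
      induction k using Fin.cases with
      | zero =>
        have h1 := i.exponent_lt 0
        have h2 : sylvester (0 : Fin (m + 1 + 1)) = 2 := sylvester_zero
        rw [Idx.exponent_castSucc] at h1
        have h3 : (i.1 0 : ℕ) = 0 := by omega
        rw [h3, pow_zero]
        exact Subalgebra.one_mem _
      | succ k => exact Subalgebra.pow_mem _ (h0 k) _
  · rw [← aeval_fermat m, ← atInfinity_normalForm t]
    have : (aeval (Pi.single (Fin.succ 0) (Polynomial.X : Polynomial ℂ)) : PolyRing (m + 1) →ₐ[ℂ] _) =
        (aeval (Pi.single (Fin.succ 0) (Polynomial.X : Polynomial ℂ))).comp (atInfinity (m + 1)) := by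
      apply MvPolynomial.algHom_ext
      intro j
      induction j using Fin.lastCases with
      | last =>
        rw [AlgHom.comp_apply, atInfinity_X_last, map_zero, aeval_X, Pi.single_eq_of_ne]
        simp [Fin.ext_iff]
      | cast k =>
        rw [AlgHom.comp_apply, atInfinity_X_castSucc, aeval_X, aeval_X]
        simp [Pi.single_apply, Fin.ext_iff]
    exact congr($this (normalForm t))

end Primality

section CoordinateRing

variable {m n : ℕ}

/-- The class of the variable `x_j` in `ℂ[x_0, …, x_{n+1}] / (F_t)`. -/
def coordVar (t : Params n) (j : Fin (n + 2)) : CoordRing t := coordMk t (X j)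

lemma coordMk_mem (t : Params n) {g : PolyRing n} {i : ℕ} (hg : IsWeightedHomogeneous (wt n) g i) :
    coordMk t g ∈ coordPiece t i := ⟨g, hg, rfl⟩

lemma coordVar_mem (t : Params n) (j : Fin (n + 2)) : coordVar t j ∈ coordPiece t (wt n j) :=
  coordMk_mem t (isWeightedHomogeneous_X ℂ _ _)

lemma coordMk_eq_zero_iff (t : Params n) (g : PolyRing n) : coordMk t g = 0 ↔ normalForm t ∣ g := by
  rw [← Ideal.mem_span_singleton]
  exact Ideal.Quotient.eq_zero_iff_mem

instance (t : Params (m + 1)) : IsDomain (CoordRing t) :=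
  (Ideal.Quotient.isDomain_iff_prime _).mpr
    ((Ideal.span_singleton_prime (normalForm_ne_zero t)).mpr (prime_normalForm t))

/-- Evaluation at the point `(w, 1, …, 1, 0)` of `D_t`, where `w ^ 2 = -(m + 1)`: neither `x_0` nor `x_1 ⋯ x_n` vanishes
there, so neither is divisible by `x_{n+1}`. -/
lemma exists_eval (t : Params (m + 1)) : ∃ ε : CoordRing t →+* ℂ, ε (coordVar t (Fin.last _)) = 0 ∧
    ε (coordVar t (Fin.castSucc 0)) ≠ 0 ∧ ∀ k : Fin (m + 1), ε (coordVar t k.succ.castSucc) = 1 := by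
  obtain ⟨w, hw⟩ := IsAlgClosed.exists_pow_nat_eq (-((m : ℂ) + 1)) (n := 2) two_pos
  have hw0 : w ≠ 0 := by
    rintro rfl
    rw [zero_pow two_ne_zero, eq_comm, neg_eq_zero] at hw
    exact Nat.cast_add_one_ne_zero m hw
  let v : Fin (m + 2) → ℂ := Fin.cons w 1
  let ev : PolyRing (m + 1) →ₐ[ℂ] ℂ := (aeval v).comp (atInfinity (m + 1))
  have h0 : ∀ a ∈ Ideal.span {normalForm t}, (ev : PolyRing (m + 1) →+* ℂ) a = 0 := by
    intro a ha
    obtain ⟨b, rfl⟩ := Ideal.mem_span_singleton.mp ha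
    rw [RingHom.coe_coe, map_mul, AlgHom.comp_apply, atInfinity_normalForm, map_sum, Fin.sum_univ_succ]
    simp only [map_pow, aeval_X, v, Fin.cons_zero, Fin.cons_succ, Fin.val_zero, sylvester_zero, hw]
    simp
  refine ⟨Ideal.Quotient.lift _ (ev : PolyRing (m + 1) →+* ℂ) h0, ?_, ?_, fun k => ?_⟩
  · refine (Ideal.Quotient.lift_mk _ _ h0).trans ?_
    simp [ev]
  · rw [show Ideal.Quotient.lift _ (ev : PolyRing (m + 1) →+* ℂ) h0 (coordVar t (Fin.castSucc 0)) = w from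
      (Ideal.Quotient.lift_mk _ _ h0).trans (by
        rw [RingHom.coe_coe, AlgHom.comp_apply, atInfinity_X_castSucc, aeval_X]; rfl)]
    exact hw0
  · refine (Ideal.Quotient.lift_mk _ _ h0).trans ?_
    rw [RingHom.coe_coe, AlgHom.comp_apply, atInfinity_X_castSucc, aeval_X]
    rfl

/-- The variable `x_0`, whose weight exceeds the one of `x_1 ⋯ x_n` by one. -/
lemma coordVar_zero_mem (t : Params (m + 1)) : coordVar t (Fin.castSucc 0) ∈
    coordPiece t (1 + ∑ k : Fin (m + 1), wt (m + 1) k.succ.castSucc) := by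
  have h1 := sum_degVar (m + 1)
  have h2 := sylvester_mul_degVar (m + 1) 0
  rw [Fin.val_zero, sylvester_zero] at h2
  rw [Finset.sum_range, Fin.sum_univ_succ, Fin.val_zero] at h1
  have h3 : wt (m + 1) (Fin.castSucc 0) = 1 + ∑ k : Fin (m + 1), wt (m + 1) k.succ.castSucc := by
    simp only [wt_castSucc, Fin.val_zero]
    omega
  rw [← h3]
  exact coordVar_mem t _

lemma prod_coordVar_mem (t : Params (m + 1)) : ∏ k : Fin (m + 1), coordVar t k.succ.castSucc ∈
    coordPiece t (∑ k : Fin (m + 1), wt (m + 1) k.succ.castSucc) :=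
  SetLike.prod_mem_graded _ _ _ fun _ _ => coordVar_mem t _

lemma not_dvd_coordVar_zero (t : Params (m + 1)) : ¬ coordVar t (Fin.last _) ∣ coordVar t (Fin.castSucc 0) := by
  obtain ⟨ε, h1, h2, -⟩ := exists_eval t
  intro h
  have := map_dvd ε h
  rw [h1, zero_dvd_iff] at this
  exact h2 this

lemma not_dvd_prod_coordVar (t : Params (m + 1)) :
    ¬ coordVar t (Fin.last _) ∣ ∏ k : Fin (m + 1), coordVar t k.succ.castSucc := by
  obtain ⟨ε, h1, -, h2⟩ := exists_eval t
  intro h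
  have := map_dvd ε h
  rw [h1, zero_dvd_iff, map_prod, Finset.prod_congr rfl fun k _ => h2 k, Finset.prod_const_one] at this
  exact one_ne_zero this

lemma coordVar_last_ne_zero (t : Params (m + 1)) : coordVar t (Fin.last _) ≠ 0 := by
  intro h
  rw [coordVar, coordMk_eq_zero_iff] at h
  have h1 := ((prime_normalForm t).associated_of_dvd (X_prime) h).symm.dvd
  have h2 := map_dvd (atInfinity (m + 1)) h1
  rw [atInfinity_X_last, zero_dvd_iff, atInfinity_normalForm] at h2
  exact (prime_fermat m).ne_zero h2

/-- The quotient of the coordinate ring by `x_{n+1}` is the domain `ℂ[x_0, …, x_n] / (∑ x_k ^ s_k)`. -/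
lemma prime_coordVar_last (t : Params (m + 1)) : Prime (coordVar t (Fin.last _)) := by
  refine ⟨coordVar_last_ne_zero t, fun h => ?_, fun a b hab => ?_⟩
  · exact not_dvd_coordVar_zero t h.dvd
  · obtain ⟨a, rfl⟩ := Ideal.Quotient.mk_surjective a
    obtain ⟨b, rfl⟩ := Ideal.Quotient.mk_surjective b
    have key : ∀ g : PolyRing (m + 1), coordVar t (Fin.last _) ∣ coordMk t g ↔
        (∑ k : Fin (m + 2), (X k : MvPolynomial (Fin (m + 2)) ℂ) ^ sylvester k) ∣ atInfinity _ g := by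
      intro g
      rw [← atInfinity_normalForm t]
      constructor
      · rintro ⟨c, hc⟩
        obtain ⟨c, rfl⟩ := Ideal.Quotient.mk_surjective c
        have h1 : coordMk t (g - X (Fin.last _) * c) = 0 := by
          rw [map_sub, hc, map_mul]; exact sub_self _
        rw [coordMk_eq_zero_iff] at h1
        have h2 := map_dvd (atInfinity (m + 1)) h1
        rwa [map_sub, map_mul, atInfinity_X_last, zero_mul, sub_zero] at h2
      · rintro ⟨c, hc⟩
        obtain ⟨c, rfl⟩ := atInfinity_surjective _ c
        obtain ⟨e, he⟩ := X_last_dvd_of_atInfinity_eq_zero (g := g - normalForm t * c)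
          (by rw [map_sub, map_mul, hc, sub_self])
        refine ⟨coordMk t e, ?_⟩
        rw [coordVar, ← map_mul, ← he, map_sub, map_mul, (coordMk_eq_zero_iff t _).mpr dvd_rfl, zero_mul, sub_zero]
    have h1 : coordVar t (Fin.last _) ∣ coordMk t (a * b) := by rw [map_mul]; exact hab
    rw [key, map_mul] at h1
    exact ((prime_fermat m).dvd_or_dvd h1).imp (key a).mpr (key b).mpr

end CoordinateRing

end

/-! ### Functions of degree zero -/

section Constants

variable {A σ : Type} [CommRing A] [SetLike σ A] [AddSubgroupClass σ A] {𝒜 : ℕ → σ} [GradedRing 𝒜]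

lemma ι_comp_toSpecZero {f : A} {m : ℕ} (hf : f ∈ 𝒜 m) (hm : 0 < m) :
    (Proj.basicOpen 𝒜 f).ι ≫ Proj.toSpecZero 𝒜 = Proj.basicOpenToSpec 𝒜 f ≫
      Spec.map (CommRingCat.ofHom (HomogeneousLocalization.fromZeroRingHom 𝒜 _)) := by
  rw [← Proj.awayι_toSpecZero 𝒜 f hf hm, ← Proj.basicOpenIsoSpec_inv_ι, Category.assoc,
    ← Proj.basicOpenIsoSpec_hom 𝒜 f hf hm, Iso.hom_inv_id_assoc]

lemma appTop_ι_toSpecZero {f : A} {m : ℕ} (hf : f ∈ 𝒜 m) (hm : 0 < m) (a : 𝒜 0) :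
    (Proj.basicOpen 𝒜 f).ι.appTop.hom ((Proj.toSpecZero 𝒜).appTop.hom
      ((Scheme.ΓSpecIso (CommRingCat.of (𝒜 0))).inv.hom a)) =
    (Proj.basicOpen 𝒜 f).topIso.inv.hom ((Proj.awayToSection 𝒜 f).hom
      (HomogeneousLocalization.fromZeroRingHom 𝒜 _ a)) := by
  have h := congrArg (fun g => (Scheme.ΓSpecIso (CommRingCat.of (𝒜 0))).inv ≫ g.appTop) (ι_comp_toSpecZero hf hm)
  simp only [Scheme.Hom.comp_appTop] at h
  rw [← Category.assoc _ _ (Proj.basicOpenToSpec 𝒜 f).appTop, ← Scheme.ΓSpecIso_inv_naturality, Category.assoc] at h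
  have h2 : (Proj.basicOpenToSpec 𝒜 f).appTop = _ := Proj.basicOpenToSpec_app_top 𝒜 f
  rw [h2, Iso.inv_hom_id_assoc] at h
  exact congr($(h).hom a)

variable [IsDomain A]

/-- The function on `Proj` given by an element of degree zero has this element as its value. -/
lemma valueAt_toSpecZero {f : A} {m : ℕ} (hf : f ∈ 𝒜 m) (hm : 0 < m) {ξ : Proj 𝒜}
    (hξ : ξ ∈ Proj.basicOpen 𝒜 f) (a : 𝒜 0) :
    valueAt ξ (U := ⊤) trivial ((Proj.toSpecZero 𝒜).appTop.hom
      ((Scheme.ΓSpecIso (CommRingCat.of (𝒜 0))).inv.hom a)) = algebraMap A (FractionRing A) a := by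
  have h := appTop_ι_toSpecZero hf hm a
  have h2 : valueAt ξ (U := (Proj.basicOpen 𝒜 f).ι ''ᵁ ⊤) ⟨⟨ξ, hξ⟩, trivial, rfl⟩ ((Proj.basicOpen 𝒜 f).ι.appTop.hom ((Proj.toSpecZero 𝒜).appTop.hom
      ((Scheme.ΓSpecIso (CommRingCat.of (𝒜 0))).inv.hom a))) = valueAt ξ (U := ⊤) trivial ((Proj.toSpecZero 𝒜).appTop.hom
      ((Scheme.ΓSpecIso (CommRingCat.of (𝒜 0))).inv.hom a)) := rfl
  rw [← h2, h]
  have h3 : valueAt ξ (U := (Proj.basicOpen 𝒜 f).ι ''ᵁ ⊤) ⟨⟨ξ, hξ⟩, trivial, rfl⟩ ((Proj.basicOpen 𝒜 f).topIso.inv.hom ((Proj.awayToSection 𝒜 f).hom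
      (HomogeneousLocalization.fromZeroRingHom 𝒜 _ a))) = valueAt ξ hξ ((Proj.awayToSection 𝒜 f).hom
      (HomogeneousLocalization.fromZeroRingHom 𝒜 _ a)) := rfl
  rw [h3]
  have h4 : valueAt ξ hξ ((Proj.awayToSection 𝒜 f).hom
      (HomogeneousLocalization.fromZeroRingHom 𝒜 _ a)) = localToFrac ξ (.mk ⟨0, a, 1, (idealAt ξ).primeCompl.one_mem⟩) := rfl
  rw [h4, localToFrac_mk]
  simp

end Constants

/-! ### Comparison of the section ring with the coordinate ring -/

section

open MvPolynomial

section Comparison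

lemma poleOrderLE_coeff {X : Scheme.{0}} {D : Closeds X} (s : sectionRing D) (i : ℕ) :
    PoleOrderLE D i (s.1.coeff i) := s.2 i

lemma exists_section {X : Scheme.{0}} {D : Closeds X} {i : ℕ} {s : PuncturedSections D ⊤} (hs : PoleOrderLE D i s) :
    ∃ S : sectionRing D, S.1 = Polynomial.monomial i s := by
  refine ⟨⟨Polynomial.monomial i s, fun k => ?_⟩, rfl⟩
  rw [Polynomial.coeff_monomial]
  split_ifs with h
  · subst h; exact hs
  · exact Submodule.zero_mem _

lemma coe_sectionConst (X : ComplexScheme) (D : Closeds X.left) (c : ℂ) :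
    (sectionConst X D c).1 = Polynomial.C (restrictOff D ⊤ (globalConst X c)) := rfl

/-- Two rings embedded into a third one with the same image are isomorphic. -/
lemma exists_ringEquiv_of_range_eq {R S T : Type} [CommRing R] [CommRing S] [CommRing T] {f : R →+* T}
    {g : S →+* T} (hf : Function.Injective f) (hg : Function.Injective g) (h : f.range = g.range) :
    ∃ e : R ≃+* S, ∀ a, g (e a) = f a := by
  have h1 : ∀ a, ∃ b, g b = f a := fun a => by
    have : f a ∈ g.range := h ▸ ⟨a, rfl⟩
    exact this
  choose e he using h1
  let e' : R →+* S :=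
    { toFun := e
      map_one' := hg (by rw [he, map_one, map_one])
      map_zero' := hg (by rw [he, map_zero, map_zero])
      map_add' := fun a b => hg (by rw [he, map_add, map_add, he, he])
      map_mul' := fun a b => hg (by rw [he, map_mul, map_mul, he, he]) }
  refine ⟨RingEquiv.ofBijective e' ⟨fun a b hab => hf ?_, fun b => ?_⟩, he⟩
  · rw [← he, ← he]; exact congrArg g hab
  · have : g b ∈ f.range := h ▸ ⟨b, rfl⟩
    obtain ⟨a, ha⟩ := this
    exact ⟨a, hg ((he a).trans ha)⟩

variable {n : ℕ} {t : Params n} {K : Type} [Field K] {Y : ComplexScheme} {D : Closeds Y.left}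
  {v : PuncturedSections D ⊤ →+* K} {φ : CoordRing t →+* K}

/-- The comparison map `∑ s_i T ^ i ↦ ∑ v(s_i) T ^ i`, for a ring homomorphism `v` to a field. -/
def sectionValue (v : PuncturedSections D ⊤ →+* K) : sectionRing D →+* Polynomial K :=
  (Polynomial.mapRingHom v).comp (sectionRing D).subtype

lemma sectionValue_eq (s : sectionRing D) : sectionValue v s = Polynomial.map v s.1 := rfl

lemma coeff_sectionValue (s : sectionRing D) (i : ℕ) : (sectionValue v s).coeff i = v (s.1.coeff i) :=
  Polynomial.coeff_map _ _

lemma sectionValue_injective (hv : Function.Injective v) : Function.Injective (sectionValue v) :=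
  fun _ _ h => Subtype.ext (Polynomial.map_injective _ hv h)

/-- The map `x_j ↦ (x_j / x_{n+1} ^ {w_j}) T ^ {w_j}`, where `w_j` is the weight of `x_j`. -/
def polyValue (φ : CoordRing t →+* K) : PolyRing n →+* Polynomial K :=
  eval₂Hom (Polynomial.C.comp (φ.comp (algebraMap ℂ (CoordRing t)))) fun j =>
    Polynomial.C (φ (coordVar t j) / φ (coordVar t (Fin.last _)) ^ wt n j) * Polynomial.X ^ wt n j

lemma polyValue_C (c : ℂ) : polyValue φ (C c) = Polynomial.C (φ (algebraMap ℂ (CoordRing t) c)) := by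
  rw [polyValue, coe_eval₂Hom, eval₂_C]
  rfl

lemma polyValue_X (j : Fin (n + 2)) : polyValue φ (X j) =
    Polynomial.C (φ (coordVar t j) / φ (coordVar t (Fin.last _)) ^ wt n j) * Polynomial.X ^ wt n j := by
  rw [polyValue, coe_eval₂Hom, eval₂_X]

lemma polyValue_of_homogeneous {g : PolyRing n} {i : ℕ} (hg : IsWeightedHomogeneous (wt n) g i) :
    polyValue φ g =
      Polynomial.C (φ (coordMk t g) / φ (coordVar t (Fin.last _)) ^ i) * Polynomial.X ^ i := by
  have key : ∀ (d : Fin (n + 2) →₀ ℕ) (c : ℂ), polyValue φ (monomial d c) =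
      Polynomial.C (φ (coordMk t (monomial d c)) / φ (coordVar t (Fin.last _)) ^ Finsupp.weight (wt n) d) *
        Polynomial.X ^ Finsupp.weight (wt n) d := by
    intro d c
    induction d using Finsupp.induction generalizing c with
    | zero =>
      rw [show (monomial 0 c : PolyRing n) = C c from rfl, polyValue_C, map_zero, pow_zero, pow_zero,
        mul_one, div_one]
      rfl
    | single_add j k d hj hk ih =>
      have h1 : (monomial (Finsupp.single j k + d) c : PolyRing n) = X j ^ k * monomial d c := by
        rw [X_pow_eq_monomial, monomial_mul, one_mul]
      rw [h1, map_mul, map_pow, ih, map_add, weight_single, polyValue_X, map_mul, map_mul, map_pow, map_pow,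
        pow_add, pow_add, mul_pow, ← pow_mul, mul_comm (wt n j) k, mul_mul_mul_comm, ← map_pow, ← map_mul,
        div_pow, ← pow_mul, mul_comm (wt n j) k, div_mul_div_comm]
      rfl
  rw [g.as_sum, map_sum, map_sum, map_sum, Finset.sum_div, map_sum, Finset.sum_mul]
  refine Finset.sum_congr rfl fun d hd => ?_
  rw [key, hg (mem_support_iff.mp hd)]

lemma coeff_polyValue (g : PolyRing n) (i : ℕ) : (polyValue φ g).coeff i =
    φ (coordMk t (weightedHomogeneousComponent (wt n) i g)) / φ (coordVar t (Fin.last _)) ^ i := by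
  classical
  induction g using MvPolynomial.induction_on' with
  | add p q hp hq => rw [map_add, Polynomial.coeff_add, hp, hq, map_add, map_add, map_add, add_div]
  | monomial d c =>
    have hd := isWeightedHomogeneous_monomial (wt n) d c rfl
    rw [polyValue_of_homogeneous hd, Polynomial.coeff_C_mul, Polynomial.coeff_X_pow]
    by_cases h : i = Finsupp.weight (wt n) d
    · rw [if_pos h, mul_one, h, weightedHomogeneousComponent_eq_self hd]
    · rw [if_neg h, mul_zero, hd.weightedHomogeneousComponent_ne _ h, map_zero, map_zero, zero_div]

lemma eq_sum_components (g : PolyRing n) :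
    ∃ S : Finset ℕ, g = ∑ i ∈ S, weightedHomogeneousComponent (wt n) i g ∧
      ∀ i ∉ S, weightedHomogeneousComponent (wt n) i g = 0 := by
  refine ⟨(weightedHomogeneousComponent_finsupp (w := wt n) g).toFinset, ?_, fun i hi => ?_⟩
  · rw [← finsum_eq_sum, sum_weightedHomogeneousComponent]
  · by_contra h
    exact hi ((Set.Finite.mem_toFinset _).mpr h)

lemma polyValue_eq_zero_iff (hφ : Function.Injective φ) (hz : φ (coordVar t (Fin.last _)) ≠ 0) (g : PolyRing n) :
    polyValue φ g = 0 ↔ coordMk t g = 0 := by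
  constructor
  · intro h
    obtain ⟨S, hS, -⟩ := eq_sum_components g
    rw [hS, map_sum]
    refine Finset.sum_eq_zero fun i _ => ?_
    have h2 := coeff_polyValue (φ := φ) g i
    rw [h, Polynomial.coeff_zero, eq_comm, div_eq_zero_iff] at h2
    exact (map_eq_zero_iff φ hφ).mp (h2.resolve_right (pow_ne_zero _ hz))
  · intro h
    obtain ⟨k, rfl⟩ := (coordMk_eq_zero_iff t g).mp h
    rw [map_mul, polyValue_of_homogeneous (normalForm_isWeightedHomogeneous t),
      (coordMk_eq_zero_iff t _).mpr dvd_rfl, map_zero, zero_div, map_zero, zero_mul, zero_mul]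

/-- The comparison of the section ring and the coordinate ring, inside a ring of polynomials over a field
which contains the regular functions on the complement of the divisor and the coordinate ring. -/
theorem exists_sectionRing_equiv_of_values (hv : Function.Injective v) (hφ : Function.Injective φ)
    (hz : φ (coordVar t (Fin.last _)) ≠ 0)
    (hpole : ∀ (i : ℕ) (s : PuncturedSections D ⊤), PoleOrderLE D i s ↔ ∃ a ∈ coordPiece t i,
      v s * φ (coordVar t (Fin.last _)) ^ i = φ a)
    (hvar : ∀ (i : ℕ), ∀ a ∈ coordPiece t i, ∃ s, v s * φ (coordVar t (Fin.last _)) ^ i = φ a)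
    (hconst : ∀ c, v (restrictOff D ⊤ (globalConst Y c)) = φ (algebraMap ℂ (CoordRing t) c)) :
    ∃ e : CoordRing t ≃+* sectionRing D,
      (∀ c : ℂ, e (algebraMap ℂ (CoordRing t) c) = sectionConst Y D c) ∧
      (∀ (i : ℕ) (a : CoordRing t), a ∈ coordPiece t i ↔ e a ∈ sectionPiece D i) ∧
      (e (coordVar t (Fin.last _))).1 = Polynomial.X := by
  let θ : CoordRing t →+* Polynomial K := Ideal.Quotient.lift _ (polyValue φ) fun g hg =>
    (polyValue_eq_zero_iff hφ hz g).mpr (Ideal.Quotient.eq_zero_iff_mem.mpr hg)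
  have hθ : ∀ g, θ (coordMk t g) = polyValue φ g := fun g => Ideal.Quotient.lift_mk _ _ _
  have hsurj : Function.Surjective (coordMk t) := Ideal.Quotient.mk_surjective
  have hθi : Function.Injective θ := by
    rw [injective_iff_map_eq_zero]
    intro a ha
    obtain ⟨g, rfl⟩ := hsurj a
    exact (polyValue_eq_zero_iff hφ hz g).mp ((hθ g).symm.trans ha)
  have hC : ∀ c, sectionValue v (sectionConst Y D c) = polyValue φ (C c) := fun c => by
    rw [sectionValue_eq, coe_sectionConst, Polynomial.map_C, hconst, polyValue_C]
  have hrange : θ.range = (sectionValue v).range := by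
    apply le_antisymm
    · rintro _ ⟨a, rfl⟩
      obtain ⟨g, rfl⟩ := hsurj a
      rw [hθ g]
      induction g using MvPolynomial.induction_on with
      | C c => exact ⟨_, hC c⟩
      | add p q hp hq => rw [map_add]; exact Subring.add_mem _ hp hq
      | mul_X p j hp =>
        rw [map_mul]
        refine Subring.mul_mem _ hp ?_
        obtain ⟨s, hs⟩ := hvar _ _ (coordVar_mem t j)
        obtain ⟨S, hS⟩ := exists_section ((hpole _ s).mpr ⟨_, coordVar_mem t j, hs⟩)
        refine ⟨S, ?_⟩
        rw [sectionValue_eq, hS, Polynomial.map_monomial, polyValue_X, Polynomial.C_mul_X_pow_eq_monomial, ← hs,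
          mul_div_cancel_right₀ _ (pow_ne_zero _ hz)]
    · rintro _ ⟨s, rfl⟩
      rw [Polynomial.as_sum_support_C_mul_X_pow (sectionValue v s)]
      refine Subring.sum_mem _ fun i _ => ?_
      obtain ⟨a, ⟨g, hg, hga⟩, h⟩ := (hpole i (s.1.coeff i)).mp (poleOrderLE_coeff s i)
      refine ⟨coordMk t g, ?_⟩
      rw [hθ, polyValue_of_homogeneous hg, coeff_sectionValue, show coordMk t g = a from hga, ← h,
        mul_div_cancel_right₀ _ (pow_ne_zero _ hz)]
  obtain ⟨e, he⟩ := exists_ringEquiv_of_range_eq hθi (sectionValue_injective hv) hrange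
  refine ⟨e, fun c => ?_, fun i a => ?_, ?_⟩
  · apply sectionValue_injective hv
    rw [he, hC, ← hθ]
    rfl
  · have h1 : e a ∈ sectionPiece D i ↔ ∀ k, k ≠ i → (θ a).coeff k = 0 := by
      refine forall₂_congr fun k _ => ?_
      rw [← he, coeff_sectionValue, map_eq_zero_iff _ hv]
    rw [h1]
    constructor
    · rintro ⟨g, hg, hga⟩ k hk
      rw [← show coordMk t g = a from hga, hθ, coeff_polyValue,
        IsWeightedHomogeneous.weightedHomogeneousComponent_ne _ hg hk, map_zero, map_zero, zero_div]
    · intro h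
      obtain ⟨g, rfl⟩ := hsurj a
      have h2 : ∀ k, k ≠ i → coordMk t (weightedHomogeneousComponent (wt n) k g) = 0 := by
        intro k hk
        have h3 := h k hk
        rw [hθ, coeff_polyValue, div_eq_zero_iff] at h3
        exact (map_eq_zero_iff φ hφ).mp (h3.resolve_right (pow_ne_zero _ hz))
      obtain ⟨S, hS, hS0⟩ := eq_sum_components g
      have h3 : coordMk t g = coordMk t (weightedHomogeneousComponent (wt n) i g) := by
        conv_lhs => rw [hS, map_sum]
        exact Finset.sum_eq_single i (fun k _ hk => h2 k hk) fun hi => by rw [hS0 i hi, map_zero]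
      rw [h3]
      exact coordMk_mem t (weightedHomogeneousComponent_isWeightedHomogeneous i g)
  · apply Polynomial.map_injective _ hv
    have h1 := he (coordVar t (Fin.last _))
    rw [sectionValue_eq] at h1
    rw [h1, coordVar, hθ, polyValue_X, wt_last, pow_one, pow_one, div_self hz, map_one, one_mul, Polynomial.map_X]

end Comparison

end

/-! ### The section ring of `(X_t, D_t)` -/

section

open MvPolynomial

section SectionRing

variable {m : ℕ}

/-- The generic point of `X_t`. -/
def genericPt (t : Params (m + 1)) : Proj (coordPiece t) :=
  zeroPoint (coordPiece t) (coordVar_last_ne_zero t) (wt_pos (Fin.last _)) (coordVar_mem t _)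

/-- The divisor `D_t`, as a closed set of the homogeneous spectrum. -/
def divisorAtInfinity {n : ℕ} (t : Params n) : Closeds (Proj (coordPiece t)) := infiniteDivisor t

/-- The generic point of `D_t`. -/
def divisorPt (t : Params (m + 1)) : Proj (coordPiece t) :=
  primePoint (coordVar_mem t (Fin.last _)) (prime_coordVar_last t) (wt_pos (Fin.castSucc 0))
    (coordVar_mem t _) (not_dvd_coordVar_zero t)

lemma mem_divisorAtInfinity {n : ℕ} (t : Params n) (x : Proj (coordPiece t)) :
    x ∈ (divisorAtInfinity t : Set (Proj (coordPiece t))) ↔ coordVar t (Fin.last _) ∈ idealAt x :=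
  not_not

lemma coordVar_last_mem {n : ℕ} (t : Params n) : coordVar t (Fin.last _) ∈ coordPiece t 1 := by
  have := coordVar_mem t (Fin.last _)
  rwa [wt_last] at this

variable (t : Params (m + 1))

lemma genericPt_mem (V : (Proj (coordPiece t)).Opens) (x : Proj (coordPiece t)) (hx : x ∈ V) :
    genericPt t ∈ V := mem_of_idealAt_le (by rw [genericPt, idealAt_zeroPoint]; exact bot_le) hx

lemma genericPt_notMem : genericPt t ∉ (divisorAtInfinity t : Set (Proj (coordPiece t))) := by
  rw [mem_divisorAtInfinity, genericPt, idealAt_zeroPoint]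
  exact coordVar_last_ne_zero t

lemma idealAt_divisorPt : idealAt (divisorPt t) = Ideal.span {coordVar t (Fin.last _)} := rfl

/-- The field of fractions of the coordinate ring. -/
def CoordField : Type := FractionRing (CoordRing t)

instance : Field (CoordField t) := inferInstanceAs (Field (FractionRing (CoordRing t)))

/-- The coordinate ring in its field of fractions. -/
def toCoordField : CoordRing t →+* CoordField t := algebraMap (CoordRing t) (FractionRing (CoordRing t))

lemma toCoordField_eq_zero_iff (a : CoordRing t) : toCoordField t a = 0 ↔ a = 0 :=
  FaithfulSMul.algebraMap_eq_zero_iff (CoordRing t) (FractionRing (CoordRing t))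

/-- The value at the generic point of a function on `X_t ∖ D_t`. -/
def genericValue : PuncturedSections (divisorAtInfinity t) ⊤ →+* CoordField t :=
  puncturedValue (genericPt t) (divisorAtInfinity t) (U := ⊤) trivial (genericPt_notMem t)

lemma genericValue_injective : Function.Injective (genericValue t) :=
  puncturedValue_injective (U := ⊤) (genericPt_notMem t) (genericPt_mem t) trivial

lemma poleOrderLE_iff (i : ℕ) (s : PuncturedSections (divisorAtInfinity t) ⊤) :
    PoleOrderLE (divisorAtInfinity t) i s ↔ ∃ a ∈ coordPiece t i,
      genericValue t s * toCoordField t (coordVar t (Fin.last _)) ^ i =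
        toCoordField t a := by
  simp only [← map_pow]
  exact poleOrderLE_top_iff (genericPt_mem t) (genericPt_notMem t) (mem_divisorAtInfinity t) (idealAt_divisorPt t)
    (coordVar_last_mem t) (prime_coordVar_last t) (prod_coordVar_mem t) (coordVar_zero_mem t)
    (not_dvd_prod_coordVar t) (not_dvd_coordVar_zero t) i s

lemma genericValue_globalConst (c : ℂ) :
    genericValue t (restrictOff (divisorAtInfinity t) ⊤ (globalConst (hypersurface t) c)) =
      toCoordField t (algebraMap ℂ (CoordRing t) c) := by
  have h1 : globalConst (hypersurface t) c = (Proj.toSpecZero (coordPiece t)).appTop.hom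
      ((Scheme.ΓSpecIso (CommRingCat.of (coordPiece t 0))).inv.hom (algebraMap ℂ (coordPiece t 0) c)) := by
    have h := Scheme.ΓSpecIso_inv_naturality (CommRingCat.ofHom (algebraMap ℂ (coordPiece t 0)))
    have h2 := congr($(h).hom c)
    exact (congrArg (Proj.toSpecZero (coordPiece t)).appTop.hom h2).symm
  have h2 : genericPt t ∈ Proj.basicOpen (coordPiece t) (coordVar t (Fin.last _)) := fun h =>
    genericPt_notMem t ((mem_divisorAtInfinity t _).mpr h)
  refine (puncturedValue_restrictOff (U := ⊤) (genericPt_notMem t) trivial (globalConst (hypersurface t) c)).trans ?_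
  rw [h1]
  exact valueAt_toSpecZero (coordVar_last_mem t) one_pos h2 _


lemma exists_genericValue {i : ℕ} {a : CoordRing t} (ha : a ∈ coordPiece t i) :
    ∃ s, genericValue t s * toCoordField t (coordVar t (Fin.last _)) ^ i = toCoordField t a := by
  have hz : coordVar t (Fin.last _) ^ i ∈ coordPiece t i := by
    have := SetLike.pow_mem_graded i (coordVar_last_mem t)
    rwa [smul_eq_mul, mul_one] at this
  refine ⟨puncturedFraction ⊤ ⟨a, ha⟩ ⟨coordVar t (Fin.last _) ^ i, hz⟩
      fun y _ hy => (mem_divisorAtInfinity t y).mpr (Ideal.IsPrime.mem_of_pow_mem inferInstance _ hy), ?_⟩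
  have h1 : genericValue t (puncturedFraction ⊤ ⟨a, ha⟩ ⟨coordVar t (Fin.last _) ^ i, hz⟩
      fun y _ hy => (mem_divisorAtInfinity t y).mpr (Ideal.IsPrime.mem_of_pow_mem inferInstance _ hy)) =
      toCoordField t a / toCoordField t (coordVar t (Fin.last _) ^ i) :=
    puncturedValue_puncturedFraction (U := ⊤) (genericPt_notMem t) trivial _ _ _
  rw [h1, map_pow]
  refine div_mul_cancel₀ _ (pow_ne_zero _ fun h => ?_)
  exact coordVar_last_ne_zero t ((toCoordField_eq_zero_iff t _).mp h)

/-- The section ring of `(X_t, D_t)` is the coordinate ring. -/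
theorem exists_sectionRing_equiv :
    ∃ e : CoordRing t ≃+* sectionRing (infiniteDivisor t),
      (∀ c : ℂ, e (algebraMap ℂ (CoordRing t) c) = sectionConst (hypersurface t) (infiniteDivisor t) c) ∧
      (∀ (i : ℕ) (a : CoordRing t), a ∈ coordPiece t i ↔ e a ∈ sectionPiece (infiniteDivisor t) i) ∧
      (e (coordVar t (Fin.last _))).1 = Polynomial.X :=
  exists_sectionRing_equiv_of_values (Y := hypersurface t) (D := infiniteDivisor t) (v := genericValue t) (genericValue_injective t)
    ((injective_iff_map_eq_zero _).mpr fun a => (toCoordField_eq_zero_iff t a).mp)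
    (fun h => coordVar_last_ne_zero t ((toCoordField_eq_zero_iff t _).mp h))
    (poleOrderLE_iff t)
    (fun _ _ ha => exists_genericValue t ha) (genericValue_globalConst t)

end SectionRing

end

/-! ### Generators of the section ring -/

section

open MvPolynomial

section Generators

variable {n : ℕ}

/-- In weights up to `d_n` a multiple `F_t h` is `h(0) F_t`, since all variables have positive weight. -/
lemma coeff_normalForm_mul (t : Params n) (h : PolyRing n) {d : Fin (n + 2) →₀ ℕ}
    (hd : Finsupp.weight (wt n) d ≤ deg n) :
    coeff d (normalForm t * h) = coeff d (normalForm t) * coeff 0 h := by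
  classical
  rw [coeff_mul, Finset.sum_eq_single (d, 0)]
  · rintro ⟨a, b⟩ hab hne
    rw [Finset.HasAntidiagonal.mem_antidiagonal] at hab
    by_cases ha : coeff a (normalForm t) = 0
    · rw [ha, zero_mul]
    · exfalso
      have h1 := normalForm_isWeightedHomogeneous t ha
      have h2 : Finsupp.weight (wt n) a + Finsupp.weight (wt n) b = Finsupp.weight (wt n) d := by
        rw [← map_add, hab]
      have h3 := eq_zero_of_weight_eq_zero (n := n) (d := b) (by omega)
      subst h3
      rw [add_zero] at hab
      exact hne (Prod.ext hab rfl)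
  · intro h0
    exact absurd (Finset.HasAntidiagonal.mem_antidiagonal.mpr (add_zero d)) h0

lemma coeff_normalForm_mul_eq_zero (t : Params n) (h : PolyRing n) {d : Fin (n + 2) →₀ ℕ}
    (hd : Finsupp.weight (wt n) d < deg n) : coeff d (normalForm t * h) = 0 := by
  rw [coeff_normalForm_mul t h hd.le, (normalForm_isWeightedHomogeneous t).coeff_eq_zero d hd.ne, zero_mul]

lemma wt_lt_deg (j : Fin (n + 2)) : wt n j < deg n := by
  have h1 := sylvester_mul_degVar n 0
  have h2 := degVar_pos n 0
  rw [Fin.val_zero, sylvester_zero] at h1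
  induction j using Fin.lastCases with
  | last => rw [wt_last]; omega
  | cast k =>
    have h1 := sylvester_mul_degVar n k
    have h2 := degVar_pos n k
    have h3 := two_le_sylvester k
    rw [wt_castSucc, ← h1]
    nlinarith

/-- For `n ≥ 1` the last variable is the only monomial of weight one. -/
lemma eq_single_of_weight_eq_one (hn : 1 ≤ n) {d : Fin (n + 2) →₀ ℕ} (hd : Finsupp.weight (wt n) d = 1) :
    d = Finsupp.single (Fin.last _) 1 := by
  have h0 : ∀ k : Fin (n + 1), d k.castSucc = 0 := by
    intro k
    have h1 := mul_wt_le_weight d k.castSucc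
    have h2 := one_lt_degVar hn (k := k) (by omega)
    rw [hd, wt_castSucc] at h1
    by_contra h
    have : 1 ≤ d k.castSucc := Nat.pos_of_ne_zero h
    nlinarith
  have h1 := weight_eq d
  rw [hd, Finset.sum_eq_zero (fun k _ => by rw [h0 k, zero_mul]), zero_add] at h1
  ext j
  induction j using Fin.lastCases with
  | last => rw [← h1, Finsupp.single_eq_same]
  | cast k => rw [h0 k, Finsupp.single_eq_of_ne (Fin.castSucc_lt_last k).ne]

lemma eq_C_mul_of_homogeneous_one (hn : 1 ≤ n) {g : PolyRing n} (hg : IsWeightedHomogeneous (wt n) g 1) :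
    g = C (coeff (Finsupp.single (Fin.last _) 1) g) * X (Fin.last _) := by
  rw [C_mul_X_eq_monomial]
  exact hg.eq_monomial_of_unique_weight fun d hd => eq_single_of_weight_eq_one hn hd

lemma IsTriangular.coeff_last {Θ : PolyRing n →ₐ[ℂ] PolyRing n} (hn : 1 ≤ n) (hΘ : IsTriangular Θ) (g : PolyRing n) :
    coeff (Finsupp.single (Fin.last _) 1) (Θ g) =
      diagCoeff Θ (Fin.last _) * coeff (Finsupp.single (Fin.last _) 1) g := by
  classical
  have hw : Finsupp.weight (wt n) (Finsupp.single (Fin.last (n + 1)) 1) = 1 := by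
    rw [weight_single, wt_last]
  have h1 : ∀ p : PolyRing n, coeff (Finsupp.single (Fin.last _) 1) p =
      coeff (Finsupp.single (Fin.last _) 1) (weightedHomogeneousComponent (wt n) 1 p) := fun p => by
    rw [coeff_weightedHomogeneousComponent, if_pos hw]
  rw [h1 (Θ g), ← hΘ.map_component,
    eq_C_mul_of_homogeneous_one hn (weightedHomogeneousComponent_isWeightedHomogeneous 1 g), ← h1, map_mul,
    show Θ (C _) = C _ from Θ.commutes _, hΘ.apply_last, coeff_C_mul, coeff_C_mul, coeff_X, if_pos rfl, mul_one,
    mul_comm]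

section Substitution

variable {t : Params n} {Y : ComplexScheme} {D : Closeds Y.left} {e : CoordRing t ≃+* sectionRing D}

lemma eval₂Hom_eq_of_lift (he : ∀ c : ℂ, e (algebraMap ℂ (CoordRing t) c) = sectionConst Y D c)
    {y : Fin (n + 2) → sectionRing D} {Θ : PolyRing n →ₐ[ℂ] PolyRing n}
    (hy : ∀ j, y j = e (coordMk t (Θ (X j)))) (g : PolyRing n) :
    eval₂Hom (sectionConst Y D) y g = e (coordMk t (Θ g)) := by
  induction g using MvPolynomial.induction_on with
  | C c =>
    rw [coe_eval₂Hom, eval₂_C, ← he, show Θ (C c) = C c from Θ.commutes c]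
    rfl
  | add p q hp hq => simp only [map_add, hp, hq]
  | mul_X p j hp => rw [map_mul, hp, coe_eval₂Hom, eval₂_X, hy, map_mul, map_mul, map_mul]

/-- Composed with an isomorphism of the coordinate ring with the section ring, triangular automorphisms give
homogeneous generating systems. -/
lemma isGeneratingSystem_of_triangular
    (he : ∀ c : ℂ, e (algebraMap ℂ (CoordRing t) c) = sectionConst Y D c)
    (heg : ∀ (i : ℕ) (a : CoordRing t), a ∈ coordPiece t i ↔ e a ∈ sectionPiece D i)
    {Θ : PolyRing n →ₐ[ℂ] PolyRing n} (hΘ : IsTriangular Θ) (h0 : ∀ j, diagCoeff Θ j ≠ 0) :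
    IsGeneratingSystem Y D fun j => e (coordMk t (Θ (X j))) := by
  refine ⟨fun j => (heg _ _).mp (coordMk_mem t (hΘ.homogeneous j)), fun s => ?_⟩
  obtain ⟨a, rfl⟩ := e.surjective s
  obtain ⟨g, rfl⟩ : ∃ g, coordMk t g = a := Ideal.Quotient.mk_surjective a
  obtain ⟨g, rfl⟩ := (hΘ.bijective h0).2 g
  exact ⟨g, eval₂Hom_eq_of_lift he (fun _ => rfl) g⟩

/-- A homogeneous generating system of the section ring is obtained from the coordinates by a triangular
automorphism of the polynomial ring. -/
lemma IsGeneratingSystem.exists_triangular (hn : 1 ≤ n)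
    (he : ∀ c : ℂ, e (algebraMap ℂ (CoordRing t) c) = sectionConst Y D c)
    (heg : ∀ (i : ℕ) (a : CoordRing t), a ∈ coordPiece t i ↔ e a ∈ sectionPiece D i)
    {y : Fin (n + 2) → sectionRing D} (hy : IsGeneratingSystem Y D y) :
    ∃ Θ : PolyRing n →ₐ[ℂ] PolyRing n, IsTriangular Θ ∧ (∀ j, diagCoeff Θ j ≠ 0) ∧
      ∀ g, eval₂Hom (sectionConst Y D) y g = e (coordMk t (Θ g)) := by
  have h1 : ∀ j, ∃ g, IsWeightedHomogeneous (wt n) g (wt n j) ∧ y j = e (coordMk t g) := by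
    intro j
    obtain ⟨a, ha⟩ := e.surjective (y j)
    have h2 := hy.1 j
    rw [← ha, ← heg] at h2
    obtain ⟨g, hg, hga⟩ := h2
    exact ⟨g, hg, by rw [← ha, ← hga]; rfl⟩
  choose Y' hY' hyY using h1
  let Θ : PolyRing n →ₐ[ℂ] PolyRing n := aeval Y'
  have hΘX : ∀ j, Θ (X j) = Y' j := fun j => aeval_X _ _
  have hΘ : IsTriangular Θ := by
    refine ⟨fun j => by rw [hΘX]; exact hY' j, coeff (Finsupp.single (Fin.last _) 1) (Y' (Fin.last _)), ?_⟩
    rw [hΘX]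
    refine eq_C_mul_of_homogeneous_one hn ?_
    have := hY' (Fin.last _)
    rwa [wt_last] at this
  have hev : ∀ g, eval₂Hom (sectionConst Y D) y g = e (coordMk t (Θ g)) :=
    eval₂Hom_eq_of_lift he fun j => by rw [hΘX, hyY]
  refine ⟨Θ, hΘ, fun j h0 => ?_, hev⟩
  -- If the `j`-th diagonal coefficient were zero, no image under `Θ` would contain the monomial `x_j`. But `x_j`
  -- is such an image up to a multiple of `F_t`, which contains no monomial of weight less than `d_n`.
  obtain ⟨g, hg⟩ := hy.2 (e (coordMk t (X j)))
  rw [hev] at hg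
  have h3 : coordMk t (X j - Θ g) = 0 := by rw [map_sub, e.injective hg, sub_self]
  obtain ⟨h, hh⟩ := (coordMk_eq_zero_iff t _).mp h3
  have h4 := congrArg (coeff (Finsupp.single j 1)) hh
  rw [coeff_normalForm_mul_eq_zero t h (by rw [weight_single, one_mul]; exact wt_lt_deg j), coeff_sub, coeff_X,
    if_pos rfl] at h4
  have h5 : coeff (Finsupp.single j 1) (Θ g) = 0 := by
    induction j using Fin.lastCases with
    | last => rw [hΘ.coeff_last hn, h0, zero_mul]
    | cast k => rw [hΘ.coeff_single, h0, pow_one, zero_mul]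
  rw [h5, sub_zero] at h4
  exact one_ne_zero h4

/-- If `Θ` is the triangular automorphism belonging to a generating system, the ideal of relations is generated by
`Θ⁻¹ F_t`. -/
lemma IsGeneratingSystem.exists_ker (hn : 1 ≤ n)
    (he : ∀ c : ℂ, e (algebraMap ℂ (CoordRing t) c) = sectionConst Y D c)
    (heg : ∀ (i : ℕ) (a : CoordRing t), a ∈ coordPiece t i ↔ e a ∈ sectionPiece D i)
    {y : Fin (n + 2) → sectionRing D} (hy : IsGeneratingSystem Y D y) :
    ∃ g : PolyRing n, IsWeightedHomogeneous (wt n) g (deg n) ∧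
      (∀ k : Fin (n + 1), coeff (Finsupp.single k.castSucc (sylvester k)) g ≠ 0) ∧
      RingHom.ker (eval₂Hom (sectionConst Y D) y) = Ideal.span {g} := by
  obtain ⟨Θ, hΘ, h0, hev⟩ := hy.exists_triangular hn he heg
  obtain ⟨Ψ, hΨ, h1, h2⟩ := hΘ.exists_inverse h0
  refine ⟨Ψ (normalForm t), hΨ.map_homogeneous (normalForm_isWeightedHomogeneous t), fun k hk => ?_, ?_⟩
  · have h3 := hΘ.coeff_single k (sylvester k) (Ψ (normalForm t))
    rw [h2, coeff_normalForm_single, hk, mul_zero] at h3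
    exact one_ne_zero h3
  · ext g
    rw [RingHom.mem_ker, hev, map_eq_zero_iff e e.injective, coordMk_eq_zero_iff, Ideal.mem_span_singleton]
    constructor
    · intro h
      have := map_dvd Ψ h
      rwa [h1] at this
    · intro h
      have := map_dvd Θ h
      rwa [h2] at this

end Substitution

lemma rescale_inv {c : ℂ} (hc : c ≠ 0) {t t' : Params n} (h : t = rescale c t') : t' = rescale c⁻¹ t := by
  rw [h]
  funext i
  rw [rescale, rescale, ← mul_assoc, ← mul_pow, inv_mul_cancel₀ hc, one_pow, one_mul]

/-- The substitution `x_{n+1} ↦ γ x_{n+1}`. -/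
def scaleLast (n : ℕ) (γ : ℂ) : PolyRing n →ₐ[ℂ] PolyRing n :=
  aeval fun j => C ((Fin.snoc (α := fun _ => ℂ) (fun _ : Fin (n + 1) => (1 : ℂ)) γ : Fin (n + 2) → ℂ) j) * X j

lemma scaleLast_X (γ : ℂ) (j : Fin (n + 2)) : scaleLast n γ (X j) =
    C ((Fin.snoc (α := fun _ => ℂ) (fun _ : Fin (n + 1) => (1 : ℂ)) γ : Fin (n + 2) → ℂ) j) * X j := aeval_X _ _

lemma isTriangular_scaleLast (γ : ℂ) : IsTriangular (scaleLast n γ) :=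
  ⟨fun j => by rw [scaleLast_X]; exact (isWeightedHomogeneous_X ℂ _ _).C_mul _, _, scaleLast_X γ _⟩

lemma diagCoeff_scaleLast {γ : ℂ} (hγ : γ ≠ 0) (j : Fin (n + 2)) : diagCoeff (scaleLast n γ) j ≠ 0 := by
  rw [diagCoeff, scaleLast_X, coeff_C_mul, coeff_X, if_pos rfl, mul_one]
  induction j using Fin.lastCases with
  | last => rwa [Fin.snoc_last]
  | cast k => rw [Fin.snoc_castSucc]; exact one_ne_zero

lemma scaleLast_normalForm (t : Params n) (γ : ℂ) :
    scaleLast n γ (normalForm t) = normalForm (rescale γ t) := by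
  have hcoeff : ∀ d, coeff d (scaleLast n γ (normalForm t)) = γ ^ d (Fin.last _) * coeff d (normalForm t) := by
    intro d
    rw [coeff_of_diagonal (scaleLast_X γ), Fin.prod_univ_castSucc]
    simp
  rw [eq_normalForm ((isTriangular_scaleLast γ).map_homogeneous (normalForm_isWeightedHomogeneous t))
    (fun k => ?_) (fun k d hd => ?_)]
  · congr 1
    funext i
    rw [hcoeff, coeff_normalForm_exponent, Idx.exponent_last]
    rfl
  · rw [hcoeff, coeff_normalForm_single, Finsupp.single_eq_of_ne (Fin.castSucc_lt_last k).ne', pow_zero, one_mul]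
  · rw [hcoeff, coeff_normalForm_eq_zero t hd, mul_zero]

/-- The section ring determines the normal form up to the action of the torus. -/
lemma exists_generators_iff {t : Params n} {Y : ComplexScheme} {D : Closeds Y.left}
    {e : CoordRing t ≃+* sectionRing D} (hn : 1 ≤ n)
    (he : ∀ c : ℂ, e (algebraMap ℂ (CoordRing t) c) = sectionConst Y D c)
    (heg : ∀ (i : ℕ) (a : CoordRing t), a ∈ coordPiece t i ↔ e a ∈ sectionPiece D i) (t' : Params n) :
    (∃ y : Fin (n + 2) → sectionRing D, IsGeneratingSystem Y D y ∧
      eval₂Hom (sectionConst Y D) y (normalForm t') = 0) ↔ ∃ c : ℂ, c ≠ 0 ∧ t' = rescale c t := by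
  constructor
  · rintro ⟨y, hy, hy0⟩
    obtain ⟨Θ, hΘ, h0, hev⟩ := hy.exists_triangular hn he heg
    rw [hev, map_eq_zero_iff e e.injective, coordMk_eq_zero_iff] at hy0
    obtain ⟨h, hh⟩ := hy0
    -- both sides are homogeneous of degree `d_n`, so only the constant term of `h` matters
    have h1 : Θ (normalForm t') = C (coeff 0 h) * normalForm t := by
      ext d
      rw [coeff_C_mul]
      by_cases hd : Finsupp.weight (wt n) d = deg n
      · rw [hh, coeff_normalForm_mul t h hd.le, mul_comm]
      · rw [(hΘ.map_homogeneous (normalForm_isWeightedHomogeneous t')).coeff_eq_zero d hd,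
          (normalForm_isWeightedHomogeneous t).coeff_eq_zero d hd, mul_zero]
    obtain ⟨c, hc, h2⟩ := hΘ.exists_rescale h0 h1
    exact ⟨c⁻¹, inv_ne_zero hc, rescale_inv hc h2⟩
  · rintro ⟨c, hc, rfl⟩
    refine ⟨_, isGeneratingSystem_of_triangular he heg (isTriangular_scaleLast c⁻¹)
      (diagCoeff_scaleLast (inv_ne_zero hc)), ?_⟩
    rw [eval₂Hom_eq_of_lift he fun _ => rfl, scaleLast_normalForm, ← rescale_inv hc rfl,
      (coordMk_eq_zero_iff t _).mpr dvd_rfl, map_zero]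

end Generators

end

/-! ### Pullback of sections and pole orders -/

section Pullback

/-- The open set `U ∖ D`. -/
abbrev offOpen {X : Scheme.{0}} (D : Closeds X) (U : X.Opens) : X.Opens :=
  finiteIncl D ''ᵁ (finiteIncl D ⁻¹ᵁ U)

lemma offOpen_le {X : Scheme.{0}} (D : Closeds X) (U : X.Opens) : offOpen D U ≤ U :=
  fun _ hx => (mem_image_preimage.mp hx).1

variable {X X' X'' : Scheme.{0}} {D : Closeds X} {D' : Closeds X'} {D'' : Closeds X''}

lemma offOpen_mono (D : Closeds X) {V U : X.Opens} (h : V ≤ U) : offOpen D V ≤ offOpen D U :=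
  fun _ hx => mem_image_preimage.mpr ⟨h (mem_image_preimage.mp hx).1, (mem_image_preimage.mp hx).2⟩

lemma restrictOff_eq (D : Closeds X) (U : X.Opens) :
    restrictOff D U = openRes (offOpen_le D U) := rfl

lemma offOpen_le_preimage (f : X ⟶ X') (hD : ∀ x, f x ∈ D' → x ∈ D) {U : X.Opens}
    {U' : X'.Opens} (h : U ≤ f ⁻¹ᵁ U') : offOpen D U ≤ f ⁻¹ᵁ offOpen D' U' :=
  fun x hx => mem_image_preimage.mpr ⟨h (mem_image_preimage.mp hx).1,
    fun hx' => (mem_image_preimage.mp hx).2 (hD x hx')⟩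

/-- The pullback `𝒪_{X'}(U' ∖ D') → 𝒪_X(U ∖ D)` along a morphism `f : X ⟶ X'` with `f⁻¹ D' ⊆ D`
and `U ⊆ f⁻¹ U'`. -/
def pullPunctured (f : X ⟶ X') (hD : ∀ x, f x ∈ D' → x ∈ D) {U : X.Opens} {U' : X'.Opens}
    (h : U ≤ f ⁻¹ᵁ U') : PuncturedSections D' U' →+* PuncturedSections D U :=
  (f.appLE (offOpen D' U') (offOpen D U) (offOpen_le_preimage f hD h)).hom

variable (f : X ⟶ X') (hD : ∀ x, f x ∈ D' → x ∈ D)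

lemma pullPunctured_restrictOff {U : X.Opens} {U' : X'.Opens} (h : U ≤ f ⁻¹ᵁ U') (a : Γ(X', U')) :
    pullPunctured f hD h (restrictOff D' U' a) = restrictOff D U ((f.appLE U' U h).hom a) := by
  have h1 := f.map_appLE (offOpen_le_preimage f hD h) (homOfLE (offOpen_le D' U')).op
  have h2 := f.appLE_map h (homOfLE (offOpen_le D U)).op
  exact congr($(h1.trans h2.symm).hom a)

lemma pullPunctured_puncturedRes {V U : X.Opens} {V' U' : X'.Opens} (h : U ≤ f ⁻¹ᵁ U')
    (h' : V ≤ f ⁻¹ᵁ V') (hV : V ≤ U) (hV' : V' ≤ U') (s : PuncturedSections D' U') :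
    pullPunctured f hD h' (puncturedRes D' hV' s) = puncturedRes D hV (pullPunctured f hD h s) := by
  have h1 := f.map_appLE (offOpen_le_preimage f hD h') (homOfLE (offOpen_mono D' hV')).op
  have h2 := f.appLE_map (offOpen_le_preimage f hD h) (homOfLE (offOpen_mono D hV)).op
  exact congr($(h1.trans h2.symm).hom s)

lemma pullPunctured_pullPunctured (g : X' ⟶ X'') (hD' : ∀ x, g x ∈ D'' → x ∈ D') {U : X.Opens}
    {U' : X'.Opens} {U'' : X''.Opens} (h : U ≤ f ⁻¹ᵁ U') (h' : U' ≤ g ⁻¹ᵁ U'')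
    (hD2 : ∀ x, (f ≫ g) x ∈ D'' → x ∈ D) (h2 : U ≤ (f ≫ g) ⁻¹ᵁ U'') (s : PuncturedSections D'' U'') :
    pullPunctured f hD h (pullPunctured g hD' h' s) = pullPunctured (f ≫ g) hD2 h2 s := by
  have h1 := Scheme.Hom.appLE_comp_appLE f g _ _ _ (offOpen_le_preimage g hD' h')
    (offOpen_le_preimage f hD h)
  exact congr($(h1).hom s)

lemma pullPunctured_eq_self (f : X ⟶ X) (hf : f = 𝟙 X) (hD : ∀ x, f x ∈ D → x ∈ D) {U : X.Opens}
    (h : U ≤ f ⁻¹ᵁ U) (s : PuncturedSections D U) : pullPunctured f hD h s = s := by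
  subst hf
  have h1 : pullPunctured (𝟙 X) hD h s = openRes (le_refl (offOpen D U)) s := rfl
  rw [h1]
  exact congr($(X.presheaf.map_id (Opposite.op (offOpen D U))).hom s)

variable {f}

lemma isGenericPointOf_iso (e : X ≅ X') (hD : ∀ x, e.hom x ∈ D' ↔ x ∈ D) (η : X) (h : IsGenericPointOf D η) :
    IsGenericPointOf D' (e.hom η) := by
  refine ⟨(hD η).mpr h.1, fun ξ hξ hs => ?_⟩
  have h1 : e.hom (e.inv ξ) = ξ := congr($(e.inv_hom_id) ξ)
  have h3 : e.inv (e.hom η) = η := congr($(e.hom_inv_id) η)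
  have h2 := h.2 (e.inv ξ) ((hD _).mp (h1.symm ▸ hξ)) (by
    have := hs.map e.inv.continuous
    rwa [h3] at this)
  have := h2.map e.hom.continuous
  rwa [h1] at this

/-- The pole order does not increase under pullback along an isomorphism of pairs. -/
lemma PoleOrderLE.pullPunctured (e : X ≅ X') (hD : ∀ x, e.hom x ∈ D' ↔ x ∈ D) {U : X.Opens} {U' : X'.Opens}
    (h : U ≤ e.hom ⁻¹ᵁ U') {m : ℕ} {s : PuncturedSections D' U'} (hs : PoleOrderLE D' m s) :
    PoleOrderLE D m (pullPunctured e.hom (fun x => (hD x).mp) h s) := by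
  intro η hη hg
  have h1 := hs (e.hom η) (h hη) (isGenericPointOf_iso e hD η hg)
  -- the stalk map is an isomorphism, so the maximal ideal at `η` is generated by the one at `e η`
  have hm : IsLocalRing.maximalIdeal (X.presheaf.stalk η) ≤
      (IsLocalRing.maximalIdeal (X'.presheaf.stalk (e.hom η))).map (e.hom.stalkMap η).hom := by
    intro a ha
    obtain ⟨b, rfl⟩ : ∃ b, (e.hom.stalkMap η).hom b = a :=
      ((ConcreteCategory.bijective_of_isIso (e.hom.stalkMap η)).2 a)
    refine Ideal.mem_map_of_mem _ ?_
    by_contra hb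
    rw [IsLocalRing.mem_maximalIdeal, mem_nonunits_iff, not_not] at hb
    exact ha (hb.map _)
  refine (Ideal.pow_right_mono hm m).trans ?_
  rw [← Ideal.map_pow, Ideal.map_le_iff_le_comap]
  refine h1.trans ?_
  rintro α ⟨W, hW, hηW, a, b, rfl, hab⟩
  have hVW : U ⊓ e.hom ⁻¹ᵁ W ≤ e.hom ⁻¹ᵁ W := inf_le_right
  refine ⟨U ⊓ e.hom ⁻¹ᵁ W, inf_le_left, ⟨hη, hηW⟩, (e.hom.appLE W _ hVW).hom a,
    (e.hom.appLE W _ hVW).hom b, ?_, ?_⟩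
  · have := Scheme.Hom.germ_stalkMap_apply e.hom W η hηW a
    rw [this]
    exact X.presheaf.germ_res_apply (homOfLE hVW) η ⟨hη, hηW⟩ _
  · rw [← pullPunctured_restrictOff e.hom (fun x => (hD x).mp), ← pullPunctured_restrictOff e.hom (fun x => (hD x).mp),
      ← pullPunctured_puncturedRes e.hom _ h hVW inf_le_left hW, ← map_mul, hab]

end Pullback

/-! ### Transport of sheaves and section rings -/

section SheafTransport

variable {X X' : Scheme.{0}} {D : Closeds X} {D' : Closeds X'}

lemma pullPunctured_inv_hom (e : X ≅ X') (hD : ∀ x, e.hom x ∈ D' → x ∈ D) (hD' : ∀ x, e.inv x ∈ D → x ∈ D')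
    {U : X.Opens} {U' : X'.Opens} (h : U ≤ e.hom ⁻¹ᵁ U') (h' : U' ≤ e.inv ⁻¹ᵁ U) (s : PuncturedSections D U) :
    pullPunctured e.hom hD h (pullPunctured e.inv hD' h' s) = s := by
  have hx : ∀ x, (e.hom ≫ e.inv) x = x := fun x => congr($(e.hom_inv_id) x)
  rw [pullPunctured_pullPunctured e.hom hD e.inv hD' h h' (fun x hx' => by rwa [hx] at hx')
    (fun x hx' => by
      change (e.hom ≫ e.inv) x ∈ U
      rwa [hx])]
  exact pullPunctured_eq_self _ e.hom_inv_id _ _ s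

lemma pullPunctured_restrictOff_mul (f : X ⟶ X') (hD : ∀ x, f x ∈ D' → x ∈ D) (U : X'.Opens)
    (r : Γ(X', U)) (s : PuncturedSections D' U) :
    pullPunctured f hD (U := f ⁻¹ᵁ U) le_rfl (restrictOff D' U r * s) =
      restrictOff D _ ((f.app U).hom r) * pullPunctured f hD (U := f ⁻¹ᵁ U) le_rfl s := by
  rw [map_mul, pullPunctured_restrictOff, Scheme.Hom.appLE_eq_app]

/-- The pullback of sections, as a morphism `𝒪_{X'}(m D') ⟶ e_* 𝒪_X(m D)`. -/
def pullHom (e : X ≅ X') (hD : ∀ x, e.hom x ∈ D' ↔ x ∈ D) (m : ℕ) :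
    divisorialSheaf D' m ⟶ (Scheme.Modules.pushforward e.hom).obj (divisorialSheaf D m) where
  val := PresheafOfModules.homMk
    { app := fun U => AddCommGrpCat.ofHom
        { toFun := fun s => (⟨pullPunctured e.hom (fun x => (hD x).mp) (U := e.hom ⁻¹ᵁ U.unop) le_rfl s.1,
            s.2.pullPunctured e hD le_rfl⟩ : (divisorialSubmodule D m).obj (Opposite.op (e.hom ⁻¹ᵁ U.unop)))
          map_zero' := Subtype.ext (map_zero _)
          map_add' := fun s s' => Subtype.ext (map_add _ _ _) }
      naturality := fun U V i => by
        ext s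
        refine Subtype.ext ?_
        exact pullPunctured_puncturedRes e.hom (fun x => (hD x).mp) le_rfl le_rfl (fun _ hx => i.unop.le hx) i.unop.le s.1 }
    (fun U r s => Subtype.ext (pullPunctured_restrictOff_mul e.hom (fun x => (hD x).mp) U.unop r s.1))

lemma isIso_pullHom (e : X ≅ X') (hD : ∀ x, e.hom x ∈ D' ↔ x ∈ D) (m : ℕ) : IsIso (pullHom e hD m) := by
  have h1 : ∀ x, e.hom (e.inv x) = x := fun x => congr($(e.inv_hom_id) x)
  have hD' : ∀ x, e.inv x ∈ D ↔ x ∈ D' := fun x => by rw [← hD, h1]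
  rw [Scheme.Modules.Hom.isIso_iff_isIso_app]
  intro U
  have hU : U ≤ e.inv ⁻¹ᵁ (e.hom ⁻¹ᵁ U) := fun x hx => by
    change e.hom (e.inv x) ∈ U
    rwa [h1]
  rw [ConcreteCategory.isIso_iff_bijective]
  constructor
  · intro s s' h
    have h2 := congrArg (Subtype.val (p := fun s => s ∈ (divisorialSubmodule D m).obj (Opposite.op (e.hom ⁻¹ᵁ U)))) h
    refine Subtype.ext ?_
    have h3 := congrArg (pullPunctured e.inv (fun x => (hD' x).mp) hU) h2
    have key := pullPunctured_inv_hom e.symm (fun x => (hD' x).mp) (fun x => (hD x).mp) hU le_rfl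
    exact (key _).symm.trans (h3.trans (key _))
  · intro s
    have hs : PoleOrderLE D m (Subtype.val (p := fun s => s ∈ (divisorialSubmodule D m).obj (Opposite.op (e.hom ⁻¹ᵁ U))) s) :=
      Subtype.property (p := fun s => s ∈ (divisorialSubmodule D m).obj (Opposite.op (e.hom ⁻¹ᵁ U))) s
    refine ⟨(⟨_, hs.pullPunctured e.symm hD' hU⟩ : (divisorialSubmodule D' m).obj (Opposite.op U)), ?_⟩
    refine Subtype.ext ?_
    exact pullPunctured_inv_hom e (fun x => (hD x).mp) (fun x => (hD' x).mp) le_rfl hU _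

/-- An isomorphism `e` with `e⁻¹ D' = D` identifies `e_* 𝒪(mD)` with `𝒪(mD')`. -/
theorem nonempty_pushforward_iso (e : X ≅ X') (hD : ∀ x, e.hom x ∈ D' ↔ x ∈ D) (m : ℕ) :
    Nonempty ((Scheme.Modules.pushforward e.hom).obj (divisorialSheaf D m) ≅ divisorialSheaf D' m) :=
  have := isIso_pullHom e hD m
  ⟨(asIso (pullHom e hD m)).symm⟩

end SheafTransport

section RingTransport

variable {X X' : ComplexScheme} {D : Closeds X.left} {D' : Closeds X'.left}

/-- The isomorphism of schemes underlying an isomorphism of schemes over `ℂ`. -/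
def leftIso (e : X ≅ X') : X.left ≅ X'.left where
  hom := e.hom.left
  inv := e.inv.left
  hom_inv_id := congrArg CommaMorphism.left e.hom_inv_id
  inv_hom_id := congrArg CommaMorphism.left e.inv_hom_id

lemma appTop_globalConst (f : X ⟶ X') (c : ℂ) :
    f.left.appTop.hom (globalConst X' c) = globalConst X c := by
  have h := Scheme.Hom.comp_appTop f.left X'.hom
  rw [Over.w f] at h
  exact congr($(h.symm).hom ((Scheme.ΓSpecIso (CommRingCat.of ℂ)).inv.hom c))

/-- The pullback of section rings along an isomorphism of pairs. -/
def pullRing (e : X.left ≅ X'.left) (hD : ∀ x, e.hom x ∈ D' ↔ x ∈ D) : sectionRing D' →+* sectionRing D :=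
  ((Polynomial.mapRingHom (pullPunctured (D := D) (D' := D') (U := ⊤) (U' := ⊤) e.hom (fun x => (hD x).mp)
    fun _ _ => trivial)).comp (sectionRing D').subtype).codRestrict (sectionRing D) fun s m => by
      have h : PoleOrderLE D' m (s.1.coeff m) := s.2 m
      rw [RingHom.comp_apply, Polynomial.coe_mapRingHom, Polynomial.coeff_map]
      exact h.pullPunctured e hD _

lemma coe_pullRing (e : X.left ≅ X'.left) (hD : ∀ x, e.hom x ∈ D' ↔ x ∈ D) (s : sectionRing D') :
    (pullRing e hD s).1 = s.1.map (pullPunctured (D := D) (D' := D') (U := ⊤) (U' := ⊤) e.hom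
      (fun x => (hD x).mp) fun _ _ => trivial) := rfl

lemma pullRing_sectionConst (e : X ≅ X') (hD : ∀ x, (leftIso e).hom x ∈ D' ↔ x ∈ D) (c : ℂ) :
    pullRing (leftIso e) hD (sectionConst X' D' c) = sectionConst X D c := by
  refine Subtype.ext ?_
  rw [coe_pullRing, coe_sectionConst, coe_sectionConst, Polynomial.map_C]
  congr 1
  refine (pullPunctured_restrictOff _ _ _ _).trans (congrArg _ ?_)
  rw [← appTop_globalConst e.hom]
  exact congr($(Scheme.Hom.appLE_eq_app e.hom.left (U := ⊤)).hom (globalConst X' c))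

lemma pullRing_mem (e : X.left ≅ X'.left) (hD : ∀ x, e.hom x ∈ D' ↔ x ∈ D) {m : ℕ} {s : sectionRing D'}
    (hs : s ∈ sectionPiece D' m) : pullRing e hD s ∈ sectionPiece D m := by
  intro k hk
  rw [coe_pullRing, Polynomial.coeff_map, hs k hk, map_zero]

lemma pullRing_bijective (e : X.left ≅ X'.left) (hD : ∀ x, e.hom x ∈ D' ↔ x ∈ D) :
    Function.Bijective (pullRing e hD) := by
  have h1 : ∀ x, e.hom (e.inv x) = x := fun x => congr($(e.inv_hom_id) x)
  have hD' : ∀ x, e.inv x ∈ D ↔ x ∈ D' := fun x => by rw [← hD, h1]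
  refine Function.bijective_iff_has_inverse.mpr ⟨pullRing e.symm hD', fun s => ?_, fun s => ?_⟩
  · refine Subtype.ext (Polynomial.ext fun k => ?_)
    rw [coe_pullRing, Polynomial.coeff_map, coe_pullRing, Polynomial.coeff_map]
    exact pullPunctured_inv_hom e.symm (fun x => (hD' x).mp) (fun x => (hD x).mp) _ _ _
  · refine Subtype.ext (Polynomial.ext fun k => ?_)
    rw [coe_pullRing, Polynomial.coeff_map, coe_pullRing, Polynomial.coeff_map]
    exact pullPunctured_inv_hom e (fun x => (hD x).mp) (fun x => (hD' x).mp) _ _ _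

/-- Isomorphic pairs have isomorphic graded section rings. -/
theorem exists_sectionRing_equiv_of_iso (e : X ≅ X') (hD : ∀ x, (leftIso e).hom x ∈ D' ↔ x ∈ D) :
    ∃ E : sectionRing D' ≃+* sectionRing D, (∀ c, E (sectionConst X' D' c) = sectionConst X D c) ∧
      ∀ (m : ℕ) (s : sectionRing D'), s ∈ sectionPiece D' m → E s ∈ sectionPiece D m :=
  ⟨RingEquiv.ofBijective _ (pullRing_bijective (leftIso e) hD), pullRing_sectionConst e hD,
    fun _ _ => pullRing_mem _ hD⟩

end RingTransport

/-! ### The sheaf determines the divisor -/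

section SheafDeterminesDivisor

variable {X X' : Scheme.{0}} {D : Closeds X} {D' : Closeds X'}

lemma openRes_surjective {W U : X.Opens} (h : W ≤ U) (h' : U ≤ W) : Function.Surjective (openRes h) := by
  obtain rfl := le_antisymm h h'
  intro s
  exact ⟨s, congr($(X.presheaf.map_id (Opposite.op W)).hom s)⟩

lemma restrictOff_surjective {U : X.Opens} (h : ∀ x ∈ U, x ∉ D) : Function.Surjective (restrictOff D U) := by
  rw [restrictOff_eq]
  exact openRes_surjective _ fun x hx => mem_image_preimage.mpr ⟨hx, h x hx⟩

/-- The canonical section `1` of `𝒪(mD)`. -/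
lemma one_mem_divisorialSubmodule (D : Closeds X) (m : ℕ) (U : X.Opens) : PoleOrderLE D m (1 : PuncturedSections D U) := by
  intro η hη _
  have := denominatorIdeal_restrictOff D (U := U) 1 η hη
  rw [map_one] at this
  exact le_top.trans_eq this.symm

/-- Where `e_* 𝒪_X(D)` is generated by the section `1`, so is `𝒪_{X'}(D') ≅ e_* 𝒪_X(D)` by the image of `1`. If
this image is regular, all sections of `𝒪_{X'}(D')` are regular there. -/
lemma exists_restrictOff_of_iso (e : X ≅ X')
    (ψ : (Scheme.Modules.pushforward e.hom).obj (divisorialSheaf D 1) ≅ divisorialSheaf D' 1)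
    (hglob : ∀ s : PuncturedSections D' ⊤, PoleOrderLE D' 1 s → ∃ f, s = restrictOff D' ⊤ f)
    (V : X'.Opens) (hV : ∀ x ∈ e.hom ⁻¹ᵁ V, x ∉ D) (s : PuncturedSections D' V) (hs : PoleOrderLE D' 1 s) :
    ∃ f, s = restrictOff D' V f := by
  let one : (divisorialSubmodule D 1).obj (Opposite.op (e.hom ⁻¹ᵁ (⊤ : X'.Opens))) :=
    ⟨(1 : PuncturedSections D (e.hom ⁻¹ᵁ (⊤ : X'.Opens))), one_mem_divisorialSubmodule D 1 _⟩
  let s₀ : (divisorialSubmodule D' 1).obj (Opposite.op V) := ⟨s, hs⟩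
  let σ : (divisorialSubmodule D 1).obj (Opposite.op (e.hom ⁻¹ᵁ V)) := ψ.inv.app V s₀
  obtain ⟨g, hg⟩ := restrictOff_surjective hV σ.1
  obtain ⟨r, rfl⟩ := (ConcreteCategory.bijective_of_isIso (e.hom.app V)).2 g
  -- over `V` the section `s` corresponds to a multiple `r • 1`; so `s = r u`, where the image `u` of `1` is regular
  let u : (divisorialSubmodule D' 1).obj (Opposite.op (⊤ : X'.Opens)) := ψ.hom.app ⊤ one
  obtain ⟨c, hc⟩ := hglob u.1 u.2
  have h1 : (σ : (Scheme.Modules.presheaf ((Scheme.Modules.pushforward e.hom).obj (divisorialSheaf D 1))).obj (.op V)) =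
      r • (((Scheme.Modules.pushforward e.hom).obj (divisorialSheaf D 1)).presheaf.map
        (homOfLE le_top : V ⟶ ⊤).op one) := by
    refine Subtype.ext ?_
    refine hg.symm.trans ?_
    have h2 : restrictOff D (e.hom ⁻¹ᵁ V) ((e.hom.app V).hom r) =
      restrictOff D (e.hom ⁻¹ᵁ V) ((e.hom.app V).hom r) *
        puncturedRes D (U := e.hom ⁻¹ᵁ (⊤ : X'.Opens)) (W := e.hom ⁻¹ᵁ V) (fun _ _ => trivial) 1 := by
      rw [map_one, mul_one]
    exact h2
  have h3 : ψ.hom.app V σ = s₀ := congr($(ψ.inv_hom_id).app V s₀)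
  rw [h1, Scheme.Modules.Hom.app_smul] at h3
  have h4 : ψ.hom.app V (((Scheme.Modules.pushforward e.hom).obj (divisorialSheaf D 1)).presheaf.map
        (homOfLE le_top : V ⟶ ⊤).op one) = (divisorialSheaf D' 1).presheaf.map (homOfLE le_top : V ⟶ ⊤).op u :=
    congr($(ψ.hom.mapPresheaf.naturality (homOfLE le_top : V ⟶ ⊤).op) one)
  rw [h4] at h3
  have h5 := congrArg (Subtype.val (p := fun s => s ∈ (divisorialSubmodule D' 1).obj (Opposite.op V))) h3
  have h6 : s = restrictOff D' V r * puncturedRes D' (le_top : V ≤ ⊤) u.1 := h5.symm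
  exact ⟨r * openRes le_top c, by rw [h6, hc, map_mul, restrictOff_res]⟩

/-- The inverse of an isomorphism `e_* M ≅ M'`. -/
lemma nonempty_pushforward_symm (e : X ≅ X') {M : X.Modules} {M' : X'.Modules}
    (h : Nonempty ((Scheme.Modules.pushforward e.hom).obj M ≅ M')) :
    Nonempty ((Scheme.Modules.pushforward e.inv).obj M' ≅ M) := by
  obtain ⟨ψ⟩ := h
  exact ⟨(Scheme.Modules.pushforward e.inv).mapIso ψ.symm ≪≫
    (Scheme.Modules.pushforwardComp e.hom e.inv).app M ≪≫
    (Scheme.Modules.pushforwardCongr e.hom_inv_id).app M ≪≫ (Scheme.Modules.pushforwardId X).app M⟩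

end SheafDeterminesDivisor

/-! ### Isomorphisms from rescaling -/

section

open MvPolynomial

section GradedIso

variable {A B σ τ : Type} [CommRing A] [SetLike σ A] [AddSubgroupClass σ A]
  [CommRing B] [SetLike τ B] [AddSubgroupClass τ B]
  {𝒜 : ℕ → σ} {ℬ : ℕ → τ} [GradedRing 𝒜] [GradedRing ℬ]

lemma irrelevant_le_map_of_rightInverse (f : GradedRingHom 𝒜 ℬ) (g : GradedRingHom ℬ 𝒜)
    (h : ∀ b, f (g b) = b) :
    HomogeneousIdeal.irrelevant ℬ ≤ (HomogeneousIdeal.irrelevant 𝒜).map f := by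
  intro b hb
  have hb' : b ∈ HomogeneousIdeal.irrelevant ℬ := hb
  rw [HomogeneousIdeal.mem_irrelevant_iff, GradedRing.proj_apply] at hb'
  have hg : g b ∈ HomogeneousIdeal.irrelevant 𝒜 := by
    rw [HomogeneousIdeal.mem_irrelevant_iff, GradedRing.proj_apply, ← map_directSumDecompose (𝒜 := ℬ), hb', map_zero]
  have := Ideal.mem_map_of_mem f (I := (HomogeneousIdeal.irrelevant 𝒜).toIdeal) hg
  rwa [h] at this

/-- The isomorphism of homogeneous spectra given by inverse isomorphisms of graded rings. -/
def projIso (f : GradedRingHom 𝒜 ℬ) (g : GradedRingHom ℬ 𝒜) (h : ∀ b, f (g b) = b)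
    (h' : ∀ a, g (f a) = a) : Proj ℬ ≅ Proj 𝒜 where
  hom := Proj.map f (irrelevant_le_map_of_rightInverse f g h)
  inv := Proj.map g (irrelevant_le_map_of_rightInverse g f h')
  hom_inv_id := by
    have h1 : f.comp g = GradedRingHom.id ℬ := DFunLike.ext _ _ h
    rw [← Proj.map_comp, ← Proj.map_id]
    congr 1
  inv_hom_id := by
    have h1 : g.comp f = GradedRingHom.id 𝒜 := DFunLike.ext _ _ h'
    rw [← Proj.map_comp, ← Proj.map_id]
    congr 1

lemma awayι_map_comp_toSpecZero {R : Type} [CommRing R] (f : GradedRingHom 𝒜 ℬ)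
    (hf : HomogeneousIdeal.irrelevant ℬ ≤ (HomogeneousIdeal.irrelevant 𝒜).map f) (u : R →+* 𝒜 0) (v : R →+* ℬ 0)
    (h : ∀ c, f (u c) = v c) {i : ℕ} (hi : 0 < i) (s : A) (hs : s ∈ 𝒜 i) :
    Proj.awayι ℬ (f s) (f.2 hs) hi ≫ Proj.map f hf ≫ Proj.toSpecZero 𝒜 ≫ Spec.map (CommRingCat.ofHom u) =
      Proj.awayι ℬ (f s) (f.2 hs) hi ≫ Proj.toSpecZero ℬ ≫ Spec.map (CommRingCat.ofHom v) := by
  rw [Proj.awayι_comp_map_assoc f hf hi s hs, Proj.awayι_toSpecZero_assoc, Proj.awayι_toSpecZero_assoc,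
    ← Spec.map_comp, ← Spec.map_comp, ← Spec.map_comp]
  congr 1
  ext c
  change HomogeneousLocalization.val (HomogeneousLocalization.Away.map f s
    (HomogeneousLocalization.mk ⟨0, u c, 1, one_mem (Submonoid.powers s)⟩ : HomogeneousLocalization 𝒜 (Submonoid.powers s))) =
    HomogeneousLocalization.val
      (HomogeneousLocalization.mk ⟨0, v c, 1, one_mem (Submonoid.powers (f s))⟩ : HomogeneousLocalization ℬ (Submonoid.powers (f s)))
  rw [HomogeneousLocalization.Away.map, HomogeneousLocalization.map_mk, HomogeneousLocalization.val_mk,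
    HomogeneousLocalization.val_mk]
  congr 1
  · exact h c
  · refine Subtype.ext ?_
    exact map_one f

/-- A graded homomorphism compatible with structure maps from `R` induces a morphism over `Spec R`. -/
lemma map_comp_toSpecZero {R : Type} [CommRing R] (f : GradedRingHom 𝒜 ℬ)
    (hf : HomogeneousIdeal.irrelevant ℬ ≤ (HomogeneousIdeal.irrelevant 𝒜).map f) (u : R →+* 𝒜 0) (v : R →+* ℬ 0)
    (h : ∀ c, f (u c) = v c) :
    Proj.map f hf ≫ Proj.toSpecZero 𝒜 ≫ Spec.map (CommRingCat.ofHom u) =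
      Proj.toSpecZero ℬ ≫ Spec.map (CommRingCat.ofHom v) :=
  (Proj.mapAffineOpenCover f hf).openCover.hom_ext _ _ fun s =>
    awayι_map_comp_toSpecZero f hf u v h s.1.2 _ s.2.2

end GradedIso

section Rescale

variable {n : ℕ} {t t' : Params n}

lemma scaleLast_scaleLast {γ δ : ℂ} (h : γ * δ = 1) (g : PolyRing n) : scaleLast n γ (scaleLast n δ g) = g := by
  have : (scaleLast n γ).comp (scaleLast n δ) = AlgHom.id ℂ _ := by
    ext j : 1
    rw [AlgHom.comp_apply, scaleLast_X, map_mul, scaleLast_X, show scaleLast n γ (C _) = C _ from AlgHom.commutes _ _,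
      ← mul_assoc, ← map_mul]
    induction j using Fin.lastCases with
    | last => rw [Fin.snoc_last, Fin.snoc_last, mul_comm δ, h, map_one, one_mul]; rfl
    | cast k => rw [Fin.snoc_castSucc, Fin.snoc_castSucc, one_mul, map_one, one_mul]; rfl
  exact congr($this g)

/-- The homomorphism of coordinate rings induced by `x_{n+1} ↦ γ x_{n+1}`. -/
def scaleHom {γ : ℂ} (h : t' = rescale γ t) : GradedRingHom (coordPiece t) (coordPiece t') where
  toRingHom := Ideal.Quotient.lift (Ideal.span {normalForm t})
    ((coordMk t').comp (scaleLast n γ) : PolyRing n →+* CoordRing t') fun g hg => by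
      obtain ⟨k, rfl⟩ := Ideal.mem_span_singleton.mp hg
      refine (coordMk_eq_zero_iff t' _).mpr ?_
      change _ ∣ scaleLast n γ _
      rw [map_mul, scaleLast_normalForm, ← h]
      exact dvd_mul_right _ _
  map_mem := by
    rintro i _ ⟨g, hg, rfl⟩
    exact coordMk_mem t' ((isTriangular_scaleLast γ).map_homogeneous hg)

lemma scaleHom_coordMk {γ : ℂ} (h : t' = rescale γ t) (g : PolyRing n) :
    scaleHom h (coordMk t g) = coordMk t' (scaleLast n γ g) := rfl

lemma scaleHom_scaleHom {γ δ : ℂ} (h : t' = rescale γ t) (h' : t = rescale δ t') (hγ : γ * δ = 1) (a : CoordRing t') :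
    scaleHom h (scaleHom h' a) = a := by
  obtain ⟨g, rfl⟩ : ∃ g, coordMk t' g = a := Ideal.Quotient.mk_surjective a
  rw [scaleHom_coordMk, scaleHom_coordMk, scaleLast_scaleLast hγ]

lemma scaleHom_algebraMap {γ : ℂ} (h : t' = rescale γ t) (c : ℂ) :
    scaleHom h (algebraMap ℂ (CoordRing t) c) = algebraMap ℂ (CoordRing t') c := by
  have h1 : ∀ t : Params n, algebraMap ℂ (CoordRing t) c = coordMk t (C c) := fun _ => rfl
  rw [h1, h1, scaleHom_coordMk]
  exact congrArg _ ((scaleLast n γ).commutes c)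

lemma scaleHom_coordVar_last {γ : ℂ} (h : t' = rescale γ t) :
    scaleHom h (coordVar t (Fin.last _)) = coordMk t' (C γ) * coordVar t' (Fin.last _) := by
  rw [coordVar, scaleHom_coordMk, scaleLast_X, map_mul, Fin.snoc_last]
  rfl

lemma idealAt_projIso {A B σ τ : Type} [CommRing A] [SetLike σ A] [AddSubgroupClass σ A]
    [CommRing B] [SetLike τ B] [AddSubgroupClass τ B]
    {𝒜 : ℕ → σ} {ℬ : ℕ → τ} [GradedRing 𝒜] [GradedRing ℬ] (f : GradedRingHom 𝒜 ℬ) (g : GradedRingHom ℬ 𝒜)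
    (h : ∀ b, f (g b) = b) (h' : ∀ a, g (f a) = a) (x : Proj ℬ) (a : A) :
    a ∈ idealAt ((projIso f g h h').hom x) ↔ f a ∈ idealAt x := Iff.rfl

/-- The isomorphism `X_t ≅ X_{t'}` which divides the last coordinate by `c`, where `t' = c.t`. -/
def rescaleIso {c : ℂ} (hc : c ≠ 0) (h : t' = rescale c t) : Proj (coordPiece t) ≅ Proj (coordPiece t') :=
  projIso (scaleHom (rescale_inv hc h)) (scaleHom h)
    (scaleHom_scaleHom (rescale_inv hc h) h (inv_mul_cancel₀ hc))
    (scaleHom_scaleHom h (rescale_inv hc h) (mul_inv_cancel₀ hc))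

lemma rescaleIso_comp {c : ℂ} (hc : c ≠ 0) (h : t' = rescale c t) :
    (rescaleIso hc h).hom ≫ (hypersurface t').hom = (hypersurface t).hom :=
  map_comp_toSpecZero (scaleHom (rescale_inv hc h)) _ (algebraMap ℂ (coordPiece t' 0)) (algebraMap ℂ (coordPiece t 0))
    (scaleHom_algebraMap (rescale_inv hc h))

lemma mem_divisorAtInfinity_rescaleIso {c : ℂ} (hc : c ≠ 0) (h : t' = rescale c t) (x : Proj (coordPiece t)) :
    (rescaleIso hc h).hom x ∈ (divisorAtInfinity t' : Set (Proj (coordPiece t'))) ↔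
      x ∈ (divisorAtInfinity t : Set (Proj (coordPiece t))) := by
  rw [mem_divisorAtInfinity, mem_divisorAtInfinity, rescaleIso, idealAt_projIso, scaleHom_coordVar_last]
  refine ⟨fun h2 => ?_, fun h2 => Ideal.mul_mem_left _ _ h2⟩
  have h3 := Ideal.mul_mem_left _ (coordMk t (C c)) h2
  rwa [← mul_assoc, ← map_mul, ← map_mul, mul_inv_cancel₀ hc, map_one, map_one, one_mul] at h3

lemma pairIso_of_leftIso {X X' : ComplexScheme} {D : Closeds X.left} {D' : Closeds X'.left} (e : X.left ≅ X'.left)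
    (w : e.hom ≫ X'.hom = X.hom) (h : ∀ x, e.hom x ∈ (D' : Set X'.left) ↔ x ∈ (D : Set X.left)) : PairIso X D X' D' :=
  ⟨Over.isoMk e w, Set.ext h⟩

/-- The parameters `t` and `c.t` give isomorphic pairs, by a coordinate change of the last variable. -/
theorem pairIso_of_rescale {c : ℂ} (hc : c ≠ 0) (h : t' = rescale c t) :
    PairIso (hypersurface t) (infiniteDivisor t) (hypersurface t') (infiniteDivisor t') :=
  pairIso_of_leftIso (X := hypersurface t) (X' := hypersurface t') (rescaleIso hc h) (rescaleIso_comp hc h)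
    (mem_divisorAtInfinity_rescaleIso hc h)

end Rescale

end

/-! ### Sections of `𝒪(D_t)` -/

section

open MvPolynomial

section Divisor

variable {m : ℕ}

/-- The global sections of `𝒪_{X_t}(D_t)` are the constants, since `x_{n+1}` spans the part of degree one of the
coordinate ring. -/
lemma exists_restrictOff_of_poleOrderLE_one (t : Params (m + 1)) (s : PuncturedSections (divisorAtInfinity t) ⊤)
    (hs : PoleOrderLE (divisorAtInfinity t) 1 s) : ∃ f, s = restrictOff (divisorAtInfinity t) ⊤ f := by
  obtain ⟨_, ⟨g, hg, rfl⟩, h⟩ := (poleOrderLE_iff t 1 s).mp hs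
  set c := coeff (Finsupp.single (Fin.last (m + 2)) 1) g
  have hg' : g = C c * X (Fin.last _) := eq_C_mul_of_homogeneous_one (by omega) hg
  refine ⟨globalConst (hypersurface t) c, genericValue_injective t ?_⟩
  rw [genericValue_globalConst]
  have hz : toCoordField t (coordVar t (Fin.last _)) ≠ 0 := fun h =>
    coordVar_last_ne_zero t ((toCoordField_eq_zero_iff t _).mp h)
  refine mul_right_cancel₀ hz ?_
  rw [pow_one] at h
  rw [h, ← map_mul, hg']
  congr 1

/-- If `e_* 𝒪_X(D) ≅ 𝒪(D_t)`, then `D_t` is contained in the image of `D`: outside this image all sections of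
`𝒪(D_t)` would be regular. -/
lemma preimage_mem_of_iso (t : Params (m + 1)) {X : Scheme.{0}} {D : Closeds X} (e : X ≅ Proj (coordPiece t))
    (ψ : (Scheme.Modules.pushforward e.hom).obj (divisorialSheaf D 1) ≅ divisorialSheaf (divisorAtInfinity t) 1)
    (x : Proj (coordPiece t)) (hx : x ∈ (divisorAtInfinity t : Set (Proj (coordPiece t)))) : e.inv x ∈ D := by
  by_contra hxD
  have h1 : ∀ x, e.inv (e.hom x) = x := fun x => congr($(e.hom_inv_id) x)
  refine disjoint_of_sections_extend (U := e.inv ⁻¹ᵁ D.compl) (genericPt_mem t) (genericPt_notMem t)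
    (mem_divisorAtInfinity t) (idealAt_divisorPt t)
    (coordVar_last_mem t) (prime_coordVar_last t) (prod_coordVar_mem t) (coordVar_zero_mem t)
    (not_dvd_prod_coordVar t) (not_dvd_coordVar_zero t) (fun V hV s hs => ?_) x hxD hx
  refine exists_restrictOff_of_iso e ψ (exists_restrictOff_of_poleOrderLE_one t) V (fun y hy => ?_) s hs
  have : e.inv (e.hom y) ∉ D := hV hy
  rwa [h1] at this

end Divisor

end

/-! ### The case `n = 0` -/

section

open MvPolynomial

section Points

variable {n : ℕ} {t : Params n}

/-- The homomorphism `x_j ↦ φ(x_j) T ^ {w_j} / φ(x_{n+1}) ^ {w_j}` on the coordinate ring. -/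
def coordValue (φ : CoordRing t →+* ℂ) : CoordRing t →+* Polynomial ℂ :=
  Ideal.Quotient.lift _ (polyValue φ) fun g hg => by
    obtain ⟨k, rfl⟩ := Ideal.mem_span_singleton.mp hg
    rw [map_mul, polyValue_of_homogeneous (normalForm_isWeightedHomogeneous t),
      (coordMk_eq_zero_iff t _).mpr dvd_rfl, map_zero, zero_div, map_zero, zero_mul, zero_mul]

lemma coordValue_coordMk (φ : CoordRing t →+* ℂ) (g : PolyRing n) : coordValue φ (coordMk t g) = polyValue φ g := rfl

/-- This presentation shows that the kernel is a homogeneous ideal. -/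
lemma ker_coordValue (φ : CoordRing t →+* ℂ) :
    RingHom.ker (coordValue φ) = Ideal.span {b | coordValue φ b = 0 ∧ ∃ i, b ∈ coordPiece t i} := by
  apply le_antisymm
  · intro a ha
    obtain ⟨g, rfl⟩ : ∃ g, coordMk t g = a := Ideal.Quotient.mk_surjective a
    obtain ⟨S, hS, -⟩ := eq_sum_components g
    rw [hS, map_sum]
    refine Ideal.sum_mem _ fun i _ => Ideal.subset_span ⟨?_, i, coordMk_mem t
      (weightedHomogeneousComponent_isWeightedHomogeneous i g)⟩
    have h1 := coeff_polyValue (φ := φ) g i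
    rw [show polyValue φ g = 0 from ha, Polynomial.coeff_zero] at h1
    rw [coordValue_coordMk, polyValue_of_homogeneous (weightedHomogeneousComponent_isWeightedHomogeneous i g), ← h1,
      map_zero, zero_mul]
  · rw [Ideal.span_le]
    rintro b ⟨hb, -⟩
    exact hb

/-- The point of `X_t` with coordinates `φ(x_j)`, where `φ(x_{n+1}) ≠ 0`. -/
def valuePoint (φ : CoordRing t →+* ℂ) (hφ : φ (coordVar t (Fin.last _)) ≠ 0) : Proj (coordPiece t) :=
  ProjectiveSpectrum.mk (𝒜 := coordPiece t)
    ⟨RingHom.ker (coordValue φ), by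
      rw [ker_coordValue]
      exact Ideal.homogeneous_span _ _ fun b hb => hb.2⟩
    (RingHom.ker_isPrime _) fun h => by
      have h1 : coordVar t (Fin.last _) ∈ HomogeneousIdeal.irrelevant (coordPiece t) := by
        rw [HomogeneousIdeal.mem_irrelevant_iff, GradedRing.proj_apply,
          DirectSum.decompose_of_mem_ne _ (coordVar_mem t _) (wt_pos _).ne']
      have h2 : coordValue φ (coordVar t (Fin.last _)) = 0 := h h1
      rw [coordVar, coordValue_coordMk, polyValue_X, wt_last, pow_one, pow_one, div_self hφ, map_one, one_mul] at h2
      exact Polynomial.X_ne_zero h2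

lemma mem_idealAt_valuePoint (φ : CoordRing t →+* ℂ) (hφ : φ (coordVar t (Fin.last _)) ≠ 0) (g : PolyRing n) :
    coordMk t g ∈ idealAt (valuePoint φ hφ) ↔ polyValue φ g = 0 := Iff.rfl

/-- Not all coordinates vanish at a point of `X_t`. -/
lemma exists_notMem_idealAt (x : Proj (coordPiece t)) : ∃ j, coordVar t j ∉ idealAt x := by
  by_contra! h
  refine x.not_irrelevant_le ((HomogeneousIdeal.toIdeal_irrelevant_le _).mpr ?_)
  rintro i hi _ ⟨g, hg, rfl⟩
  change coordMk t g ∈ idealAt x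
  rw [g.as_sum, map_sum]
  refine Ideal.sum_mem _ fun d hd => ?_
  have h1 : d ≠ 0 := by
    rintro rfl
    have := hg (mem_support_iff.mp hd)
    rw [map_zero] at this
    exact hi.ne this
  obtain ⟨j, hj⟩ := Finsupp.ne_iff.mp h1
  obtain ⟨q, hq⟩ : X j ∣ monomial d (coeff d g) := X_dvd_monomial.mpr (Or.inr hj)
  rw [hq, map_mul]
  exact Ideal.mul_mem_right _ _ (h j)

end Points

section PointPairs

lemma deg_zero : deg 0 = 2 := by
  rw [deg, zero_add, Finset.prod_range_one, sylvester_zero]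

lemma Idx.apply_eq_zero (i : Idx 0) (k : Fin (0 + 1)) : (i.1 k : ℕ) = 0 := by
  have h : (i.1 k : ℕ) < sylvester k - 1 := (i.1 k).2
  have hk : sylvester k = 2 := by
    rw [show (k : ℕ) = 0 by omega, sylvester_zero]
  omega

lemma Idx.weight_eq_two (i : Idx 0) : i.weight = 2 := by
  rw [Idx.weight, Finset.sum_eq_zero fun k _ => by rw [i.apply_eq_zero, zero_mul], deg_zero, Nat.sub_zero]

instance : Subsingleton (Idx 0) :=
  ⟨fun i j => Subtype.ext <| funext fun k => Fin.ext <| by rw [i.apply_eq_zero, j.apply_eq_zero]⟩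

instance : Inhabited (Idx 0) :=
  ⟨⟨fun k => ⟨0, by
      obtain rfl : k = 0 := Fin.ext (by omega)
      rw [Fin.val_zero, sylvester_zero]
      exact one_pos⟩, by
    rw [Finset.sum_eq_zero fun k _ => zero_mul _, deg_zero]
    exact two_pos⟩⟩

/-- For `n = 0` there is just one parameter: `F_t = x_0 ^ 2 + t x_1 ^ 2`. -/
lemma normalForm_zero (t : Params 0) :
    normalForm t = X (Fin.castSucc 0) ^ 2 + C (t default) * X (Fin.last _) ^ 2 := by
  have h1 : ∀ f : Fin (0 + 1) → PolyRing 0, ∑ k, f k = f 0 := fun f => Fin.sum_univ_one f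
  rw [normalForm, h1, Fintype.sum_subsingleton (ι := Idx 0) _ default, Fin.val_zero, sylvester_zero, Idx.weight_eq_two,
    Finset.prod_eq_one fun k _ => by rw [Idx.apply_eq_zero, pow_zero], mul_one]

lemma eq_zero_iff_default (t : Params 0) : t = 0 ↔ t default = 0 :=
  ⟨fun h => by rw [h]; rfl, fun h => funext fun i => by rw [Subsingleton.elim i default, h]; rfl⟩

lemma exists_rescale_of_zero {t t' : Params 0} (h : t = 0 ↔ t' = 0) : ∃ c : ℂ, c ≠ 0 ∧ t' = rescale c t := by
  by_cases ht : t = 0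
  · exact ⟨1, one_ne_zero, by rw [h.mp ht, ht]; funext i; simp [rescale]⟩
  · have ht' := mt h.mpr ht
    rw [eq_zero_iff_default] at ht ht'
    obtain ⟨c, hc⟩ := IsAlgClosed.exists_pow_nat_eq (t' default / t default) (n := 2) two_pos
    refine ⟨c, ?_, funext fun i => ?_⟩
    · rintro rfl
      rw [zero_pow two_ne_zero, eq_comm, div_eq_zero_iff] at hc
      tauto
    · rw [Subsingleton.elim i default, rescale, Idx.weight_eq_two, hc, div_mul_cancel₀ _ ht]

lemma coordVar_relation (t : Params 0) :
    coordVar t (Fin.castSucc 0) ^ 2 + algebraMap ℂ (CoordRing t) (t default) * coordVar t (Fin.last _) ^ 2 = 0 := by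
  have h := (coordMk_eq_zero_iff t _).mpr (normalForm_zero t).dvd
  rwa [map_add, map_mul, map_pow, map_pow] at h

/-- For `n = 0` the divisor `D_t` is empty. -/
lemma coordVar_last_notMem_of_zero (t : Params 0) (x : Proj (coordPiece t)) : coordVar t (Fin.last _) ∉ idealAt x := by
  intro h
  have h0 : coordVar t (Fin.castSucc 0) ∈ idealAt x := by
    refine (inferInstance : (idealAt x).IsPrime).mem_of_pow_mem 2 ?_
    rw [eq_neg_of_add_eq_zero_left (coordVar_relation t)]
    exact neg_mem (Ideal.mul_mem_left _ _ (Ideal.pow_mem_of_mem _ h 2 two_pos))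
  obtain ⟨j, hj⟩ := exists_notMem_idealAt x
  induction j using Fin.lastCases with
  | last => exact hj h
  | cast k =>
    obtain rfl : k = 0 := Fin.ext (by omega)
    exact hj h0

/-- For `t = 0` the variable `x_0` is nilpotent, so modulo the prime ideal of a point only powers of `x_1` remain. -/
lemma sub_mem_idealAt_of_zero {g : PolyRing 0} {i : ℕ} (hg : IsWeightedHomogeneous (wt 0) g i)
    (x : Proj (coordPiece (0 : Params 0))) :
    coordMk 0 g - coordMk 0 (C (coeff (Finsupp.single (Fin.last 1) i) g) * X (Fin.last 1) ^ i) ∈ idealAt x := by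
  have h0 : coordVar (0 : Params 0) (Fin.castSucc 0) ∈ idealAt x := by
    refine (inferInstance : (idealAt x).IsPrime).mem_of_pow_mem 2 ?_
    have h := coordVar_relation (0 : Params 0)
    rw [Pi.zero_apply, map_zero, zero_mul, add_zero] at h
    rw [h]
    exact zero_mem _
  rw [← map_sub, X_pow_eq_monomial, C_mul_monomial, mul_one]
  set h := g - monomial (Finsupp.single (Fin.last 1) i) (coeff (Finsupp.single (Fin.last 1) i) g) with hh
  rw [h.as_sum, map_sum]
  refine Ideal.sum_mem _ fun d hd => ?_
  have hd' := mem_support_iff.mp hd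
  rw [hh, coeff_sub, coeff_monomial] at hd'
  have hne : Finsupp.single (Fin.last 1) i ≠ d := by
    rintro rfl
    rw [if_pos rfl, sub_self] at hd'
    exact hd' rfl
  rw [if_neg hne, sub_zero] at hd'
  have hw : Finsupp.weight (wt 0) d = i := hg hd'
  have hd0 : d (Fin.castSucc 0) ≠ 0 := by
    intro h0
    have h1 : d = Finsupp.single (Fin.last 1) (d (Fin.last 1)) := by
      ext j
      induction j using Fin.lastCases with
      | last => rw [Finsupp.single_eq_same]
      | cast k =>
        obtain rfl : k = 0 := Fin.ext (by omega)
        rw [h0, Finsupp.single_eq_of_ne (Fin.castSucc_lt_last _).ne]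
    rw [h1, weight_single, wt_last, mul_one] at hw
    exact hne (by rw [← hw]; exact h1.symm)
  obtain ⟨q, hq⟩ : X (Fin.castSucc 0) ∣ monomial d (coeff d h) := X_dvd_monomial.mpr (Or.inr hd0)
  rw [hq, map_mul]
  exact Ideal.mul_mem_right _ _ h0

/-- For `t = 0` the only point of `X_t` is given by `x_0 = 0`. -/
lemma subsingleton_of_eq_zero : Subsingleton (Proj (coordPiece (0 : Params 0))) := by
  have key : ∀ x y : Proj (coordPiece (0 : Params 0)), idealAt x ≤ idealAt y := by
    classical
    intro x y a ha
    rw [← DirectSum.sum_support_decompose (coordPiece (0 : Params 0)) a]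
    refine Ideal.sum_mem _ fun i _ => ?_
    have hx : (DirectSum.decompose (coordPiece (0 : Params 0)) a i : CoordRing (0 : Params 0)) ∈ idealAt x :=
      x.asHomogeneousIdeal.isHomogeneous i ha
    obtain ⟨g, hg, hga⟩ := (DirectSum.decompose (coordPiece (0 : Params 0)) a i).2
    rw [← hga] at hx ⊢
    change coordMk 0 g ∈ idealAt x at hx
    change coordMk 0 g ∈ idealAt y
    have h1 := sub_mem_idealAt_of_zero hg
    have h2 := (Submodule.sub_mem_iff_right _ hx).mp (h1 x)
    have h3 : coeff (Finsupp.single (Fin.last 1) i) g = 0 := by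
      by_contra hc
      refine coordVar_last_notMem_of_zero 0 x ((inferInstance : (idealAt x).IsPrime).mem_of_pow_mem i ?_)
      have h4 := Ideal.mul_mem_left _ (coordMk 0 (C (coeff (Finsupp.single (Fin.last 1) i) g)⁻¹)) h2
      rw [← map_mul, ← mul_assoc, ← C_mul, inv_mul_cancel₀ hc, C_1, one_mul, map_pow] at h4
      exact h4
    have h5 := h1 y
    rwa [h3, C_0, zero_mul, map_zero, sub_zero] at h5
  exact ⟨fun x y => ((specializes_of_le (key x y)).antisymm (specializes_of_le (key y x))).eq⟩

/-- For `t ≠ 0` there are two points, given by the two square roots of `-t_0`. -/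
lemma not_subsingleton_of_ne_zero {t : Params 0} (ht : t ≠ 0) : ¬ Subsingleton (Proj (coordPiece t)) := by
  rw [Ne, eq_zero_iff_default] at ht
  obtain ⟨a, ha⟩ := IsAlgClosed.exists_pow_nat_eq (-t default) (n := 2) two_pos
  have ha0 : a ≠ 0 := by
    rintro rfl
    rw [zero_pow two_ne_zero, eq_comm, neg_eq_zero] at ha
    exact ht ha
  have hφ : ∀ b : ℂ, b ^ 2 = -t default → ∃ φ : CoordRing t →+* ℂ, (∀ c, φ (algebraMap ℂ (CoordRing t) c) = c) ∧
      φ (coordVar t (Fin.castSucc 0)) = b ∧ φ (coordVar t (Fin.last _)) = 1 := by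
    intro b hb
    let v : Fin (0 + 2) → ℂ := Fin.snoc (α := fun _ => ℂ) (fun _ : Fin (0 + 1) => b) 1
    have h0 : eval v (normalForm t) = 0 := by
      rw [normalForm_zero, map_add, map_mul, map_pow, map_pow, eval_X, eval_X, eval_C,
        show v (Fin.castSucc 0) = b from Fin.snoc_castSucc _ _ _, show v (Fin.last _) = 1 from Fin.snoc_last _ _, hb, one_pow, mul_one, neg_add_cancel]
    refine ⟨Ideal.Quotient.lift _ (eval v) fun g hg => ?_, fun c => ?_, ?_, ?_⟩
    · obtain ⟨k, rfl⟩ := Ideal.mem_span_singleton.mp hg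
      rw [map_mul, h0, zero_mul]
    · exact eval_C c
    · exact (eval_X _).trans (Fin.snoc_castSucc _ _ _)
    · exact (eval_X _).trans (Fin.snoc_last _ _)
  have hval : ∀ φ : CoordRing t →+* ℂ, (∀ c, φ (algebraMap ℂ (CoordRing t) c) = c) → 
      φ (coordVar t (Fin.last _)) = 1 → polyValue φ (X (Fin.castSucc 0) - C a * X (Fin.last _)) =
        Polynomial.C (φ (coordVar t (Fin.castSucc 0)) - a) * Polynomial.X := by
    intro φ hC h1
    have hw : wt 0 (Fin.castSucc 0) = 1 := by
      rw [wt_castSucc, degVar, Fin.val_zero]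
      rfl
    rw [map_sub, map_mul, polyValue_X, polyValue_X, polyValue_C, hC, hw, wt_last, h1, pow_one, pow_one, div_one, div_one,
      map_one, one_mul, map_sub, sub_mul]
  obtain ⟨φ, hC, h0, h1⟩ := hφ a ha
  obtain ⟨φ', hC', h0', h1'⟩ := hφ (-a) (by rw [neg_sq, ha])
  intro hs
  have h2 := (mem_idealAt_valuePoint φ (by rw [h1]; exact one_ne_zero) (X (Fin.castSucc 0) - C a * X (Fin.last _))).mpr
    (by rw [hval φ hC h1, h0, sub_self, map_zero, zero_mul])
  rw [Subsingleton.elim (valuePoint φ (by rw [h1]; exact one_ne_zero))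
    (valuePoint φ' (by rw [h1']; exact one_ne_zero)), mem_idealAt_valuePoint, hval φ' hC' h1', h0', mul_eq_zero] at h2
  refine h2.elim (fun h => ?_) Polynomial.X_ne_zero
  have h3 : -a - a = 0 := Polynomial.C_eq_zero.mp h
  exact ha0 (by linear_combination (-1 / 2) * h3)

end PointPairs

end

/-! ### Isomorphism classes of pairs -/

section

open MvPolynomial

section Conclusion

variable {n : ℕ}

lemma inv_mem_of_sheafIso {m : ℕ} (t : Params (m + 1)) {X : Scheme.{0}} {D : Closeds X} (e : X ≅ (hypersurface t).left)
    (h : Nonempty ((Scheme.Modules.pushforward e.hom).obj (divisorialSheaf D 1) ≅ divisorialSheaf (infiniteDivisor t) 1))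
    (x : (hypersurface t).left) (hx : x ∈ (infiniteDivisor t : Set (hypersurface t).left)) :
    e.inv x ∈ (D : Set X) :=
  h.elim fun ψ => preimage_mem_of_iso t e ψ x hx

lemma notMem_infiniteDivisor_of_zero (t : Params 0) (x : (hypersurface t).left) :
    x ∉ (infiniteDivisor t : Set (hypersurface t).left) :=
  fun hx => coordVar_last_notMem_of_zero t x ((mem_divisorAtInfinity t x).mp hx)

/-- For an isomorphism, two inclusions give `e⁻¹ D' = D`. -/
lemma preimage_eq_of_inv_mem {X X' : Scheme.{0}} {D : Set X} {D' : Set X'} (e : X ≅ X')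
    (h : ∀ x ∈ D, e.hom x ∈ D') (h' : ∀ x ∈ D', e.inv x ∈ D) (x : X) : e.hom x ∈ D' ↔ x ∈ D := by
  refine ⟨fun hx => ?_, h x⟩
  have h1 := h' _ hx
  rwa [show e.inv (e.hom x) = x from congr($(e.hom_inv_id) x)] at h1

lemma mem_of_sheafIso (t t' : Params n) (e : (hypersurface t).left ≅ (hypersurface t').left)
    (h : Nonempty ((Scheme.Modules.pushforward e.hom).obj (divisorialSheaf (infiniteDivisor t) 1) ≅
      divisorialSheaf (infiniteDivisor t') 1)) (x : (hypersurface t).left) :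
    e.hom x ∈ (infiniteDivisor t' : Set (hypersurface t').left) ↔
      x ∈ (infiniteDivisor t : Set (hypersurface t).left) := by
  cases n with
  | zero => exact iff_of_false (notMem_infiniteDivisor_of_zero t' _) (notMem_infiniteDivisor_of_zero t _)
  | succ m =>
    exact preimage_eq_of_inv_mem e (inv_mem_of_sheafIso t e.symm (nonempty_pushforward_symm e h))
      (inv_mem_of_sheafIso t' e h) x

lemma nonempty_pushforward_iso_iff {X X' : ComplexScheme} {D : Closeds X.left} {D' : Closeds X'.left} (φ : X ≅ X')
    (h : Nonempty ((Scheme.Modules.pushforward (leftIso φ).hom).obj (divisorialSheaf D 1) ≅ divisorialSheaf D' 1) →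
      ∀ x, (leftIso φ).hom x ∈ (D' : Set X'.left) ↔ x ∈ (D : Set X.left)) :
    Nonempty ((Scheme.Modules.pushforward φ.hom.left).obj (divisorialSheaf D 1) ≅ divisorialSheaf D' 1) ↔
      (φ.hom.left : X.left → X'.left) ⁻¹' (D' : Set X'.left) = D :=
  ⟨fun h1 => Set.ext (h h1), fun h1 => nonempty_pushforward_iso (leftIso φ) (fun x => Set.ext_iff.mp h1 x) 1⟩

/-- The sheaf determines the divisor, and conversely. -/
theorem sheafIso_iff (t t' : Params n) (φ : hypersurface t ≅ hypersurface t') :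
    Nonempty ((Scheme.Modules.pushforward φ.hom.left).obj (divisorialSheaf (infiniteDivisor t) 1) ≅
        divisorialSheaf (infiniteDivisor t') 1) ↔
      (φ.hom.left : (hypersurface t).left → (hypersurface t').left) ⁻¹'
        (infiniteDivisor t' : Set (hypersurface t').left) = infiniteDivisor t :=
  nonempty_pushforward_iso_iff φ (mem_of_sheafIso t t' (leftIso φ))

lemma PairIso.exists_sectionRing_equiv {X X' : ComplexScheme} {D : Closeds X.left} {D' : Closeds X'.left}
    (h : PairIso X D X' D') :
    ∃ E : sectionRing D' ≃+* sectionRing D, (∀ c, E (sectionConst X' D' c) = sectionConst X D c) ∧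
      ∀ (m : ℕ) (s : sectionRing D'), s ∈ sectionPiece D' m → E s ∈ sectionPiece D m :=
  h.elim fun φ hφ => exists_sectionRing_equiv_of_iso φ fun x => Set.ext_iff.mp hφ x

lemma PairIso.nonempty_homeomorph {X X' : ComplexScheme} {D : Closeds X.left} {D' : Closeds X'.left}
    (h : PairIso X D X' D') : Nonempty (X.left ≃ₜ X'.left) :=
  h.elim fun φ _ => ⟨Scheme.homeoOfIso (leftIso φ)⟩

/-- Transport of generators of the section ring along an isomorphism of pairs. -/
lemma IsGeneratingSystem.of_equiv {X X' : ComplexScheme} {D : Closeds X.left} {D' : Closeds X'.left}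
    {E : sectionRing D' ≃+* sectionRing D} (hE : ∀ c, E (sectionConst X' D' c) = sectionConst X D c)
    (hE' : ∀ (m : ℕ) (s : sectionRing D'), s ∈ sectionPiece D' m → E s ∈ sectionPiece D m)
    {y : Fin (n + 2) → sectionRing D'} (hy : IsGeneratingSystem X' D' y) :
    IsGeneratingSystem X D (fun j => E (y j)) ∧ ∀ g : PolyRing n,
      eval₂Hom (sectionConst X D) (fun j => E (y j)) g = E (eval₂Hom (sectionConst X' D') y g) := by
  have h1 : ∀ g : PolyRing n,
      eval₂Hom (sectionConst X D) (fun j => E (y j)) g = E (eval₂Hom (sectionConst X' D') y g) := by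
    intro g
    have h2 : eval₂Hom (sectionConst X D) (fun j => E (y j)) =
        (E : sectionRing D' →+* sectionRing D).comp (eval₂Hom (sectionConst X' D') y) := by
      refine MvPolynomial.ringHom_ext (fun c => ?_) fun j => ?_
      · rw [eval₂Hom_C, RingHom.comp_apply, eval₂Hom_C]
        exact (hE c).symm
      · rw [eval₂Hom_X', RingHom.comp_apply, eval₂Hom_X']
        rfl
    exact congr($h2 g)
  refine ⟨⟨fun j => hE' _ _ (hy.1 j), fun b => ?_⟩, h1⟩
  obtain ⟨g, hg⟩ := hy.2 (E.symm b)
  exact ⟨g, by rw [h1, hg, E.apply_symm_apply]⟩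

/-- The pair determines the parameters up to the action of the torus. -/
theorem exists_rescale_of_pairIso {t t' : Params n}
    (h : PairIso (hypersurface t) (infiniteDivisor t) (hypersurface t') (infiniteDivisor t')) :
    ∃ c : ℂ, c ≠ 0 ∧ t' = rescale c t := by
  cases n with
  | zero =>
    -- the number of points of `X_t` tells whether `t = 0`
    refine exists_rescale_of_zero ?_
    obtain ⟨e⟩ : Nonempty (Proj (coordPiece t) ≃ₜ Proj (coordPiece t')) := h.nonempty_homeomorph
    constructor
    · rintro rfl
      by_contra h'
      have := subsingleton_of_eq_zero
      exact not_subsingleton_of_ne_zero h' e.symm.injective.subsingleton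
    · rintro rfl
      by_contra h'
      have := subsingleton_of_eq_zero
      exact not_subsingleton_of_ne_zero h' e.injective.subsingleton
  | succ m =>
    obtain ⟨e, he, heg, -⟩ := exists_sectionRing_equiv t
    obtain ⟨e', he', heg', -⟩ := exists_sectionRing_equiv t'
    obtain ⟨E, hE, hE'⟩ := h.exists_sectionRing_equiv
    obtain ⟨y, hy, hy0⟩ := (exists_generators_iff (by omega) he' heg' t').mpr ⟨1, one_ne_zero, by
      funext i; simp [rescale]⟩
    obtain ⟨h1, h2⟩ := hy.of_equiv hE hE'
    exact (exists_generators_iff (by omega) he heg t').mp ⟨_, h1, by rw [h2, hy0, map_zero]⟩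

/-- Isomorphisms of pairs, of varieties with a sheaf, and orbits of the torus action. -/
theorem pairIso_tfae (t t' : Params n) :
    List.TFAE
      [∃ c : ℂ, c ≠ 0 ∧ t' = rescale c t,
        PairIso (hypersurface t) (infiniteDivisor t) (hypersurface t') (infiniteDivisor t'),
        SheafPairIso (hypersurface t) (divisorialSheaf (infiniteDivisor t) 1)
          (hypersurface t') (divisorialSheaf (infiniteDivisor t') 1)] := by
  tfae_have 1 → 2 := fun ⟨c, hc, h⟩ => pairIso_of_rescale hc h
  tfae_have 2 → 1 := exists_rescale_of_pairIso
  tfae_have 2 ↔ 3 := exists_congr fun φ => (sheafIso_iff t t' φ).symm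
  tfae_finish

theorem pairIso_iff_moduliPoint_eq (t t' : Params n) (ht : t ≠ 0) (ht' : t' ≠ 0) :
    PairIso (hypersurface t) (infiniteDivisor t) (hypersurface t') (infiniteDivisor t') ↔
      moduliPoint t ht = moduliPoint t' ht' :=
  ((pairIso_tfae t t').out 1 0).trans Quotient.eq.symm

end Conclusion

end

end SylvesterPair

end

theorem mainTheorem9 (n : ℕ) :
    -- the section ring is the weighted polynomial ring modulo the equation
    (1 ≤ n → ∀ t : Params n,
      ∃ e : CoordRing t ≃+* sectionRing (infiniteDivisor t),
        (∀ c : ℂ, e (algebraMap ℂ (CoordRing t) c) =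
          sectionConst (hypersurface t) (infiniteDivisor t) c) ∧
        (∀ (m : ℕ) (a : CoordRing t),
          a ∈ coordPiece t m ↔ e a ∈ sectionPiece (infiniteDivisor t) m) ∧
        (e (coordMk t (MvPolynomial.X (Fin.last (n + 1))))).1 = Polynomial.X) ∧
    -- unique normalization of an equation by completing powers
    (∀ g : PolyRing n, MvPolynomial.IsWeightedHomogeneous (wt n) g (deg n) →
      ∀ a : Fin (n + 1) → ℂ,
        (∀ k : Fin (n + 1), a k ^ sylvester k *
          MvPolynomial.coeff (Finsupp.single k.castSucc (sylvester k)) g = 1) →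
        ∃! pt : (Fin (n + 1) → PolyRing n) × Params n,
          (∀ k : Fin (n + 1),
            MvPolynomial.IsWeightedHomogeneous (wt n) (pt.1 k) (degVar n k) ∧
              ∀ j ∈ (pt.1 k).vars, k.castSucc < j) ∧
          MvPolynomial.aeval
              (Fin.snoc (α := fun _ => PolyRing n)
                (fun k : Fin (n + 1) =>
                  MvPolynomial.C (a k) * MvPolynomial.X k.castSucc + pt.1 k)
                (MvPolynomial.X (Fin.last (n + 1)))) g =
            normalForm pt.2) ∧
    -- the equation is determined, up to scaling, by the section ring
    (1 ≤ n → ∀ t : Params n,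
      (∀ y : Fin (n + 2) → sectionRing (infiniteDivisor t),
        IsGeneratingSystem (hypersurface t) (infiniteDivisor t) y →
          ∃ g : PolyRing n, MvPolynomial.IsWeightedHomogeneous (wt n) g (deg n) ∧
            (∀ k : Fin (n + 1),
              MvPolynomial.coeff (Finsupp.single k.castSucc (sylvester k)) g ≠ 0) ∧
            RingHom.ker (MvPolynomial.eval₂Hom
              (sectionConst (hypersurface t) (infiniteDivisor t)) y) = Ideal.span {g}) ∧
      (∀ t' : Params n,
        (∃ y : Fin (n + 2) → sectionRing (infiniteDivisor t),
          IsGeneratingSystem (hypersurface t) (infiniteDivisor t) y ∧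
            MvPolynomial.eval₂Hom
              (sectionConst (hypersurface t) (infiniteDivisor t)) y (normalForm t') = 0) ↔
        ∃ c : ℂ, c ≠ 0 ∧ t' = rescale c t)) ∧
    -- the sheaf determines the divisor
    (∀ (t t' : Params n) (φ : hypersurface t ≅ hypersurface t'),
      Nonempty ((AlgebraicGeometry.Scheme.Modules.pushforward φ.hom.left).obj
          (divisorialSheaf (infiniteDivisor t) 1) ≅ divisorialSheaf (infiniteDivisor t') 1) ↔
        (φ.hom.left : (hypersurface t).left → (hypersurface t').left) ⁻¹'
          (infiniteDivisor t' : Set (hypersurface t').left) = infiniteDivisor t) ∧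
    -- the equation is intrinsic to the pair, and to the variety with the sheaf
    (∀ t t' : Params n,
      List.TFAE
        [∃ c : ℂ, c ≠ 0 ∧ t' = rescale c t,
          PairIso (hypersurface t) (infiniteDivisor t) (hypersurface t') (infiniteDivisor t'),
          SheafPairIso (hypersurface t) (divisorialSheaf (infiniteDivisor t) 1)
            (hypersurface t') (divisorialSheaf (infiniteDivisor t') 1)]) ∧
    -- distinct points of the moduli space give non-isomorphic pairs
    (∀ (t t' : Params n) (ht : t ≠ 0) (ht' : t' ≠ 0),
      PairIso (hypersurface t) (infiniteDivisor t) (hypersurface t') (infiniteDivisor t') ↔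
        moduliPoint t ht = moduliPoint t' ht') := by
  refine ⟨fun hn t => ?_, fun g hg a ha => existsUnique_normalization hg ha, fun hn t => ?_, sheafIso_iff,
    pairIso_tfae, pairIso_iff_moduliPoint_eq⟩
  · obtain ⟨m, rfl⟩ : ∃ m, n = m + 1 := ⟨n - 1, by omega⟩
    exact exists_sectionRing_equiv t
  · obtain ⟨m, rfl⟩ : ∃ m, n = m + 1 := ⟨n - 1, by omega⟩
    obtain ⟨e, he, heg, -⟩ := exists_sectionRing_equiv t
    exact ⟨fun y hy => IsGeneratingSystem.exists_ker hn he heg hy, exists_generators_iff hn he heg⟩
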